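/- **Setting.** Let $n\ge 1$. For a strict partition $\lambda=(\lambda_1>\dots>\lambda_k>0)$ the shifted shape $S(\lambda)$ has boxes $(r,s)$ (row, column) with $1\le r\le k$, $r\le s\le r+\lambda_r-1$. For strict partitions with $S(\mu)\subseteq S(\lambda)$ put $S(\lambda/\mu)=S(\lambda)\setminus S(\mu)$. The main diagonal consists of the boxes $(r,r)$. The primed alphabet is $[n]'=\{1'<1<2'<2<\dots<n'<n\}$; write $\mathbf k$ for a letter that is $k$ or $k'$. A shifted semistandard tableau of shape $\lambda/\mu$ is a filling of $S(\lambda/\mu)$ with letters of $[n]'$ whose rows and columns are weakly increasing, with at most one $k$ in each column and at most one $k'$ in each row, for every $k$. Its reading word lists the rows from bottom to top, each from left to right. A filling is in canonical form if for every $k$ the first $\mathbf k$ in its reading word, if any, is unprimed; a filling is canonicalized by unpriming these letters. Let $\mathsf{ShST}(\lambda/\mu,n)$ be the set of shifted semistandard tableaux of shape $\lambda/\mu$ on $[n]'$ in canonical form. The weight is $\mathsf{wt}(T)=(wt_1,\dots,wt_n)$, where $wt_k$ is the number of boxes of $T$ holding $k$ or $k'$. A permutation $\tau\in\mathfrak S_n$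 acts on vectors by $\tau(v_1,\dots,v_n)=(v_{\tau^{-1}(1)},\dots,v_{\tau^{-1}(n)})$, and on fillings by $k\mapsto\tau(k)$, $k'\mapsto\tau(k)'$ in every box, followed by canonicalization. **Switching.** Let $a\ne b$ be in $[n]$. While some $\mathbf a$-box has a $\mathbf b$-box directly to its right or directly below it, choose the rightmost box $c$ holding $a$ with this property if there is one, and otherwise the lowest box $c$ holding $a'$ with this property. Let $c=(r,s)$, $e=(r,s+1)$ and $d=(r+1,s)$. * If both $e$ and $d$ are $\mathbf b$-boxes: exchange the entries of $c$ and $e$ if $e$ holds $b'$ (S5). If $e$ holds $b$, exchange the entries of $c$ and $d$ (S6), unless $s=r+1$, $c$ holds $a$ and $(r,r)$ is an $\mathbf a$-box (S7); in that exceptional case exchange the entries of $(r,r)$ and $(r+1,r+1)$ and replace the entry of $c$ by $a'$. * If only $e$ is a $\mathbf b$-box: exchange the entries of $c$ and $e$ (S1), unless $r=s$, $e$ holds $b'$ and $(r+1,r+1)$ is a $\mathbf b$-box (S3); in that exceptional case exchange the entries of $(r,r)$ and $(r+1,r+1)$ and replace the entry of $e$ by $b$. * If only $d$ is a $\mathbf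 b$-box: exchange the entries of $c$ and $d$ (S2), unless $s=r+1$, $c$ holds $a$ and $(r,r)$ is an $\mathbf a$-box (S4); in that exceptional case exchange the entries of $(r,r)$ and $(r+1,r+1)$ and replace the entry of $c$ by $a'$. The process is repeated until no $\mathbf a$-box has a $\mathbf b$-box directly to its right or directly below it; the result is $\mathsf{SP}_{a,b}(T)$. For $1\le i\le n-1$ let $\theta_i=(i,i+1)$, let $\mathsf t_i(T)=\theta_i\,\mathsf{SP}_{i,i+1}(T)$ be the shifted Bender–Knuth operator, and put $$\mathsf q_i=\mathsf t_1(\mathsf t_2\mathsf t_1)\cdots(\mathsf t_i\mathsf t_{i-1}\cdots\mathsf t_1)$$ (composition of maps, the rightmost being applied first). Let $\theta_{1,i+1}\in\mathfrak S_n$ be the longest permutation of $\{1,\dots,i+1\}$: $x\mapsto i+2-x$ for $x\le i+1$, and $x\mapsto x$ for $x>i+1$. **Corollary.** Let $S(\mu)\subseteq S(\lambda)$ and $1\le i\le n-1$. Then $\mathsf q_i$ maps $\mathsf{ShST}(\lambda/\mu,n)$ into itself, $\mathsf q_i^2=1$ on $\mathsf{ShST}(\lambda/\mu,n)$, and for every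 $T\in\mathsf{ShST}(\lambda/\mu,n)$ $$\mathsf{wt}(\mathsf q_i(T))=\theta_{1,i+1}(\mathsf{wt}(T)).$$ -/

import Mathlib

namespace ShiftedBK

/-- A strict partition: a strictly decreasing list of positive integers (possibly empty). -/
structure StrictPartition where
  parts : List ℕ
  sorted : parts.Pairwise (· > ·)
  pos : ∀ x ∈ parts, 0 < x

/-- A box is a pair (row, column), both counted from `0`, rows going downwards (English notation).
Row `r` of the shifted shape has `parts[r]` boxes and is shifted `r` units to the right. -/
abbrev Box := ℕ × ℕ

/-- The shifted shape of a strict partition. -/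
def StrictPartition.shape (l : StrictPartition) : Set Box :=
  {c | ∃ h : c.1 < l.parts.length, c.1 ≤ c.2 ∧ c.2 < c.1 + l.parts[c.1]}

/-- The skew shifted shape `l / m` (meaningful when `m.shape ⊆ l.shape`). -/
def skewShape (l m : StrictPartition) : Set Box := l.shape \ m.shape

/-- The primed alphabet `1' < 1 < 2' < 2 < ... < n' < n`; the element `val : Fin n` stands for
the number `val + 1`. -/
@[ext] structure Letter (n : ℕ) where
  val : Fin n
  primed : Bool
deriving DecidableEq

/-- The position of a letter in the total order `1' < 1 < 2' < 2 < ...`. -/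
def Letter.rank {n : ℕ} (x : Letter n) : ℕ := 2 * x.val + (if x.primed then 0 else 1)

/-- A filling of some set of boxes with letters: `none` means that the box is not filled. -/
abbrev Filling (n : ℕ) := Box → Option (Letter n)

variable {n : ℕ}

/-- The set of filled boxes. -/
def Filling.support (T : Filling n) : Set Box := {c | ∃ x, T c = some x}

/-- The box `c` holds `k` or `k'`. -/
def HasVal (T : Filling n) (k : Fin n) (c : Box) : Prop := ∃ p, T c = some ⟨k, p⟩

/-- Rows and columns are weakly increasing, there is at most one `k` in each column and at most
one `k'` in each row. -/
structure IsSemistandard (T : Filling n) : Prop where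
  row_le : ∀ r s s' x y, s < s' → T (r, s) = some x → T (r, s') = some y → x.rank ≤ y.rank
  col_le : ∀ r r' s x y, r < r' → T (r, s) = some x → T (r', s) = some y → x.rank ≤ y.rank
  col_unique : ∀ r r' s k, T (r, s) = some ⟨k, false⟩ → T (r', s) = some ⟨k, false⟩ → r = r'
  row_unique : ∀ r s s' k, T (r, s) = some ⟨k, true⟩ → T (r, s') = some ⟨k, true⟩ → s = s'

/-- `c` is read before `d` in the reading word (rows from bottom to top, each from left to
right). -/
def ReadsBefore (c d : Box) : Prop := d.1 < c.1 ∨ (c.1 = d.1 ∧ c.2 < d.2)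

/-- The first occurrence of `k` or `k'` in the reading word is unprimed, for every `k`. -/
def IsCanonical (T : Filling n) : Prop :=
  ∀ c k, T c = some ⟨k, true⟩ → ∃ d, ReadsBefore d c ∧ HasVal T k d

open Classical in
/-- The canonical form: unprime the first occurrence of `k` or `k'` in the reading word, for
every `k`. -/
noncomputable def canonicalize (T : Filling n) : Filling n := fun c =>
  (T c).map fun x =>
    if ∃ d, ReadsBefore d c ∧ HasVal T x.val d then x else ⟨x.val, false⟩

/-- The shifted semistandard tableaux of shape `l / m` on the alphabet `1' < 1 < ... < n' < n`,
in canonical form. -/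
def ShST (l m : StrictPartition) (n : ℕ) : Set (Filling n) :=
  {T | T.support = skewShape l m ∧ IsSemistandard T ∧ IsCanonical T}

/-- The weight: the `k`-th entry counts the boxes that hold `k` or `k'`. -/
noncomputable def weight (T : Filling n) : Fin n → ℕ := fun k => {c | HasVal T k c}.ncard

/-! ### Switches and the switching process -/

/-- Boolean version of `HasVal`. -/
def hasVal (T : Filling n) (k : Fin n) (c : Box) : Bool :=
  match T c with
  | some x => decide (x.val = k)
  | none => false

/-- The box to the right. -/
def Box.east (c : Box) : Box := (c.1, c.2 + 1)

/-- The box below. -/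
def Box.south (c : Box) : Box := (c.1 + 1, c.2)

/-- `c` is the neighbour to the west or to the north of a box holding `b` or `b'`. -/
def Touches (T : Filling n) (b : Fin n) (c : Box) : Prop :=
  HasVal T b (Box.east c) ∨ HasVal T b (Box.south c)

/-- Exchange the entries of two boxes. -/
def exchange (T : Filling n) (c d : Box) : Filling n := fun x => T (Equiv.swap c d x)

/-- The diagonal switch on the boxes `(r, r)`, `(r, r + 1)`, `(r + 1, r + 1)`, where the first two
hold `a`-letters and the last one a `b`-letter: the letters on the main diagonal are exchanged and
the middle box becomes `a'`. (These are the switches (S4) and (S7).) -/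
def diagSwitch (T : Filling n) (a : Fin n) (r : ℕ) : Filling n :=
  Function.update (exchange T (r, r) (r + 1, r + 1)) (r, r + 1) (some ⟨a, true⟩)

/-- The switch that is performed at an `a`-box `c` that has a `b`-box to its east or south. The
variable `diag` says that `c = (r, r + 1)` holds `a` and that `(r, r)` holds `a` or `a'`. -/
def switchAt (T : Filling n) (a b : Fin n) (c : Box) : Filling n :=
  let e := Box.east c
  let s := Box.south c
  let diag : Bool := decide (c.2 = c.1 + 1) && decide (T c = some ⟨a, false⟩)
    && hasVal T a (c.1, c.1)
  if hasVal T b e && hasVal T b s then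
    if T e = some ⟨b, true⟩ then exchange T c e                -- (S5)
    else if diag then diagSwitch T a c.1                       -- (S7)
    else exchange T c s                                        -- (S6)
  else if hasVal T b e then
    if c.1 = c.2 ∧ T e = some ⟨b, true⟩ ∧ hasVal T b (c.1 + 1, c.1 + 1) then
      Function.update (exchange T c (c.1 + 1, c.1 + 1)) e (some ⟨b, false⟩)  -- (S3)
    else exchange T c e                                        -- (S1)
  else if hasVal T b s then
    if diag then diagSwitch T a c.1                            -- (S4)
    else exchange T c s                                        -- (S2)
  else T

/-- `c` is the `a`-box chosen by the switching process: the rightmost box holding `a` among those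
that are north or west neighbours of a `b`-box; if there is none, the bottommost box holding `a'`
among those. -/
def IsChosen (T : Filling n) (a b : Fin n) (c : Box) : Prop :=
  (T c = some ⟨a, false⟩ ∧ Touches T b c ∧
    ∀ d, T d = some ⟨a, false⟩ → Touches T b d → d.2 ≤ c.2) ∨
  ((¬ ∃ d, T d = some ⟨a, false⟩ ∧ Touches T b d) ∧
    T c = some ⟨a, true⟩ ∧ Touches T b c ∧
    ∀ d, T d = some ⟨a, true⟩ → Touches T b d → d.1 ≤ c.1)

/-- No `a`-box can be switched with a `b`-box. -/
def FullySwitched (T : Filling n) (a b : Fin n) : Prop :=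
  ∀ c, HasVal T a c → ¬ Touches T b c

open Classical in
/-- One step of the switching process (nothing happens when there is no box to choose; on the
fillings that occur, the chosen box is unique). -/
noncomputable def step (a b : Fin n) (T : Filling n) : Filling n :=
  if h : ∃ c, IsChosen T a b c then switchAt T a b h.choose else T

/-- The switching process applied to the border strips of the letters `a` and `b` in `T`, all other
letters staying unchanged: iterate `step` up to the least `m` for which the result is fully
switched. -/
noncomputable def switching (a b : Fin n) (T : Filling n) : Filling n :=
  (step a b)^[sInf {m : ℕ | FullySwitched ((step a b)^[m] T) a b}] T

/-! ### Permutations of the letters and the Bender--Knuth operators -/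

/-- A permutation of the numbers `1, ..., n` acts on letters (keeping primes) and so on fillings,
the result being put into canonical form. -/
noncomputable def permFilling (τ : Equiv.Perm (Fin n)) (T : Filling n) : Filling n :=
  canonicalize fun c => (T c).map fun x => ⟨τ x.val, x.primed⟩

/-- The action on vectors: `τ (v_1, ..., v_n) = (v_{τ⁻¹ 1}, ..., v_{τ⁻¹ n})`. -/
def permVector (τ : Equiv.Perm (Fin n)) (v : Fin n → ℕ) : Fin n → ℕ := fun k => v (τ⁻¹ k)

/-- The shifted Bender--Knuth operator `t_i`, for `1 ≤ i ≤ n - 1` (the identity otherwise):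
switch the strips of the letters `i` and `i + 1`, then apply the transposition `(i, i + 1)`.
The numbers `i` and `i + 1` are the elements `i - 1` and `i` of `Fin n`. -/
noncomputable def bk (i : ℕ) (T : Filling n) : Filling n :=
  if h : 1 ≤ i ∧ i < n then
    let a : Fin n := ⟨i - 1, by omega⟩
    let b : Fin n := ⟨i, h.2⟩
    permFilling (Equiv.swap a b) (switching a b T)
  else T

/-- `p_i = t_i t_{i-1} ⋯ t_1` (`t_1` is applied first). -/
noncomputable def promotion : ℕ → Filling n → Filling n
  | 0, T => T
  | i + 1, T => bk (i + 1) (promotion i T)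

/-- `q_i = t_1 (t_2 t_1) ⋯ (t_i t_{i-1} ⋯ t_1)` (the rightmost factor is applied first). -/
noncomputable def q : ℕ → Filling n → Filling n
  | 0, T => T
  | i + 1, T => q i (promotion (i + 1) T)

/-- The map underlying `longest`, with `Fin n` counted from `0`. -/
def reverseBetween (n i j : ℕ) (x : Fin n) : Fin n :=
  if h : (1 ≤ i ∧ j ≤ n) ∧ (i ≤ (x : ℕ) + 1 ∧ (x : ℕ) + 1 ≤ j) then
    ⟨i + j - ((x : ℕ) + 1) - 1, by omega⟩
  else x

theorem reverseBetween_involutive (n i j : ℕ) :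
    Function.Involutive (reverseBetween n i j) := by
  intro x
  unfold reverseBetween
  split_ifs with h1 h2
  · ext; simp only; omega
  · simp only at h2; omega
  · rfl

/-- The longest permutation `θ_{i,j}` of `{i, ..., j}`, for `1 ≤ i ≤ j ≤ n`, as a permutation of
`{1, ..., n}`: it sends `x` to `i + j - x` if `i ≤ x ≤ j` and fixes all other numbers. -/
def longest (n i j : ℕ) : Equiv.Perm (Fin n) := (reverseBetween_involutive n i j).toPerm

end ShiftedBK

/-! A tableau in canonical form is encoded by one list of boxes per letter `k`: the boxes with `k'`
from top to bottom, followed by the boxes with `k` from left to right. Consecutive boxes in this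
standard order step down and left until the first `k` is reached, then right and up (`Hook`). The
turning point recovers the primes (`Hook.unique`), and each list is a linear extension over the
ideal formed by the inner shape and the smaller letters. Conversely, lists with these properties
come from a unique tableau (`exists_listing`, `mem_ShST_of_listing`, `HasLists.unique`).

On linear extensions, switching is built from `pass`, which interchanges two consecutive boxes
unless they are adjacent. It is an involution, and so is `switch`, which carries out the passes of a
whole grid (`switch_switch`).

The main work is to show that the switching process of `a` and `b` acts on the two lists as `switch`
(`exists_switched`, `mem_ShST_switching`). The process moves the `a`-letters in reverse standard
order, each one sliding past the whole list of `b`-letters (`RunHyp.run`). An analysis of three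
consecutive boxes (`LinExt.pass_rel`, `LinExt.copass_rel`) shows that the direction of a step
survives each pass, except on a triple `(r, r)`, `(r, r + 1)`, `(r + 1, r + 1)`. There the direction
turns, and the special switches (S3), (S4), (S7) alter a prime accordingly.

Hence the Bender–Knuth operators are involutions, and those with distant indices commute.
Schützenberger's evacuation argument then gives `q_i ^ 2 = 1` in any group: `q_{i+1}` is both `q_i
p_{i+1}` and `p_{i+1}⁻¹ q_i` (`evacuation_succ`). For the weight, `switch` exchanges the lengths of
two lists, and the resulting product of transpositions is the longest permutation (`weight_q`). -/

namespace ShiftedBK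

variable {n : ℕ}

/-! ### Tableau switching on lists of boxes -/

/-- Two boxes share an edge. -/
def Adjacent (x y : Box) : Prop :=
  (x.1 = y.1 ∧ (y.2 = x.2 + 1 ∨ x.2 = y.2 + 1)) ∨ (x.2 = y.2 ∧ (y.1 = x.1 + 1 ∨ x.1 = y.1 + 1))

instance (x y : Box) : Decidable (Adjacent x y) := by unfold Adjacent; infer_instance

theorem Adjacent.symm {x y : Box} (h : Adjacent x y) : Adjacent y x := by
  unfold Adjacent at *; omega

/-- The elementary switch of two consecutive boxes of a linear extension: the second label moves in
front of the first one; the boxes are interchanged unless they are adjacent. -/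
def pass (x y : Box) : Box × Box := if Adjacent x y then (x, y) else (y, x)

theorem pass_of_adjacent {x y : Box} (h : Adjacent x y) : pass x y = (x, y) := if_pos h

theorem pass_of_not_adjacent {x y : Box} (h : ¬ Adjacent x y) : pass x y = (y, x) := if_neg h

theorem pass_pass (x y : Box) : pass (pass x y).1 (pass x y).2 = (x, y) := by
  unfold pass
  by_cases h : Adjacent x y
  · simp [h]
  · have h' : ¬ Adjacent y x := fun h' => h h'.symm
    simp [h, h']

/-- Slide the label in the box `x` past the labels in the boxes `ys`. -/
def slide : Box → List Box → List Box × Box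
  | x, [] => ([], x)
  | x, y :: ys => ((pass x y).1 :: (slide (pass x y).2 ys).1, (slide (pass x y).2 ys).2)

/-- Slide the label in the box `y` backwards past the labels in the boxes `xs`. -/
def coslide : List Box → Box → Box × List Box
  | [], y => (y, [])
  | x :: xs, y => ((pass x (coslide xs y).1).1, (pass x (coslide xs y).1).2 :: (coslide xs y).2)

/-- Slide the labels in the boxes `xs` past the labels in the boxes `ys`. -/
def switch : List Box → List Box → List Box × List Box
  | [], ys => (ys, [])
  | x :: xs, ys =>
    ((slide x (switch xs ys).1).1, (slide x (switch xs ys).1).2 :: (switch xs ys).2)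

theorem slide_coslide (xs : List Box) (y : Box) :
    slide (coslide xs y).1 (coslide xs y).2 = (xs, y) := by
  induction xs with
  | nil => rfl
  | cons x xs ih => simp only [coslide, slide, pass_pass, ih]

theorem switch_nil (xs : List Box) : switch xs [] = ([], xs) := by
  induction xs with
  | nil => rfl
  | cons x xs ih => simp [switch, ih, slide]

/-- The passes form a grid indexed by the two lists. `switch` is defined row by row, through
`slide`; here the same grid is evaluated column by column, through `coslide`. -/
theorem switch_cons (xs : List Box) (y : Box) (ys : List Box) :
    switch xs (y :: ys) = ((coslide xs y).1 :: (switch (coslide xs y).2 ys).1,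
      (switch (coslide xs y).2 ys).2) := by
  induction xs with
  | nil => rfl
  | cons x xs ih => simp [switch, coslide, ih, slide]

/-- Evaluate the first switch by columns and the second by rows. Since `pass` is an involution, the
last slide undoes the first coslide. -/
theorem switch_switch (xs ys : List Box) :
    switch (switch xs ys).1 (switch xs ys).2 = (xs, ys) := by
  induction ys generalizing xs with
  | nil => simp [switch_nil, switch]
  | cons y ys ih => simp only [switch_cons xs, switch, ih, slide_coslide]

theorem length_slide (x : Box) (ys : List Box) : (slide x ys).1.length = ys.length := by
  induction ys generalizing x with
  | nil => rfl
  | cons y ys ih => simp [slide, ih]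

theorem length_switch (xs ys : List Box) :
    (switch xs ys).1.length = ys.length ∧ (switch xs ys).2.length = xs.length := by
  induction xs with
  | nil => simp [switch]
  | cons x xs ih => simp [switch, length_slide, ih]

theorem mem_pass (x y d : Box) : d = (pass x y).1 ∨ d = (pass x y).2 ↔ d = x ∨ d = y := by
  unfold pass; split_ifs <;> simp [or_comm]

theorem mem_slide (x : Box) (ys : List Box) (d : Box) :
    d ∈ (slide x ys).1 ∨ d = (slide x ys).2 ↔ d = x ∨ d ∈ ys := by
  induction ys generalizing x with
  | nil => simp [slide]
  | cons y ys ih =>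
    have := mem_pass x y d
    have := ih (pass x y).2
    simp only [slide, List.mem_cons]
    tauto

theorem mem_switch (xs ys : List Box) (d : Box) :
    d ∈ (switch xs ys).1 ∨ d ∈ (switch xs ys).2 ↔ d ∈ xs ∨ d ∈ ys := by
  induction xs with
  | nil => simp [switch]
  | cons x xs ih =>
    have := mem_slide x (switch xs ys).1 d
    simp only [switch, List.mem_cons]
    tauto

theorem slide_append (x : Box) (ys zs : List Box) :
    slide x (ys ++ zs) = ((slide x ys).1 ++ (slide (slide x ys).2 zs).1,
      (slide (slide x ys).2 zs).2) := by
  induction ys generalizing x with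
  | nil => simp [slide]
  | cons y ys ih => simp [slide, ih]

/-! ### Linear extensions -/

/-- Order ideals of the shifted plane. -/
structure IsIdeal (I : Set Box) : Prop where
  shifted : ∀ x ∈ I, x.1 ≤ x.2
  down : ∀ x ∈ I, ∀ d : Box, d.1 ≤ d.2 → d.1 ≤ x.1 → d.2 ≤ x.2 → d ∈ I

/-- The box `x` can be added to the ideal `I`. -/
structure Addable (I : Set Box) (x : Box) : Prop where
  shifted : x.1 ≤ x.2
  notMem : x ∉ I
  down : ∀ d : Box, d.1 ≤ d.2 → d.1 ≤ x.1 → d.2 ≤ x.2 → d = x ∨ d ∈ I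

/-- The boxes in the list can be added to the ideal `I` one after the other. -/
def LinExt : Set Box → List Box → Prop
  | _, [] => True
  | I, x :: L => Addable I x ∧ LinExt (insert x I) L

theorem IsIdeal.adjoin {I : Set Box} (hI : IsIdeal I) {x : Box} (hx : Addable I x) :
    IsIdeal (insert x I) := by
  constructor
  · rintro y (rfl | hy)
    · exact hx.shifted
    · exact hI.shifted y hy
  · rintro y (rfl | hy) d h1 h2 h3
    · exact hx.down d h1 h2 h3
    · exact Or.inr (hI.down y hy d h1 h2 h3)

theorem linExt_append {I : Set Box} {L L' : List Box} :
    LinExt I (L ++ L') ↔ LinExt I L ∧ LinExt (I ∪ {d | d ∈ L}) L' := by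
  induction L generalizing I with
  | nil => simp [LinExt]
  | cons x L ih =>
    have : insert x I ∪ {d | d ∈ L} = I ∪ {d | d ∈ x :: L} := by
      ext d; simp; tauto
    simp only [List.cons_append, LinExt, ih, this, and_assoc]

theorem IsIdeal.union {I : Set Box} (hI : IsIdeal I) {L : List Box} (hL : LinExt I L) :
    IsIdeal (I ∪ {d | d ∈ L}) := by
  induction L generalizing I with
  | nil => simpa using hI
  | cons x L ih =>
    have : insert x I ∪ {d | d ∈ L} = I ∪ {d | d ∈ x :: L} := by
      ext d; simp; tauto
    rw [← this]
    exact ih (hI.adjoin hL.1) hL.2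

theorem LinExt.shifted {I : Set Box} {L : List Box} (hL : LinExt I L) {x : Box} (hx : x ∈ L) :
    x.1 ≤ x.2 := by
  induction L generalizing I with
  | nil => simp at hx
  | cons y L ih =>
    rcases List.mem_cons.1 hx with rfl | hx
    · exact hL.1.shifted
    · exact ih hL.2 hx

theorem LinExt.notMem {I : Set Box} {L : List Box} (hL : LinExt I L) {x : Box} (hx : x ∈ L) :
    x ∉ I := by
  induction L generalizing I with
  | nil => simp at hx
  | cons y L ih =>
    rcases List.mem_cons.1 hx with rfl | hx
    · exact hL.1.notMem
    · exact fun h => ih hL.2 hx (Or.inr h)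

theorem LinExt.down {I : Set Box} {L : List Box} (hL : LinExt I L) {x : Box} (hx : x ∈ L)
    (d : Box) (h1 : d.1 ≤ d.2) (h2 : d.1 ≤ x.1) (h3 : d.2 ≤ x.2) : d ∈ I ∨ d ∈ L := by
  induction L generalizing I with
  | nil => simp at hx
  | cons y L ih =>
    rcases List.mem_cons.1 hx with rfl | hx
    · rcases hL.1.down d h1 h2 h3 with rfl | h
      · simp
      · exact Or.inl h
    · rcases ih hL.2 hx with (rfl | h) | h
      · simp
      · exact Or.inl h
      · simp [h]

theorem LinExt.pairwise {I : Set Box} (hI : IsIdeal I) {L : List Box} (hL : LinExt I L) :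
    L.Pairwise fun x y => ¬ (y.1 ≤ x.1 ∧ y.2 ≤ x.2) := by
  induction L generalizing I with
  | nil => simp
  | cons x L ih =>
    refine List.pairwise_cons.2 ⟨fun y hy h => ?_, ih (hI.adjoin hL.1) hL.2⟩
    exact hL.2.notMem hy ((hI.adjoin hL.1).down x (by simp) y (hL.2.shifted hy) h.1 h.2)

theorem linExt_of_pairwise {I : Set Box} {L : List Box} (hs : ∀ x ∈ L, x.1 ≤ x.2)
    (hn : ∀ x ∈ L, x ∉ I)
    (hd : ∀ x ∈ L, ∀ d : Box, d.1 ≤ d.2 → d.1 ≤ x.1 → d.2 ≤ x.2 → d ∈ I ∨ d ∈ L)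
    (hp : L.Pairwise fun x y => ¬ (y.1 ≤ x.1 ∧ y.2 ≤ x.2)) : LinExt I L := by
  induction L generalizing I with
  | nil => trivial
  | cons x L ih =>
    rw [List.pairwise_cons] at hp
    refine ⟨⟨hs x (by simp), hn x (by simp), fun d h1 h2 h3 => ?_⟩, ih ?_ ?_ ?_ hp.2⟩
    · rcases hd x (by simp) d h1 h2 h3 with h | h
      · exact Or.inr h
      · rcases List.mem_cons.1 h with h | h
        · exact Or.inl h
        · exact absurd ⟨h2, h3⟩ (hp.1 d h)
    · exact fun y hy => hs y (by simp [hy])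
    · rintro y hy (rfl | h)
      · exact hp.1 y hy ⟨le_rfl, le_rfl⟩
      · exact hn y (by simp [hy]) h
    · intro y hy d h1 h2 h3
      rcases hd y (by simp [hy]) d h1 h2 h3 with h | h
      · exact Or.inl (Or.inr h)
      · rcases List.mem_cons.1 h with h | h
        · exact Or.inl (Or.inl h)
        · exact Or.inr h

/-- Consecutive boxes of a linear extension that are not adjacent are incomparable, so they can be
added in either order. -/
theorem LinExt.pass {I : Set Box} (hI : IsIdeal I) {x y : Box} {L : List Box}
    (h : LinExt I (x :: y :: L)) : LinExt I ((pass x y).1 :: (pass x y).2 :: L) := by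
  unfold ShiftedBK.pass
  split_ifs with hxy
  · exact h
  · obtain ⟨hx, hy, hL⟩ := h
    have hne : y ≠ x := fun h => hy.notMem (by simp [h])
    refine ⟨⟨hy.shifted, fun h => hy.notMem (Or.inr h), fun d h1 h2 h3 => ?_⟩,
      ⟨hx.shifted, ?_, ?_⟩, ?_⟩
    · rcases hy.down d h1 h2 h3 with h | rfl | h
      · exact Or.inl h
      -- Here `x` (now called `d`) lies weakly northwest of `y`. As they are not adjacent, the box
      -- right of `x` or the one below `x` also lies northwest of `y`; it would have to be added
      -- before `y`, yet it is not in `I`, because `x` is not.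
      · exfalso
        obtain ⟨r, s⟩ := d
        obtain ⟨r', s'⟩ := y
        simp only [Adjacent, ne_eq, Prod.mk.injEq] at *
        rcases Nat.lt_or_ge s s' with hs | hs
        · rcases hy.down (r, s + 1) (by simp; omega) h2 hs with h | h | h
          · simp at h; omega
          · simp at h
          · exact hx.notMem (hI.down _ h _ h1 le_rfl (by simp))
        · rcases hy.down (r + 1, s) (by simp; have := hy.shifted; simp at this; omega)
            (by simp; omega) h3 with h | h | h
          · simp at h; omega
          · simp at h
          · exact hx.notMem (hI.down _ h _ h1 (by simp) le_rfl)
      · exact Or.inr h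
    · rintro (h | h)
      · exact hne h.symm
      · exact hx.notMem h
    · intro d h1 h2 h3
      rcases hx.down d h1 h2 h3 with h | h
      · exact Or.inl h
      · exact Or.inr (Or.inr h)
    · rwa [Set.insert_comm]

theorem LinExt.slide {I : Set Box} (hI : IsIdeal I) {x : Box} {ys L : List Box}
    (h : LinExt I (x :: (ys ++ L))) : LinExt I ((slide x ys).1 ++ (slide x ys).2 :: L) := by
  induction ys generalizing x I with
  | nil => exact h
  | cons y ys ih =>
    have h' := LinExt.pass hI h
    exact ⟨h'.1, ih (hI.adjoin h'.1) h'.2⟩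

theorem LinExt.switch {I : Set Box} (hI : IsIdeal I) {xs ys L : List Box}
    (h : LinExt I (xs ++ (ys ++ L))) :
    LinExt I ((switch xs ys).1 ++ ((switch xs ys).2 ++ L)) := by
  induction xs generalizing I with
  | nil => exact h
  | cons x xs ih => exact LinExt.slide hI ⟨h.1, ih (hI.adjoin h.1) h.2⟩

/-! ### The relative position of consecutive boxes -/

/-- `y` is strictly below and weakly left of `x`. -/
def Below (x y : Box) : Prop := x.1 < y.1 ∧ y.2 ≤ x.2

/-- `y` is strictly right and weakly above of `x`. -/
def RightOf (x y : Box) : Prop := x.2 < y.2 ∧ y.1 ≤ x.1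

theorem Below.trans {x y z : Box} (h : Below x y) (h' : Below y z) : Below x z := by
  unfold Below at *; omega

theorem RightOf.trans {x y z : Box} (h : RightOf x y) (h' : RightOf y z) : RightOf x z := by
  unfold RightOf at *; omega

theorem RightOf.not_below {x y : Box} (h : RightOf x y) : ¬ Below x y := by
  unfold RightOf Below at *; omega

/-- The boxes `(r, r)`, `(r, r + 1)`, `(r + 1, r + 1)`. -/
def IsDiagTriple (x y z : Box) : Prop :=
  x.2 = x.1 ∧ y = (x.1, x.1 + 1) ∧ z = (x.1 + 1, x.1 + 1)

/-- The only other possibility is that `y` is strictly southeast of `x`; then the box to the right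
of `x` would have to be added between the two. -/
theorem LinExt.below_or_rightOf {I : Set Box} (hI : IsIdeal I) {x y : Box} {L : List Box}
    (h : LinExt I (x :: y :: L)) : Below x y ∨ RightOf x y := by
  obtain ⟨hx, hy, -⟩ := h
  have h1 := hx.shifted
  have h2 := hy.shifted
  by_contra hcon
  have hne : ¬ (y.1 ≤ x.1 ∧ y.2 ≤ x.2) := fun h =>
    hy.notMem ((hI.adjoin hx).down x (by simp) y h2 h.1 h.2)
  unfold Below RightOf at hcon
  rcases hy.down (x.1, x.2 + 1) (by simp; omega) (by simp; omega) (by simp; omega) with h | h | h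
  · apply_fun Prod.fst at h
    simp at h; omega
  · apply_fun Prod.snd at h
    simp at h
  · exact hx.notMem (hI.down _ h _ h1 le_rfl (by simp))

/-- Order convexity of consecutive boxes, one clause for each of the pairs `(x, y)`, `(x, z)`, `(y,
z)`. It is phrased in coordinates so that it can be handed to `omega`. -/
theorem LinExt.convex {I : Set Box} (hI : IsIdeal I) {x y z : Box} {L : List Box}
    (h : LinExt I (x :: y :: z :: L)) (r s : ℕ) (hrs : r ≤ s) :
    (x.1 ≤ r → x.2 ≤ s → r ≤ y.1 → s ≤ y.2 → (r = x.1 ∧ s = x.2) ∨ (r = y.1 ∧ s = y.2)) ∧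
    (x.1 ≤ r → x.2 ≤ s → r ≤ z.1 → s ≤ z.2 →
      (r = x.1 ∧ s = x.2) ∨ (r = y.1 ∧ s = y.2) ∨ (r = z.1 ∧ s = z.2)) ∧
    (y.1 ≤ r → y.2 ≤ s → r ≤ z.1 → s ≤ z.2 → (r = y.1 ∧ s = y.2) ∨ (r = z.1 ∧ s = z.2)) := by
  obtain ⟨hx, hy, hz, -⟩ := h
  refine ⟨fun h1 h2 h3 h4 => ?_, fun h1 h2 h3 h4 => ?_, fun h1 h2 h3 h4 => ?_⟩
  · rcases hy.down (r, s) hrs h3 h4 with rfl | rfl | h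
    · simp
    · simp
    · exact absurd (hI.down _ h _ hx.shifted h1 h2) hx.notMem
  · rcases hz.down (r, s) hrs h3 h4 with rfl | rfl | rfl | h
    · simp
    · simp
    · simp
    · exact absurd (hI.down _ h _ hx.shifted h1 h2) hx.notMem
  · rcases hz.down (r, s) hrs h3 h4 with rfl | rfl | h
    · simp
    · simp
    · exact absurd ((hI.adjoin hx).down _ h _ hy.shifted h1 h2) hy.notMem

/-- The boxes compared are those left to `y` and `z` after the label of `x` has slid past both. Only
a diagonal triple can turn a downward step into a rightward one, since a shifted shape has no box
`(r + 1, r)`. -/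
theorem LinExt.pass_rel {I : Set Box} (hI : IsIdeal I) {x y z : Box} {L : List Box}
    (h : LinExt I (x :: y :: z :: L)) :
    (Below y z → Below (ShiftedBK.pass x y).1 (ShiftedBK.pass (ShiftedBK.pass x y).2 z).1 ∨
      IsDiagTriple x y z) ∧
    (RightOf y z →
      RightOf (ShiftedBK.pass x y).1 (ShiftedBK.pass (ShiftedBK.pass x y).2 z).1) := by
  have hc := LinExt.convex hI h
  have hp := LinExt.pairwise hI h
  have hx := h.1.shifted
  have hy := h.2.1.shifted
  have hz := h.2.2.1.shifted
  obtain ⟨x1, x2⟩ := x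
  obtain ⟨y1, y2⟩ := y
  obtain ⟨z1, z2⟩ := z
  have e1 := hc x1 (x2 + 1)
  have e2 := hc (x1 + 1) x2
  have e3 := hc (x1 + 1) (x2 + 1)
  simp only [List.pairwise_cons, List.mem_cons, forall_eq_or_imp] at *
  unfold ShiftedBK.pass Below RightOf IsDiagTriple Adjacent
  clear hc h
  simp only [Prod.mk.injEq]
  refine ⟨fun hb => ?_, fun hb => ?_⟩
  · by_cases c1 : (x1 = y1 ∧ (y2 = x2 + 1 ∨ x2 = y2 + 1) ∨ x2 = y2 ∧ (y1 = x1 + 1 ∨ x1 = y1 + 1))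
    · simp only [c1, if_true]
      split_ifs with c2 <;> simp only <;> omega
    · simp only [c1, if_false]
      split_ifs with c2 <;> simp only <;> omega
  · by_cases c1 : (x1 = y1 ∧ (y2 = x2 + 1 ∨ x2 = y2 + 1) ∨ x2 = y2 ∧ (y1 = x1 + 1 ∨ x1 = y1 + 1))
    · simp only [c1, if_true]
      split_ifs with c2 <;> simp only <;> omega
    · simp only [c1, if_false]
      split_ifs with c2 <;> simp only <;> omega

/-- The mirror image of `LinExt.pass_rel`: now the labels of `x` and `y` move past `z`. Passing is
an involution and the two directions exclude each other, so the claim follows by applying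
`LinExt.pass_rel` to the boxes after the move. -/
theorem LinExt.copass_rel {I : Set Box} (hI : IsIdeal I) {x y z : Box} {L : List Box}
    (h : LinExt I (x :: y :: z :: L)) :
    (Below x y → Below (ShiftedBK.pass x (ShiftedBK.pass y z).1).2 (ShiftedBK.pass y z).2) ∧
    (RightOf x y → RightOf (ShiftedBK.pass x (ShiftedBK.pass y z).1).2 (ShiftedBK.pass y z).2 ∨
      IsDiagTriple x y z) := by
  have h1 : LinExt I (x :: (ShiftedBK.pass y z).1 :: (ShiftedBK.pass y z).2 :: L) :=
    ⟨h.1, LinExt.pass (hI.adjoin h.1) h.2⟩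
  have h2 := LinExt.pass hI h1
  have h3 := LinExt.below_or_rightOf (hI.adjoin h2.1) h2.2
  have h4 := LinExt.pass_rel hI h2
  rw [pass_pass] at h4
  simp only [pass_pass] at h4
  refine ⟨fun hb => h3.resolve_right fun hr => (h4.2 hr).not_below hb, fun hr => ?_⟩
  refine h3.symm.imp_right fun hb => ?_
  rcases h4.1 hb with hb | ⟨e1, e2, e3⟩
  · exact absurd hb hr.not_below
  -- The boxes after the move form a diagonal triple. Consecutive boxes of such a triple are
  -- adjacent, so both passes leave them in place and the triple was there from the start.
  · have e4 := pass_pass x (ShiftedBK.pass y z).1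
    have e5 := pass_pass y z
    rw [e2] at e4
    have a1 : Adjacent (ShiftedBK.pass x (ShiftedBK.pass y z).1).1
        ((ShiftedBK.pass x (ShiftedBK.pass y z).1).1.1,
          (ShiftedBK.pass x (ShiftedBK.pass y z).1).1.1 + 1) := by
      unfold Adjacent; simp [e1]
    rw [pass_of_adjacent a1, Prod.mk.injEq] at e4
    rw [← e4.2, e3] at e5
    have a2 : Adjacent ((ShiftedBK.pass x (ShiftedBK.pass y z).1).1.1,
        (ShiftedBK.pass x (ShiftedBK.pass y z).1).1.1 + 1)
        ((ShiftedBK.pass x (ShiftedBK.pass y z).1).1.1 + 1,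
          (ShiftedBK.pass x (ShiftedBK.pass y z).1).1.1 + 1) := by
      unfold Adjacent; simp
    rw [pass_of_adjacent a2, Prod.mk.injEq] at e5
    rw [e4.1] at e1 e5
    exact ⟨e1, e5.1.symm, e5.2.symm⟩

/-- When sliding past the boxes `ys`, the label starting in `x` reaches the box `(r, r + 1)` and
leaves it to `(r + 1, r + 1)`. -/
def EntersDiagonal (r : ℕ) : Box → List Box → Prop
  | _, [] => False
  | x, y :: ys => (x = (r, r + 1) ∧ y = (r + 1, r + 1)) ∨ EntersDiagonal r (pass x y).2 ys

theorem EntersDiagonal.mem {r : ℕ} {x : Box} {ys : List Box} (h : EntersDiagonal r x ys) :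
    (r + 1, r + 1) ∈ ys := by
  induction ys generalizing x with
  | nil => exact h.elim
  | cons y ys ih =>
    rcases h with h | h
    · simp [h.2]
    · exact List.mem_cons_of_mem _ (ih h)

/-- Past each box of `L` the label of `y` moves first and that of `x` follows, so
`LinExt.copass_rel` applies box by box. -/
theorem slide_slide_below {I : Set Box} (hI : IsIdeal I) {x y : Box} {L : List Box}
    (h : LinExt I (x :: y :: L)) (hb : Below x y) :
    Below (slide x (slide y L).1).2 (slide y L).2 := by
  induction L generalizing I x y with
  | nil => exact hb
  | cons z L ih =>
    have h1 : LinExt I (x :: (ShiftedBK.pass y z).1 :: (ShiftedBK.pass y z).2 :: L) :=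
      ⟨h.1, LinExt.pass (hI.adjoin h.1) h.2⟩
    have h2 := LinExt.pass hI h1
    exact ih (hI.adjoin h2.1) h2.2 ((LinExt.copass_rel hI h).1 hb)

/-- The only obstruction is a diagonal triple, with `x` on the main diagonal when `y` enters it.
`hd` excludes this for the starting box of `x`, and `hu` for diagonal boxes that `x` reaches later.
-/
theorem slide_slide_rightOf {I : Set Box} (hI : IsIdeal I) {x y : Box} {L : List Box}
    (h : LinExt I (x :: y :: L)) (hr : RightOf x y)
    (hd : ∀ r, x = (r, r) → ¬ EntersDiagonal r y L)
    (hu : L.Pairwise fun y z => y.1 = y.2 → z.1 ≠ z.2) :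
    RightOf (slide x (slide y L).1).2 (slide y L).2 := by
  induction L generalizing I x y with
  | nil => exact hr
  | cons z L ih =>
    have h1 : LinExt I (x :: (ShiftedBK.pass y z).1 :: (ShiftedBK.pass y z).2 :: L) :=
      ⟨h.1, LinExt.pass (hI.adjoin h.1) h.2⟩
    have h2 := LinExt.pass hI h1
    rw [List.pairwise_cons] at hu
    refine ih (hI.adjoin h2.1) h2.2 (((LinExt.copass_rel hI h).2 hr).resolve_right ?_) ?_ hu.2
    · rintro ⟨e1, e2, e3⟩
      exact hd x.1 (Prod.ext rfl e1) (Or.inl ⟨e2, e3⟩)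
    · intro r hxr hE
      by_cases hx : x = (r, r)
      · exact hd r hx (Or.inr hE)
      -- The label of `x` arrives at `(r, r)` only now, so it has taken over the box `z = (r, r)`.
      -- Entering the diagonal later would need `(r + 1, r + 1)`, a second diagonal box in the list.
      · have hxs := h.1.shifted
        have hyx : y ≠ (r, r) := by
          rintro rfl
          unfold ShiftedBK.pass at hxr
          unfold RightOf at hr
          split_ifs at hxr with c1 c2 <;> simp_all <;> unfold Adjacent at * <;> simp_all <;> omega
        have hz : z = (r, r) := by
          unfold ShiftedBK.pass at hxr
          split_ifs at hxr with c1 c2 <;> simp_all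
        exact hu.1 _ hE.mem (by simp [hz]) rfl

theorem switch_below {I : Set Box} (hI : IsIdeal I) {x y : Box} {xs ys : List Box}
    (h : LinExt I (x :: (xs ++ ys))) (hy : y ∈ xs.head?) (hb : Below x y) :
    ∃ z ∈ (switch xs ys).2.head?, Below (slide x (switch xs ys).1).2 z := by
  cases xs with
  | nil => simp at hy
  | cons y' xs =>
    obtain rfl : y' = y := by simpa using hy
    refine ⟨_, by simp only [switch, List.head?_cons]; rfl, ?_⟩
    have h2 := LinExt.switch ((hI.adjoin h.1).adjoin h.2.1) (L := []) (by simpa using h.2.2)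
    have h3 : LinExt I (x :: y' :: (switch xs ys).1) := ⟨h.1, h.2.1, (linExt_append.1 h2).1⟩
    exact slide_slide_below hI h3 hb

theorem switch_rightOf {I : Set Box} (hI : IsIdeal I) {x y : Box} {xs ys : List Box}
    (h : LinExt I (x :: y :: (xs ++ ys))) (hr : RightOf x y)
    (hd : ∀ r, x = (r, r) → ¬ EntersDiagonal r y (switch xs ys).1)
    (hu : (switch xs ys).1.Pairwise fun y z => y.1 = y.2 → z.1 ≠ z.2) :
    RightOf (slide x (switch (y :: xs) ys).1).2 (slide y (switch xs ys).1).2 := by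
  have h2 := LinExt.switch ((hI.adjoin h.1).adjoin h.2.1) (L := []) (by simpa using h.2.2)
  have h3 : LinExt I (x :: y :: (switch xs ys).1) := ⟨h.1, h.2.1, (linExt_append.1 h2).1⟩
  exact slide_slide_rightOf hI h3 hr hd hu

/-! ### Hooks: the boxes of a letter in standard order -/

/-- The boxes in `P` go down and left, ending in the first box of `Q`, and the boxes in `Q` go right
and up. -/
def Hook : List Box → List Box → Prop
  | [], Q => Q.Pairwise RightOf
  | p :: P, Q => (∃ z ∈ (P ++ Q).head?, Below p z) ∧ Hook P Q

theorem Hook.pairwise_right {P Q : List Box} (h : Hook P Q) : Q.Pairwise RightOf := by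
  induction P with
  | nil => exact h
  | cons p P ih => exact ih h.2

theorem Hook.below {P Q : List Box} (h : Hook P Q) :
    P.Pairwise Below ∧ ∀ p ∈ P, ∃ q ∈ Q.head?, Below p q := by
  induction P with
  | nil => simp
  | cons p P ih =>
    obtain ⟨⟨z, hz, hpz⟩, h⟩ := h
    obtain ⟨h1, h2⟩ := ih h
    have hp : ∀ x ∈ P, Below p x := by
      intro x hx
      cases P with
      | nil => simp at hx
      | cons p' P =>
        obtain rfl : p' = z := by simpa using hz
        rcases List.mem_cons.1 hx with rfl | hx
        · exact hpz
        · exact hpz.trans ((List.pairwise_cons.1 h1).1 _ hx)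
    refine ⟨List.pairwise_cons.2 ⟨hp, h1⟩, fun x hx => ?_⟩
    rcases List.mem_cons.1 hx with rfl | hx
    · cases P with
      | nil => exact ⟨z, by simpa using hz, hpz⟩
      | cons p' P =>
        obtain ⟨q, hq, hpq⟩ := h2 p' (by simp)
        exact ⟨q, hq, (hp p' (by simp)).trans hpq⟩
    · exact h2 x hx

theorem hook_of {P Q : List Box} (h1 : P.Pairwise Below) (h2 : ∀ p ∈ P, ∃ q ∈ Q.head?, Below p q)
    (h3 : Q.Pairwise RightOf) : Hook P Q := by
  induction P with
  | nil => exact h3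
  | cons p P ih =>
    rw [List.pairwise_cons] at h1
    refine ⟨?_, ih h1.2 fun x hx => h2 x (by simp [hx])⟩
    cases P with
    | nil => simpa using h2 p (by simp)
    | cons p' P => exact ⟨p', by simp, h1.1 p' (by simp)⟩

/-- `P` ends at the first step that is not downward, so the split can be read off from the
concatenated list. This is why the primes carry no information beyond the standard order. -/
theorem Hook.unique {P Q P' Q' : List Box} (h : Hook P Q) (h' : Hook P' Q')
    (e : P ++ Q = P' ++ Q') : P = P' ∧ Q = Q' := by
  have key : ∀ {P Q p P' : List Box} {x : Box}, Hook [] Q → Hook (x :: P') p → Q = x :: P' ++ p →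
      False := by
    intro P Q p P' x h h' e
    obtain ⟨⟨z, hz, hxz⟩, -⟩ := h'
    subst e
    cases hl : P' ++ p with
    | nil => simp [hl] at hz
    | cons y l =>
      rw [hl] at hz
      obtain rfl : y = z := by simpa using hz
      have h2 : (x :: (P' ++ p)).Pairwise RightOf := h
      rw [hl, List.pairwise_cons] at h2
      exact (h2.1 y (by simp)).not_below hxz
  induction P generalizing P' with
  | nil =>
    cases P' with
    | nil => exact ⟨rfl, by simpa using e⟩
    | cons x P' => exact (key (P := []) h h' (by simpa using e)).elim
  | cons p P ih =>
    cases P' with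
    | nil => exact (key (P := []) h' h (by simpa using e.symm)).elim
    | cons x P' =>
      simp only [List.cons_append, List.cons.injEq] at e
      obtain ⟨rfl, rfl⟩ := ih h.2 h'.2 e.2
      exact ⟨by rw [e.1], rfl⟩

/-- All other boxes of the hook are strictly further right than the first box of `Q` or strictly
above it, so only that box can be on the main diagonal. -/
theorem Hook.not_diagonal {P Q : List Box} (h : Hook P Q) (hs : ∀ x ∈ P ++ Q, x.1 ≤ x.2) {x : Box}
    (hx : x ∈ P ++ Q.tail) : x.1 < x.2 := by
  cases Q with
  | nil =>
    rcases List.mem_append.1 hx with hx | hx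
    · simpa using h.below.2 x hx
    · simp at hx
  | cons q Q =>
    have hq := hs q (by simp)
    rcases List.mem_append.1 hx with hx | hx
    · obtain ⟨q', h1, h2⟩ := h.below.2 x hx
      obtain rfl : q = q' := by simpa using h1
      unfold Below at h2
      omega
    · have h2 := (List.pairwise_cons.1 h.pairwise_right).1 x hx
      unfold RightOf at h2
      omega

theorem Hook.pairwise_diagonal {P Q : List Box} (h : Hook P Q) (hs : ∀ x ∈ P ++ Q, x.1 ≤ x.2) :
    (P ++ Q).Pairwise fun y z => y.1 = y.2 → z.1 ≠ z.2 := by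
  induction P with
  | nil =>
    cases Q with
    | nil => simp
    | cons q Q =>
      refine List.Pairwise.imp_of_mem (R := RightOf) ?_ h
      intro y z hy hz hyz h1 h2
      have := hs y hy
      unfold RightOf at hyz
      omega
  | cons p P ih =>
    have hp := h.not_diagonal hs (x := p) (by simp)
    exact List.pairwise_cons.2 ⟨fun z _ h1 => absurd h1 hp.ne,
      ih h.2 fun x hx => hs x (by simp at hx ⊢; tauto)⟩

/-- The first box of the result of a slide. -/
theorem LinExt.slide_head {I : Set Box} (hI : IsIdeal I) {x y z : Box} {L : List Box}
    (h : LinExt I (x :: y :: L)) (hz : z ∈ L.head?) :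
    ∃ z' ∈ (ShiftedBK.slide (ShiftedBK.pass x y).2 L).1.head?,
      (Below y z → Below (ShiftedBK.pass x y).1 z' ∨ IsDiagTriple x y z) ∧
      (RightOf y z → RightOf (ShiftedBK.pass x y).1 z') := by
  cases L with
  | nil => simp at hz
  | cons w L =>
    obtain rfl : w = z := by simpa using hz
    exact ⟨_, by simp only [ShiftedBK.slide, List.head?_cons]; rfl, LinExt.pass_rel hI h⟩

theorem hook_cons_right {q : Box} {P Q : List Box} (hP : P = []) (h : Hook P Q)
    (hq : ∀ z ∈ Q.head?, RightOf q z) : Hook [] (q :: Q) := by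
  subst hP
  refine List.pairwise_cons.2 ⟨fun z hz => ?_, h⟩
  cases Q with
  | nil => simp at hz
  | cons q' Q =>
    have h1 := hq q' (by simp)
    rcases List.mem_cons.1 hz with rfl | hz
    · exact h1
    · exact h1.trans ((List.pairwise_cons.1 h).1 z hz)

/-! ### Single steps of the switching process -/

theorem hasVal_iff {T : Filling n} {k : Fin n} {c : Box} : hasVal T k c = true ↔ HasVal T k c := by
  unfold hasVal HasVal
  cases h : T c with
  | none => simp
  | some x => obtain ⟨v, p⟩ := x; simp

theorem switchAt_east {T : Filling n} {a b : Fin n} {c e : Box} (hce : e = (c.1, c.2 + 1))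
    (he : HasVal T b e) (h : HasVal T b (c.1 + 1, c.2) → T e = some ⟨b, true⟩)
    (h3 : ¬ (c.1 = c.2 ∧ T e = some ⟨b, true⟩ ∧ HasVal T b (c.1 + 1, c.1 + 1))) :
    switchAt T a b c = exchange T c e := by
  subst hce
  simp only [← hasVal_iff] at *
  unfold switchAt
  simp only [Box.east, Box.south]
  by_cases hs : hasVal T b (c.1 + 1, c.2) = true
  · simp [he, hs, h hs]
  · simp only [he, hs, h3]; simp

theorem switchAt_diag_east {T : Filling n} {a b : Fin n} {c : Box}
    (he : T (c.1, c.2 + 1) = some ⟨b, true⟩) (h : ¬ HasVal T b (c.1 + 1, c.2)) (hc : c.1 = c.2)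
    (hd : HasVal T b (c.1 + 1, c.1 + 1)) :
    switchAt T a b c =
      Function.update (exchange T c (c.1 + 1, c.1 + 1)) (c.1, c.2 + 1) (some ⟨b, false⟩) := by
  have he' : HasVal T b (c.1, c.2 + 1) := ⟨_, he⟩
  obtain ⟨r, s⟩ := c
  obtain rfl : r = s := hc
  simp only [← hasVal_iff] at *
  unfold switchAt
  simp only [Box.east, Box.south]
  simp [he, he', h, hd]

theorem switchAt_south {T : Filling n} {a b : Fin n} {c s : Box} (hcs : s = (c.1 + 1, c.2))
    (hs : HasVal T b s) (h : T (c.1, c.2 + 1) ≠ some ⟨b, true⟩)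
    (h4 : ¬ (c.2 = c.1 + 1 ∧ T c = some ⟨a, false⟩ ∧ HasVal T a (c.1, c.1))) :
    switchAt T a b c = exchange T c s := by
  subst hcs
  have h5 : (decide (c.2 = c.1 + 1) && decide (T c = some ⟨a, false⟩) && hasVal T a (c.1, c.1))
      = false := by
    rw [Bool.eq_false_iff]
    simp only [ne_eq, Bool.and_eq_true, decide_eq_true_eq, hasVal_iff]
    tauto
  simp only [← hasVal_iff] at *
  unfold switchAt
  simp only [Box.east, Box.south, h5, hs, h]
  by_cases he : hasVal T b (c.1, c.2 + 1) = true <;> simp [he]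

theorem switchAt_diag_south {T : Filling n} {a b : Fin n} {c : Box}
    (hs : HasVal T b (c.1 + 1, c.2)) (h : T (c.1, c.2 + 1) ≠ some ⟨b, true⟩)
    (h4 : c.2 = c.1 + 1 ∧ T c = some ⟨a, false⟩ ∧ HasVal T a (c.1, c.1)) :
    switchAt T a b c = diagSwitch T a c.1 := by
  have h5 : (decide (c.2 = c.1 + 1) && decide (T c = some ⟨a, false⟩) && hasVal T a (c.1, c.1))
      = true := by
    simp only [Bool.and_eq_true, decide_eq_true_eq, hasVal_iff]
    tauto
  simp only [← hasVal_iff] at *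
  unfold switchAt
  simp only [Box.east, Box.south, h5, hs, h]
  by_cases he : hasVal T b (c.1, c.2 + 1) = true <;> simp [he]

theorem exchange_apply {T : Filling n} {c y d : Box} :
    exchange T c y d = if d = c then T y else if d = y then T c else T d := by
  unfold exchange
  rw [Equiv.swap_apply_def]
  split_ifs <;> rfl

/-- Some iteration of `step` leads from `T` to `T'`. -/
def Reaches (a b : Fin n) (T T' : Filling n) : Prop := ∃ m, (step a b)^[m] T = T'

theorem Reaches.refl (a b : Fin n) (T : Filling n) : Reaches a b T T := ⟨0, rfl⟩

theorem Reaches.trans {a b : Fin n} {T T' T'' : Filling n} (h : Reaches a b T T')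
    (h' : Reaches a b T' T'') : Reaches a b T T'' := by
  obtain ⟨m, rfl⟩ := h
  obtain ⟨m', rfl⟩ := h'
  exact ⟨m' + m, Function.iterate_add_apply _ _ _ _⟩

theorem Reaches.step {a b : Fin n} {T T' T'' : Filling n} (h : ShiftedBK.step a b T = T')
    (h' : Reaches a b T' T'') : Reaches a b T T'' := Reaches.trans ⟨1, h⟩ h'

theorem step_of_fullySwitched {a b : Fin n} {T : Filling n} (h : FullySwitched T a b) :
    step a b T = T := by
  refine dif_neg ?_
  rintro ⟨c, ⟨h1, h2, -⟩ | ⟨-, h1, h2, -⟩⟩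
  · exact h c ⟨_, h1⟩ h2
  · exact h c ⟨_, h1⟩ h2

/-- `step` fixes fully switched fillings, so every fully switched filling that is reached agrees
with the one at the least possible number of steps. -/
theorem Reaches.switching_eq {a b : Fin n} {T T' : Filling n} (h : Reaches a b T T')
    (hT' : FullySwitched T' a b) : switching a b T = T' := by
  obtain ⟨m, rfl⟩ := h
  have h1 : m ∈ {m | FullySwitched ((ShiftedBK.step a b)^[m] T) a b} := hT'
  have h2 := Nat.sInf_mem ⟨m, h1⟩
  have h3 := Nat.sInf_le h1
  unfold switching
  set k := sInf {m | FullySwitched ((ShiftedBK.step a b)^[m] T) a b}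
  obtain ⟨j, rfl⟩ := Nat.exists_eq_add_of_le' h3
  rw [Function.iterate_add_apply]
  exact (Function.iterate_fixed (step_of_fullySwitched h2) j).symm

/-! ### Sliding one letter -/

/-- The situation in which the letter `a` (or `a'`) in the box `c` slides past the letters `b'` in
the boxes of `P` and `b` in the boxes of `Q`, while the ideal `I` contains the letters that come
before. -/
structure RunHyp (T : Filling n) (a b : Fin n) (I : Set Box) (c : Box) (α : Bool)
    (P Q : List Box) : Prop where
  ideal : IsIdeal I
  lin : LinExt I (c :: (P ++ Q))
  hook : Hook P Q
  val : T c = some ⟨a, α⟩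
  labP : ∀ d ∈ P, T d = some ⟨b, true⟩
  labQ : ∀ d ∈ Q, T d = some ⟨b, false⟩
  bmem : ∀ d, HasVal T b d → d ∈ I ∨ d ∈ P ++ Q
  shifted : ∀ d, HasVal T a d → d.1 ≤ d.2
  left : ∀ d ∈ I, T d = some ⟨a, false⟩ → α = false ∧ d.2 < c.2
  above : α = true → ∀ d ∈ I, T d = some ⟨a, true⟩ → d.1 < c.1
  diag : α = false → ∀ r, (r, r) ∈ I → HasVal T a (r, r) → T (r, r) = some ⟨a, false⟩ ∧
    ∀ r', (r', r') ∈ I → HasVal T a (r', r') → r' = r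

theorem LinExt.nodup {I : Set Box} (hI : IsIdeal I) {L : List Box} (h : LinExt I L) : L.Nodup := by
  refine (LinExt.pairwise hI h).imp ?_
  rintro x _ hxy rfl
  exact hxy ⟨le_rfl, le_rfl⟩

theorem HasVal.unique {T : Filling n} {a b : Fin n} {c : Box} (h : HasVal T a c)
    (h' : HasVal T b c) : a = b := by
  obtain ⟨p, hp⟩ := h
  obtain ⟨p', hp'⟩ := h'
  simp_all

namespace RunHyp

variable {T : Filling n} {a b : Fin n} {I : Set Box} {c : Box} {α : Bool} {P Q : List Box}

theorem hasVal_b (h : RunHyp T a b I c α P Q) {d : Box} (hd : d ∈ P ++ Q) : HasVal T b d := by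
  rcases List.mem_append.1 hd with hd | hd
  · exact ⟨_, h.labP d hd⟩
  · exact ⟨_, h.labQ d hd⟩

/-- The ideal together with `c` and the remaining `b`-boxes is again an ideal and contains every
`b`-box, hence also every northwest neighbour of one. The `a`-letters that have already slid lie
outside it and no longer take part. -/
theorem of_touches (hab : a ≠ b) (h : RunHyp T a b I c α P Q) {d : Box} (hd : HasVal T a d)
    (ht : Touches T b d) : d ∈ I ∨ d = c := by
  have hJ := h.ideal.union h.lin
  have key : ∀ e : Box, HasVal T b e → d.1 ≤ e.1 → d.2 ≤ e.2 → d ∈ I ∨ d = c := by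
    intro e he h1 h2
    have : e ∈ I ∪ {d | d ∈ c :: (P ++ Q)} := by
      rcases h.bmem e he with he | he
      · exact Or.inl he
      · exact Or.inr (List.mem_cons_of_mem _ he)
    rcases hJ.down e this d (h.shifted d hd) h1 h2 with h3 | h3
    · exact Or.inl h3
    · rcases List.mem_cons.1 h3 with h3 | h3
      · exact Or.inr h3
      · exact absurd (hd.unique (h.hasVal_b h3)) hab
  rcases ht with ht | ht
  · exact key _ ht (by simp [Box.east]) (by simp [Box.east])
  · exact key _ ht (by simp [Box.south]) (by simp [Box.south])

/-- The selection rule of the process is reverse standard order: unprimed letters from the right,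
then primed letters from the bottom. The fields `left` and `above` say that the `a`-letters in `I`
come before `c` in this sense. -/
theorem isChosen_iff (hab : a ≠ b) (h : RunHyp T a b I c α P Q) (ht : Touches T b c) (d : Box) :
    IsChosen T a b d ↔ d = c := by
  have hcI := h.lin.1.notMem
  cases α with
  | false =>
    have h1 : IsChosen T a b c := by
      refine Or.inl ⟨h.val, ht, fun d hd htd => ?_⟩
      rcases h.of_touches hab ⟨_, hd⟩ htd with h1 | rfl
      · exact (h.left d h1 hd).2.le
      · exact le_rfl
    refine ⟨?_, fun e => e ▸ h1⟩
    rintro (⟨h2, h3, h4⟩ | ⟨h2, -⟩)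
    · rcases h.of_touches hab ⟨_, h2⟩ h3 with h5 | h5
      · exact absurd (h.left d h5 h2).2 (h4 c h.val ht).not_gt
      · exact h5
    · exact absurd ⟨c, h.val, ht⟩ h2
  | true =>
    have h0 : ¬ ∃ d, T d = some ⟨a, false⟩ ∧ Touches T b d := by
      rintro ⟨d, hd, htd⟩
      rcases h.of_touches hab ⟨_, hd⟩ htd with h1 | rfl
      · exact absurd (h.left d h1 hd).1 (by simp)
      · have := h.val
        rw [hd] at this
        simp at this
    have h1 : IsChosen T a b c := by
      refine Or.inr ⟨h0, h.val, ht, fun d hd htd => ?_⟩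
      rcases h.of_touches hab ⟨_, hd⟩ htd with h1 | rfl
      · exact (h.above rfl d h1 hd).le
      · exact le_rfl
    refine ⟨?_, fun e => e ▸ h1⟩
    rintro (⟨h2, h3, -⟩ | ⟨-, h2, h3, h4⟩)
    · exact absurd ⟨d, h2, h3⟩ h0
    · rcases h.of_touches hab ⟨_, h2⟩ h3 with h5 | h5
      · exact absurd (h.above rfl d h5 h2) (h4 c h.val ht).not_gt
      · exact h5

theorem step_eq (hab : a ≠ b) (h : RunHyp T a b I c α P Q) (ht : Touches T b c) :
    step a b T = switchAt T a b c := by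
  have hex : ∃ d, IsChosen T a b d := ⟨c, (h.isChosen_iff hab ht c).2 rfl⟩
  unfold step
  rw [dif_pos hex, (h.isChosen_iff hab ht _).1 hex.choose_spec]

theorem adjacent_cases (h : RunHyp T a b I c α P Q) {y : Box} (hy : y ∈ P ++ Q)
    (hcy : Adjacent c y) : y = (c.1, c.2 + 1) ∨ y = (c.1 + 1, c.2) := by
  have h1 := (List.pairwise_cons.1 (LinExt.pairwise h.ideal h.lin)).1 y hy
  obtain ⟨y1, y2⟩ := y
  unfold Adjacent at hcy
  simp only [Prod.mk.injEq] at *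
  omega

theorem b_iff (h : RunHyp T a b I c α P Q) {d : Box} (h1 : c.1 ≤ d.1) (h2 : c.2 ≤ d.2) :
    HasVal T b d ↔ d ∈ P ++ Q := by
  refine ⟨fun hd => (h.bmem d hd).resolve_left fun hI => ?_, h.hasVal_b⟩
  exact h.lin.1.notMem (h.ideal.down d hI c h.lin.1.shifted h1 h2)

theorem touches (h : RunHyp T a b I c α P Q) {y : Box} (hy : y ∈ P ++ Q) (hcy : Adjacent c y) :
    Touches T b c := by
  have hb := h.hasVal_b hy
  rcases h.adjacent_cases hy hcy with rfl | rfl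
  · exact Or.inl hb
  · exact Or.inr hb

/-- `h3` excludes (S3), and `h4` excludes (S4) and (S7); the remaining switches are plain exchanges
with the first box of the list. -/
theorem step_exchange (hab : a ≠ b) (h : RunHyp T a b I c α P Q) {y : Box} {L : List Box}
    (hL : P ++ Q = y :: L) (hcy : Adjacent c y)
    (h3 : ¬ (c.1 = c.2 ∧ y = (c.1, c.1 + 1) ∧ y ∈ P))
    (h4 : ¬ (c.2 = c.1 + 1 ∧ y = (c.1 + 1, c.2) ∧ α = false ∧ HasVal T a (c.1, c.1))) :
    step a b T = exchange T c y := by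
  have hy : y ∈ P ++ Q := by simp [hL]
  have hyT : T y = some ⟨b, true⟩ → y ∈ P := by
    intro h1
    rcases List.mem_append.1 hy with h2 | h2
    · exact h2
    · have := h.labQ y h2
      rw [this] at h1
      simp at h1
  rw [h.step_eq hab (h.touches hy hcy)]
  rcases h.adjacent_cases hy hcy with e | e
  · refine switchAt_east e (h.hasVal_b hy) (fun hs => ?_) ?_
    -- The first box `y` is the eastern one. If the southern box holds a `b`-letter as well, then
    -- `y` holds `b'`: an unprimed first box would force the southern one to be strictly to its
    -- right. So (S5) is the rule that applies.
    · rw [h.b_iff (by simp) (by simp)] at hs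
      cases P with
      | cons p P =>
        obtain rfl : p = y := by simpa using (List.cons.inj hL).1
        exact h.labP _ (by simp)
      | nil =>
        simp only [List.nil_append] at hL hs
        subst hL
        rcases List.mem_cons.1 hs with h1 | h1
        · rw [e] at h1; simp at h1
        · have h2 := (List.pairwise_cons.1 h.hook.pairwise_right).1 _ h1
          simp [e, RightOf] at h2
    · rintro ⟨h5, h6, -⟩
      exact h3 ⟨h5, by rw [e, h5], hyT h6⟩
  · refine switchAt_south e (h.hasVal_b hy) (fun he => ?_) ?_
    -- The first box `y` is the southern one. A `b'` to the east would come later in the list and so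
    -- would have to be strictly below `y`; hence the rules (S2) and (S6) apply.
    · have h1 := (h.b_iff (by simp) (by simp)).1 ⟨_, he⟩
      have h2 : (c.1, c.2 + 1) ∈ P := by
        rcases List.mem_append.1 h1 with h2 | h2
        · exact h2
        · rw [h.labQ _ h2] at he
          simp at he
      cases P with
      | nil => simp at h2
      | cons p P =>
        obtain rfl : p = y := by simpa using (List.cons.inj hL).1
        rcases List.mem_cons.1 h2 with h5 | h5
        · rw [e] at h5; simp at h5
        · have h6 := (List.pairwise_cons.1 h.hook.below.1).1 _ h5
          simp [e, Below] at h6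
    · rintro ⟨h5, h6, h7⟩
      refine h4 ⟨h5, e, ?_, h7⟩
      rw [h.val] at h6
      simpa using h6

/-- The situation after the label in `c` has been moved past the first box. -/
theorem next (hab : a ≠ b) (h : RunHyp T a b I c α P Q) {y : Box} {P' Q' : List Box}
    (hL : P ++ Q = y :: (P' ++ Q')) (hk : Hook P' Q') (hP : ∀ d ∈ P', d ∈ P)
    (hQ : ∀ d ∈ Q', d ∈ Q) {T₁ : Filling n} (h1 : HasVal T₁ b (pass c y).1)
    (h2 : T₁ (pass c y).2 = T c) (h3 : ∀ d, d ≠ c → d ≠ y → T₁ d = T d) :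
    RunHyp T₁ a b (insert (pass c y).1 I) (pass c y).2 α P' Q' := by
  have hlin := h.lin
  rw [hL] at hlin
  have hn := LinExt.nodup h.ideal hlin
  have hp := LinExt.pass h.ideal hlin
  have hy : y ∈ P ++ Q := by simp [hL]
  have hyI : y ∉ I := hlin.notMem (by simp)
  have hcI : c ∉ I := hlin.notMem (by simp)
  have hle : c.1 ≤ (pass c y).2.1 ∧ c.2 ≤ (pass c y).2.2 := by
    by_cases hcy : Adjacent c y
    · rw [pass_of_adjacent hcy]
      rcases h.adjacent_cases hy hcy with e | e <;> simp [e]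
    · rw [pass_of_not_adjacent hcy]; simp
  have hmp := mem_pass c y
  have hTI : ∀ d ∈ I, T₁ d = T d := fun d hd =>
    h3 d (fun e => hcI (e ▸ hd)) (fun e => hyI (e ▸ hd))
  have hTL : ∀ d ∈ P' ++ Q', T₁ d = T d := by
    intro d hd
    rw [List.nodup_cons, List.nodup_cons] at hn
    exact h3 d (fun e => hn.1 (by simp [← e, List.mem_append.1 hd]))
      (fun e => hn.2.1 (e ▸ hd))
  constructor
  · exact h.ideal.adjoin hp.1
  · exact hp.2
  · exact hk
  · rw [h2, h.val]
  · intro d hd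
    rw [hTL d (by simp [hd]), h.labP d (hP d hd)]
  · intro d hd
    rw [hTL d (by simp [hd]), h.labQ d (hQ d hd)]
  · intro d hd
    by_cases hd' : d = c ∨ d = y
    · rcases (hmp d).2 hd' with e | e
      · exact Or.inl (Or.inl e)
      · exfalso
        subst e
        exact hab (HasVal.unique ⟨α, by rw [h2, h.val]⟩ hd)
    · rw [not_or] at hd'
      have hd2 : HasVal T b d := by
        obtain ⟨p, hp⟩ := hd
        exact ⟨p, by rw [← h3 d hd'.1 hd'.2, hp]⟩
      rcases h.bmem d hd2 with h4 | h4
      · exact Or.inl (Or.inr h4)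
      · rw [hL] at h4
        exact Or.inr ((List.mem_cons.1 h4).resolve_left hd'.2)
  · intro d hd
    by_cases hd' : d = c ∨ d = y
    · rcases hd' with rfl | rfl
      · exact hlin.shifted (by simp)
      · exact hlin.shifted (by simp)
    · rw [not_or] at hd'
      obtain ⟨p, hp⟩ := hd
      exact h.shifted d ⟨p, by rw [← h3 d hd'.1 hd'.2, hp]⟩
  · rintro d (rfl | hd) hTd
    · exact absurd (HasVal.unique ⟨_, hTd⟩ h1) hab
    · rw [hTI d hd] at hTd
      have := h.left d hd hTd
      exact ⟨this.1, this.2.trans_le hle.2⟩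
  · rintro hα d (rfl | hd) hTd
    · exact absurd (HasVal.unique ⟨_, hTd⟩ h1) hab
    · rw [hTI d hd] at hTd
      exact (h.above hα d hd hTd).trans_le hle.1
  · have key : ∀ r, (r, r) ∈ insert (pass c y).1 I → HasVal T₁ a (r, r) →
        (r, r) ∈ I ∧ HasVal T a (r, r) := by
      rintro r (e | hr) hv
      · exact absurd (hv.unique (e ▸ h1)) hab
      · obtain ⟨p, hp⟩ := hv
        exact ⟨hr, p, by rw [← hTI _ hr, hp]⟩
    intro hα r hr hv
    obtain ⟨hr', hv'⟩ := key r hr hv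
    obtain ⟨h5, h6⟩ := h.diag hα r hr' hv'
    refine ⟨by rw [hTI _ hr', h5], fun r' hr1 hv1 => ?_⟩
    obtain ⟨hr2, hv2⟩ := key r' hr1 hv1
    exact h6 r' hr2 hv2

end RunHyp

/-- The result `T'` of sliding the letter in `c` past the letters in `P` and `Q`, when no letter
other than these is changed. -/
def PlainRun (T T' : Filling n) (a b : Fin n) (I : Set Box) (c : Box) (α : Bool)
    (P Q : List Box) : Prop :=
  ∃ P' Q', P'.length ≤ P.length ∧ (slide c (P ++ Q)).1 = P' ++ Q' ∧ Hook P' Q' ∧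
    (∀ d ∈ P', T' d = some ⟨b, true⟩) ∧ (∀ d ∈ Q', T' d = some ⟨b, false⟩) ∧
    T' (slide c (P ++ Q)).2 = some ⟨a, α⟩ ∧ (∀ d, d ≠ c → d ∉ P ++ Q → T' d = T d) ∧
    (α = false → ∀ r, (r, r) ∈ I → HasVal T a (r, r) → ¬ EntersDiagonal r c (P ++ Q))

/-- The result `T'` of sliding the letter `a` in `c` past the letters in `P` and `Q`, when on the
way it enters the main diagonal from the box `(r, r + 1)` and the `a`-box `(r, r)` is moved along
to `(r, r + 1)`. -/
def DiagRun (T T' : Filling n) (a b : Fin n) (I : Set Box) (c : Box) (P Q : List Box) : Prop :=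
  ∃ r v w, (r, r) ∈ I ∧ HasVal T a (r, r) ∧ c.1 ≤ r ∧ c.2 ≤ r + 1 ∧ ∃ u,
    slide c (P ++ Q) = (u ++ (r, r + 1) :: v, (slide (r + 1, r + 1) w).2) ∧
    v = (slide (r + 1, r + 1) w).1 ∧
    LinExt I (u ++ (r, r + 1) :: (r + 1, r + 1) :: w) ∧ Hook u ((r, r + 1) :: v) ∧
    (∀ d ∈ u, T' d = some ⟨b, true⟩) ∧ T' (r, r) = some ⟨b, false⟩ ∧
    T' (r, r + 1) = some ⟨a, true⟩ ∧ (∀ d ∈ v, T' d = some ⟨b, false⟩) ∧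
    T' (slide c (P ++ Q)).2 = some ⟨a, false⟩ ∧
    (∀ d, d ≠ (r, r) → d ≠ c → d ∉ P ++ Q → T' d = T d)

theorem RunHyp.next_data {T T₁ : Filling n} {a b : Fin n} {I : Set Box} {c : Box} {α : Bool}
    {P Q : List Box} (hab : a ≠ b) (h : RunHyp T a b I c α P Q) {y : Box} {L : List Box}
    (hL : P ++ Q = y :: L) (h1 : HasVal T₁ b (pass c y).1)
    (h3 : ∀ d, d ≠ c → d ≠ y → T₁ d = T d) :
    (∀ r, (r, r) ∈ I → HasVal T a (r, r) →
      (r, r) ∈ insert (pass c y).1 I ∧ HasVal T₁ a (r, r)) ∧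
    (∀ r, (r, r) ∈ insert (pass c y).1 I → HasVal T₁ a (r, r) →
      (r, r) ∈ I ∧ HasVal T a (r, r)) ∧
    (∀ d, d ≠ (pass c y).2 ∧ d ∉ L ↔ d = (pass c y).1 ∨ d ≠ c ∧ d ∉ P ++ Q) := by
  have hlin := h.lin
  rw [hL] at hlin
  have hcI : c ∉ I := hlin.notMem (by simp)
  have hyI : y ∉ I := hlin.notMem (by simp)
  have hTI : ∀ d ∈ I, T₁ d = T d := fun d hd =>
    h3 d (fun e => hcI (e ▸ hd)) (fun e => hyI (e ▸ hd))
  refine ⟨?_, ?_, ?_⟩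
  · rintro r hr ⟨p, hp⟩
    exact ⟨Or.inr hr, p, by rw [hTI _ hr, hp]⟩
  · rintro r (e | hr) hv
    · exact absurd (hv.unique (e ▸ h1)) hab
    · obtain ⟨p, hp⟩ := hv
      exact ⟨hr, p, by rw [← hTI _ hr, hp]⟩
  · intro d
    have hn := LinExt.nodup h.ideal (LinExt.pass h.ideal hlin)
    simp only [List.nodup_cons, List.mem_cons, not_or] at hn
    have hm := mem_pass c y d
    rw [hL, List.mem_cons]
    have e1 : d = (pass c y).1 → d ≠ (pass c y).2 ∧ d ∉ L := by
      rintro rfl; exact hn.1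
    tauto

/-- `hd` excludes the one configuration in which the first downward step of the `b`-hook would turn,
and `hy` says that this first pass does not enter the diagonal. -/
theorem PlainRun.cons_left {T T₁ T' : Filling n} {a b : Fin n} {I : Set Box} {c y : Box} {α : Bool}
    {P Q : List Box} (hab : a ≠ b) (h : RunHyp T a b I c α (y :: P) Q)
    (h1 : T₁ (pass c y).1 = some ⟨b, true⟩) (h3 : ∀ d, d ≠ c → d ≠ y → T₁ d = T d)
    (hd : ¬ (c.1 = c.2 ∧ y = (c.1, c.1 + 1)))
    (hy : y.1 < y.2)
    (hr : PlainRun T₁ T' a b (insert (pass c y).1 I) (pass c y).2 α P Q) :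
    PlainRun T T' a b I c α (y :: P) Q := by
  obtain ⟨P', Q', l, e, k, lP, lQ, lc, lu, ld⟩ := hr
  obtain ⟨g1, -, g3⟩ := h.next_data hab (y := y) (L := P ++ Q) rfl ⟨_, h1⟩ h3
  refine ⟨(pass c y).1 :: P', Q', by simpa using l, by simp [slide, e], ⟨?_, k⟩, ?_, lQ, lc, ?_, ?_⟩
  · obtain ⟨⟨z, hz, hyz⟩, -⟩ := h.hook
    obtain ⟨z', hz', g, -⟩ := LinExt.slide_head (L := P ++ Q) h.ideal h.lin hz
    rw [e] at hz'
    refine ⟨z', hz', (g hyz).resolve_right ?_⟩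
    rintro ⟨e1, e2, -⟩
    exact hd ⟨e1.symm, e2⟩
  · intro d hd
    rcases List.mem_cons.1 hd with rfl | hd
    · have := (g3 (pass c y).1).2 (Or.inl rfl)
      rw [lu _ this.1 this.2, h1]
    · exact lP d hd
  · intro d h4 h5
    have := (g3 d).2 (Or.inr ⟨h4, h5⟩)
    rw [lu _ this.1 this.2]
    exact h3 d h4 (fun e => h5 (by simp [e]))
  · rintro hα r hr hv (⟨-, e2⟩ | e2)
    · rw [e2] at hy; simp at hy
    · exact ld hα r (g1 r hr hv).1 (g1 r hr hv).2 e2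

/-- Rightward steps always survive a slide; `hd` only serves to show that this pass is not an entry
to the diagonal next to a diagonal `a`-box. -/
theorem PlainRun.cons_right {T T₁ T' : Filling n} {a b : Fin n} {I : Set Box} {c y : Box}
    {α : Bool} {Q : List Box} (hab : a ≠ b) (h : RunHyp T a b I c α [] (y :: Q))
    (h1 : T₁ (pass c y).1 = some ⟨b, false⟩) (h3 : ∀ d, d ≠ c → d ≠ y → T₁ d = T d)
    (hd : ¬ (c.2 = c.1 + 1 ∧ y = (c.1 + 1, c.2) ∧ α = false ∧ HasVal T a (c.1, c.1)))
    (hr : PlainRun T₁ T' a b (insert (pass c y).1 I) (pass c y).2 α [] Q) :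
    PlainRun T T' a b I c α [] (y :: Q) := by
  obtain ⟨P', Q', l, e, k, lP, lQ, lc, lu, ld⟩ := hr
  obtain rfl : P' = [] := by simpa using l
  obtain ⟨g1, -, g3⟩ := h.next_data hab (y := y) (L := Q) rfl ⟨_, h1⟩ h3
  refine ⟨[], (pass c y).1 :: Q', by simp, by simpa [slide] using e, ?_, by simp, ?_, lc, ?_, ?_⟩
  · refine hook_cons_right rfl k fun z hz => ?_
    have e' : (slide (pass c y).2 Q).1 = Q' := e
    cases Q with
    | nil =>
      simp only [slide] at e'
      subst e'
      simp at hz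
    | cons y' Q =>
      obtain ⟨z', hz', -, g⟩ := LinExt.slide_head (z := y') h.ideal h.lin (by simp)
      rw [e'] at hz'
      obtain rfl : z = z' := Option.some_injective _ (hz.symm.trans hz')
      exact g ((List.pairwise_cons.1 h.hook.pairwise_right).1 y' (by simp))
  · intro d hd
    rcases List.mem_cons.1 hd with rfl | hd
    · have := (g3 (pass c y).1).2 (Or.inl rfl)
      rw [lu _ this.1 this.2, h1]
    · exact lQ d hd
  · intro d h4 h5
    have := (g3 d).2 (Or.inr ⟨h4, h5⟩)
    rw [lu _ this.1 this.2]
    exact h3 d h4 (fun e => h5 (by simp [e]))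
  · rintro hα r hr hv (⟨e1, e2⟩ | e2)
    · exact hd ⟨by simp [e1], by simp [e1, e2], hα, by simpa [e1] using hv⟩
    · exact ld hα r (g1 r hr hv).1 (g1 r hr hv).2 e2

theorem DiagRun.cons_left {T T₁ T' : Filling n} {a b : Fin n} {I : Set Box} {c y : Box}
    {P Q : List Box} (hab : a ≠ b) (h : RunHyp T a b I c false (y :: P) Q)
    (h1 : T₁ (pass c y).1 = some ⟨b, true⟩) (h3 : ∀ d, d ≠ c → d ≠ y → T₁ d = T d)
    (hd : ¬ (c.1 = c.2 ∧ y = (c.1, c.1 + 1))) (hle : c.1 ≤ (pass c y).2.1 ∧ c.2 ≤ (pass c y).2.2)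
    (hr : DiagRun T₁ T' a b (insert (pass c y).1 I) (pass c y).2 P Q) :
    DiagRun T T' a b I c (y :: P) Q := by
  obtain ⟨r, v, w, rI, rv, r1, r2, u, e, ev, hl, k, lu, lr, la, lv, lc, lo⟩ := hr
  obtain ⟨-, g2, g3⟩ := h.next_data hab (y := y) (L := P ++ Q) rfl ⟨_, h1⟩ h3
  have hlin := LinExt.pass h.ideal h.lin
  obtain ⟨rI', rv'⟩ := g2 r rI rv
  refine ⟨r, v, w, rI', rv', hle.1.trans r1, hle.2.trans r2, (pass c y).1 :: u,
    by simp [slide, e], ev, ⟨hlin.1, hl⟩, ⟨?_, k⟩, ?_, lr, la, lv, lc, ?_⟩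
  · obtain ⟨⟨z, hz, hyz⟩, -⟩ := h.hook
    obtain ⟨z', hz', g, -⟩ := LinExt.slide_head (L := P ++ Q) h.ideal h.lin hz
    rw [e] at hz'
    refine ⟨z', hz', (g hyz).resolve_right ?_⟩
    rintro ⟨e1, e2, -⟩
    exact hd ⟨e1.symm, e2⟩
  · intro d hd
    rcases List.mem_cons.1 hd with rfl | hd
    · have := (g3 (pass c y).1).2 (Or.inl rfl)
      rw [lo _ (fun e => hlin.1.notMem (by rw [e]; exact rI')) this.1 this.2, h1]
    · exact lu d hd
  · intro d h0 h4 h5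
    have := (g3 d).2 (Or.inr ⟨h4, h5⟩)
    rw [lo _ h0 this.1 this.2]
    exact h3 d h4 (fun e => h5 (by simp [e]))

/-- A later entry to the diagonal would use a box `(r + 1, r + 1)` of `Q`, but in a list of
rightward steps only the first box, here `y`, can be on the diagonal. -/
theorem DiagRun.not_cons_right {T T₁ T' : Filling n} {a b : Fin n} {I : Set Box} {c y : Box}
    {Q : List Box} (h : RunHyp T a b I c false [] (y :: Q)) :
    ¬ DiagRun T₁ T' a b (insert (pass c y).1 I) (pass c y).2 [] Q := by
  rintro ⟨r, v, w, rI, rv, r1, r2, u, e, ev, hl, -⟩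
  have h2 := h.ideal.adjoin (LinExt.pass h.ideal h.lin).1
  have h3 : (r + 1, r + 1) ∈ Q := by
    have h4 : (r + 1, r + 1) ∈ (slide (pass c y).2 Q).1 ∨
        (r + 1, r + 1) = (slide (pass c y).2 Q).2 := by
      have h5 : (slide (pass c y).2 ([] ++ Q)).2 = (slide (r + 1, r + 1) w).2 := by rw [e]
      have h6 : (slide (pass c y).2 ([] ++ Q)).1 = u ++ (r, r + 1) :: v := by rw [e]
      simp only [List.nil_append] at h5 h6
      rw [h5, h6, ev]
      have := (mem_slide (r + 1, r + 1) w (r + 1, r + 1)).2 (Or.inl rfl)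
      simp only [List.mem_append, List.mem_cons]
      tauto
    rcases (mem_slide _ _ _).1 h4 with h5 | h5
    · rw [← h5] at r1; simp at r1
    · exact h5
  have h4 := (List.pairwise_cons.1 h.hook.pairwise_right).1 _ h3
  have h5 := h.lin.2.1.shifted
  unfold RightOf at h4
  simp at h4
  omega

/-- The switches (S3): two boxes are passed at once. -/
theorem RunHyp.diag_east {T : Filling n} {a b : Fin n} {I : Set Box} {c : Box} {α : Bool}
    {y : Box} {P Q : List Box} (hab : a ≠ b) (h : RunHyp T a b I c α (y :: P) Q)
    (hc : c.1 = c.2) (hy : y = (c.1, c.1 + 1)) :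
    ∃ Q', P = [] ∧ Q = (c.1 + 1, c.1 + 1) :: Q' ∧ ∃ T₂, step a b T = T₂ ∧
      RunHyp T₂ a b (insert y (insert c I)) (c.1 + 1, c.1 + 1) α [] Q' ∧
      T₂ c = some ⟨b, false⟩ ∧ T₂ y = some ⟨b, false⟩ ∧
      (∀ d, d ≠ c → d ≠ y → d ≠ (c.1 + 1, c.1 + 1) → T₂ d = T d) := by
  have hPQ : P ++ Q = (c.1 + 1, c.1 + 1) :: (P ++ Q).tail := by
    obtain ⟨⟨z, hz, hyz⟩, -⟩ := h.hook
    have hz2 := h.lin.shifted (x := z) (by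
      have := List.mem_of_mem_head? hz
      simp only [List.mem_append] at this
      simp; tauto)
    have hz3 : z = (c.1 + 1, c.1 + 1) := by
      unfold Below at hyz
      rw [hy] at hyz
      obtain ⟨z1, z2⟩ := z
      simp only [Prod.mk.injEq] at *
      omega
    rw [hz3] at hz
    cases hPQ : P ++ Q with
    | nil => simp [hPQ] at hz
    | cons z' L => simpa [hPQ] using hz
  have hP : P = [] := by
    cases P with
    | nil => rfl
    | cons p P =>
      obtain rfl : p = (c.1 + 1, c.1 + 1) := by simpa using hPQ
      have := h.hook.not_diagonal (fun x hx => h.lin.shifted (List.mem_cons_of_mem _ hx))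
        (x := (c.1 + 1, c.1 + 1)) (by simp)
      simp at this
  subst hP
  simp only [List.nil_append] at hPQ
  cases Q with
  | nil => simp at hPQ
  | cons z Q =>
    obtain rfl : z = (c.1 + 1, c.1 + 1) := by simpa using hPQ
    have hcz : c ≠ (c.1 + 1, c.1 + 1) := fun e => by
      have := congrArg Prod.fst e
      simp at this
    have hcy : c ≠ y := fun e => by
      have := congrArg Prod.snd (e.trans hy)
      simp at this; omega
    have hyz : y ≠ (c.1 + 1, c.1 + 1) := by rw [hy]; simp
    have a1 : Adjacent c y := by rw [hy]; unfold Adjacent; simp; omega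
    have a2 : Adjacent y (c.1 + 1, c.1 + 1) := by rw [hy]; unfold Adjacent; simp
    have hz : T (c.1 + 1, c.1 + 1) = some ⟨b, false⟩ := h.labQ _ (by simp)
    refine ⟨Q, rfl, rfl, _, rfl, ?_⟩
    have hstep : step a b T =
        Function.update (exchange T c (c.1 + 1, c.1 + 1)) y (some ⟨b, false⟩) := by
      rw [h.step_eq hab (h.touches (by simp) a1), hy]
      have hy' : T (c.1, c.2 + 1) = some ⟨b, true⟩ := by
        rw [← hc, ← hy]; exact h.labP _ (by simp)
      rw [switchAt_diag_east hy' _ hc ⟨_, hz⟩, hc]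
      rw [h.b_iff (by simp) (by simp)]
      intro hm
      have := h.lin.shifted (List.mem_cons_of_mem _ hm)
      simp at this; omega
    have v1 : step a b T c = some ⟨b, false⟩ := by
      rw [hstep, Function.update_of_ne hcy, exchange_apply, if_pos rfl, hz]
    have v2 : step a b T y = some ⟨b, false⟩ := by
      rw [hstep, Function.update_self]
    have v3 : step a b T (c.1 + 1, c.1 + 1) = T c := by
      rw [hstep, Function.update_of_ne hyz.symm, exchange_apply, if_neg hcz.symm, if_pos rfl]
    have v4 : ∀ d, d ≠ c → d ≠ y → d ≠ (c.1 + 1, c.1 + 1) → step a b T d = T d := by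
      intro d d1 d2 d3
      rw [hstep, Function.update_of_ne d2, exchange_apply, if_neg d1, if_neg d3]
    refine ⟨?_, v1, v2, v4⟩
    -- (S3) does two passes in one step, so `next` is applied twice. The filling between them, with
    -- `a` in `y` and `b` in `c`, is auxiliary and does not occur in the process.
    have n1 := h.next hab (y := y) (P' := []) (Q' := (c.1 + 1, c.1 + 1) :: Q) rfl h.hook.2
      (by simp) (by simp)
      (T₁ := Function.update (Function.update T c (some ⟨b, false⟩)) y (T c))
      (by rw [pass_of_adjacent a1]
          exact ⟨false, by rw [Function.update_of_ne hcy, Function.update_self]⟩)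
      (by rw [pass_of_adjacent a1, Function.update_self])
      (by intro d d1 d2; rw [Function.update_of_ne d2, Function.update_of_ne d1])
    rw [pass_of_adjacent a1] at n1
    have n2 := n1.next hab (y := (c.1 + 1, c.1 + 1)) (P' := []) (Q' := Q) rfl
      (List.Pairwise.of_cons h.hook.2)
      (by simp) (by simp +contextual) (T₁ := step a b T)
      (by rw [pass_of_adjacent a2]; exact ⟨_, v2⟩)
      (by rw [pass_of_adjacent a2, Function.update_self, v3])
      (by
        intro d d1 d2
        rw [Function.update_of_ne d1]
        by_cases d3 : d = c
        · subst d3; rw [Function.update_self, v1]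
        · rw [Function.update_of_ne d3, v4 d d3 d1 d2])
    rwa [pass_of_adjacent a2] at n2

/-- The switches (S4) and (S7). -/
theorem RunHyp.diag_south {T : Filling n} {a b : Fin n} {I : Set Box} {c : Box} {Q : List Box}
    (hab : a ≠ b) (h : RunHyp T a b I c false [] ((c.1 + 1, c.2) :: Q)) (hc : c.2 = c.1 + 1)
    (hv : HasVal T a (c.1, c.1)) :
    ∃ T₁, step a b T = T₁ ∧ (c.1, c.1) ∈ I ∧
      RunHyp T₁ a b (insert c I) (c.1 + 1, c.2) false [] Q ∧
      (∀ r, (r, r) ∈ insert c I → ¬ HasVal T₁ a (r, r)) ∧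
      T₁ (c.1, c.1) = some ⟨b, false⟩ ∧ T₁ c = some ⟨a, true⟩ ∧
      (∀ d, d ≠ (c.1, c.1) → d ≠ c → d ≠ (c.1 + 1, c.2) → T₁ d = T d) := by
  have hrI : (c.1, c.1) ∈ I := by
    refine (h.lin.1.down (c.1, c.1) le_rfl le_rfl (by simp [hc])).resolve_left fun e => ?_
    have := congrArg Prod.snd e
    simp at this; omega
  have hcI := h.lin.1.notMem
  have hyI : (c.1 + 1, c.2) ∉ I := h.lin.notMem (by simp)
  have hc0 : c ≠ (c.1, c.1) := fun e => hcI (by rw [e]; exact hrI)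
  have hcy : c ≠ (c.1 + 1, c.2) := fun e => by
    have := congrArg Prod.fst e
    simp at this
  have h0y : (c.1, c.1) ≠ (c.1 + 1, c.2) := by simp
  have a1 : Adjacent c (c.1 + 1, c.2) := by unfold Adjacent; simp
  have hy : T (c.1 + 1, c.2) = some ⟨b, false⟩ := h.labQ _ (by simp)
  obtain ⟨h00, huniq⟩ := h.diag rfl c.1 hrI hv
  have hstep : step a b T = diagSwitch T a c.1 := by
    rw [h.step_eq hab (h.touches (by simp) a1)]
    refine switchAt_diag_south ⟨_, hy⟩ (fun he => ?_) ⟨hc, h.val, hv⟩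
    have h1 := (h.b_iff (by simp) (by simp)).1 ⟨_, he⟩
    rw [h.labQ _ h1] at he
    simp at he
  have hc' : (c.1, c.1 + 1) = c := by rw [← hc]
  have hy' : (c.1 + 1, c.1 + 1) = (c.1 + 1, c.2) := by rw [hc]
  have v0 : step a b T (c.1, c.1) = some ⟨b, false⟩ := by
    rw [hstep, diagSwitch, hc', Function.update_of_ne hc0.symm, exchange_apply, if_pos rfl, hy', hy]
  have v1 : step a b T c = some ⟨a, true⟩ := by
    rw [hstep, diagSwitch, hc', Function.update_self]
  have v2 : step a b T (c.1 + 1, c.2) = some ⟨a, false⟩ := by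
    rw [hstep, diagSwitch, hc', hy', Function.update_of_ne hcy.symm, exchange_apply,
      if_neg h0y.symm, if_pos rfl, h00]
  have v3 : ∀ d, d ≠ (c.1, c.1) → d ≠ c → d ≠ (c.1 + 1, c.2) → step a b T d = T d := by
    intro d d0 d1 d2
    rw [hstep, diagSwitch, hc', hy', Function.update_of_ne d1, exchange_apply, if_neg d0, if_neg d2]
  have hnd : ∀ r, (r, r) ∈ insert c I → ¬ HasVal (step a b T) a (r, r) := by
    rintro r (e | hr) hvr
    · have e1 := congrArg Prod.fst e
      have e2 := congrArg Prod.snd e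
      simp at e1 e2; omega
    · by_cases hrc : r = c.1
      · subst hrc
        exact hab (hvr.unique ⟨_, v0⟩)
      · obtain ⟨p, hp⟩ := hvr
        rw [v3 (r, r) (by simpa using hrc) (fun e => hcI (e ▸ hr)) (fun e => hyI (e ▸ hr))] at hp
        exact hrc (huniq r hr ⟨_, hp⟩)
  refine ⟨_, rfl, hrI, ?_, hnd, v0, v1, v3⟩
  have hn := LinExt.nodup h.ideal h.lin
  simp only [List.nil_append, List.nodup_cons, List.mem_cons, not_or] at hn
  have hTQ : ∀ d ∈ Q, step a b T d = T d := fun d hd =>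
    v3 d (fun e => h.lin.notMem (x := d) (by simp [hd]) (e ▸ hrI)) (fun e => hn.1.2 (e ▸ hd))
      (fun e => hn.2.1 (e ▸ hd))
  constructor
  · exact h.ideal.adjoin h.lin.1
  · exact h.lin.2
  · exact List.Pairwise.of_cons h.hook
  · exact v2
  · simp
  · intro d hd
    rw [hTQ d hd, h.labQ d (by simp [hd])]
  · intro d hd
    by_cases d1 : d = c
    · exact Or.inl (Or.inl d1)
    by_cases d0 : d = (c.1, c.1)
    · exact Or.inl (Or.inr (d0 ▸ hrI))
    by_cases d2 : d = (c.1 + 1, c.2)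
    · subst d2
      exact absurd (HasVal.unique ⟨_, v2⟩ hd) hab
    obtain ⟨p, hp⟩ := hd
    rw [v3 d d0 d1 d2] at hp
    rcases h.bmem d ⟨_, hp⟩ with h1 | h1
    · exact Or.inl (Or.inr h1)
    · exact Or.inr ((List.mem_cons.1 h1).resolve_left d2)
  · intro d hd
    by_cases d1 : d = c
    · rw [d1]; omega
    by_cases d0 : d = (c.1, c.1)
    · simp [d0]
    by_cases d2 : d = (c.1 + 1, c.2)
    · rw [d2]; simp; omega
    obtain ⟨p, hp⟩ := hd
    rw [v3 d d0 d1 d2] at hp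
    exact h.shifted d ⟨_, hp⟩
  · rintro d (rfl | hd) hTd
    · rw [v1] at hTd; simp at hTd
    · by_cases d0 : d = (c.1, c.1)
      · subst d0
        exact absurd (HasVal.unique ⟨_, hTd⟩ ⟨_, v0⟩) hab
      · rw [v3 d d0 (fun e => hcI (e ▸ hd)) (fun e => hyI (e ▸ hd))] at hTd
        exact h.left d hd hTd
  · intro hα
    simp at hα
  · intro _ r hr hvr
    exact absurd hvr (hnd r hr)

/-- By induction on the number of `b`-boxes still to be passed. A pass of a box that is not adjacent
takes no step, and an adjacent one is a single switch. (S3) performs two passes together and keeps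
the run plain, while (S4) and (S7) make it a diagonal run. -/
theorem RunHyp.run {T : Filling n} {a b : Fin n} {I : Set Box} {c : Box} {α : Bool}
    {P Q : List Box} (hab : a ≠ b) (h : RunHyp T a b I c α P Q) :
    ∃ T', Reaches a b T T' ∧
      (PlainRun T T' a b I c α P Q ∨ α = false ∧ DiagRun T T' a b I c P Q) := by
  induction hl : P.length + Q.length using Nat.strong_induction_on generalizing T I c P Q with
  | _ N ih =>
  subst hl
  -- The generic pass, outside the exceptional configurations: zero steps or one exchange, according
  -- to adjacency.
  have hmove : ∀ y L, P ++ Q = y :: L → ¬ (c.1 = c.2 ∧ y = (c.1, c.1 + 1) ∧ y ∈ P) →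
      ¬ (c.2 = c.1 + 1 ∧ y = (c.1 + 1, c.2) ∧ α = false ∧ HasVal T a (c.1, c.1)) →
      ∃ T₁, Reaches a b T T₁ ∧ T₁ (pass c y).1 = T y ∧ T₁ (pass c y).2 = T c ∧
        (∀ d, d ≠ c → d ≠ y → T₁ d = T d) ∧ c.1 ≤ (pass c y).2.1 ∧ c.2 ≤ (pass c y).2.2 := by
    intro y L hL h3 h4
    by_cases hcy : Adjacent c y
    · refine ⟨exchange T c y, Reaches.step (h.step_exchange hab hL hcy h3 h4) (.refl _ _ _), ?_⟩
      have hne : y ≠ c := by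
        rintro rfl
        unfold Adjacent at hcy; omega
      rw [pass_of_adjacent hcy]
      refine ⟨by simp [exchange_apply], by simp [exchange_apply, hne], fun d d1 d2 => ?_, ?_⟩
      · simp [exchange_apply, d1, d2]
      · rcases h.adjacent_cases (by simp [hL]) hcy with e | e <;> simp [e]
    · refine ⟨T, .refl _ _ _, ?_⟩
      rw [pass_of_not_adjacent hcy]
      simp
  cases P with
  | nil =>
    cases Q with
    | nil =>
      exact ⟨T, .refl _ _ _, Or.inl ⟨[], [], le_rfl, rfl, h.hook, by simp, by simp, h.val,
        fun _ _ _ => rfl, fun _ _ _ _ h => h⟩⟩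
    | cons y Q =>
      by_cases h4 : c.2 = c.1 + 1 ∧ y = (c.1 + 1, c.2) ∧ α = false ∧ HasVal T a (c.1, c.1)
      · obtain ⟨hc, rfl, rfl, hv⟩ := h4
        obtain ⟨T₁, hs, hrI, h1, hnd, v0, v1, v3⟩ := h.diag_south hab hc hv
        obtain ⟨T', hr, hT' | ⟨-, r, -, -, hrI', hv', -⟩⟩ := ih _ (by simp) h1 rfl
        · refine ⟨T', .step hs hr, Or.inr ⟨rfl, ?_⟩⟩
          obtain ⟨P', Q', l, e, k, lP, lQ, lc, lu, ld⟩ := hT'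
          obtain rfl : P' = [] := by simpa using l
          have a1 : Adjacent c (c.1 + 1, c.2) := by unfold Adjacent; simp
          have hn := LinExt.nodup h.ideal h.lin
          simp only [List.nil_append, List.nodup_cons, List.mem_cons, not_or] at hn
          have hc' : (c.1, c.1 + 1) = c := by rw [← hc]
          have hy' : (c.1 + 1, c.1 + 1) = (c.1 + 1, c.2) := by rw [hc]
          simp only [List.nil_append] at e lc
          refine ⟨c.1, Q', Q, hrI, hv, le_rfl, hc.le, [], ?_, ?_, ?_, ?_, by simp, ?_, ?_, lQ, ?_, ?_⟩
          · simp [slide, pass_of_adjacent a1, hc', hy', e]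
          · rw [hy', e]
          · rw [hc', hy']; exact h.lin
          · rw [hc']
            refine hook_cons_right rfl k fun z hz => ?_
            cases Q with
            | nil =>
              simp only [slide] at e
              subst e
              simp at hz
            | cons y' Q =>
              obtain ⟨z', hz', -, g⟩ := LinExt.slide_head (z := y') h.ideal h.lin (by simp)
              rw [pass_of_adjacent a1] at hz' g
              rw [e] at hz'
              obtain rfl : z = z' := Option.some_injective _ (hz.symm.trans hz')
              exact g ((List.pairwise_cons.1 h.hook.pairwise_right).1 y' (by simp))
          · rw [lu, v0]
            · simp
            · exact fun hm => h.lin.notMem (x := (c.1, c.1))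
                (by simp only [List.nil_append] at hm; simp [hm]) hrI
          · rw [hc', lu, v1]
            · exact hn.1.1
            · exact hn.1.2
          · simpa [slide, pass_of_adjacent a1] using lc
          · intro d d0 d1 d2
            simp only [List.nil_append, List.mem_cons, not_or] at d2
            rw [lu d d2.1 d2.2, v3 d d0 d1 d2.1]
        -- A second diagonal switch would need another `a`-box of the ideal on the diagonal, and
        -- none is left after the first.
        · exact absurd hv' (hnd r hrI')
      · obtain ⟨T₁, hs, v1, v2, v3, hle⟩ := hmove y Q rfl (by simp) h4
        rw [h.labQ y (by simp)] at v1
        have h1 := h.next hab (y := y) (P' := []) (Q' := Q) rfl (List.Pairwise.of_cons h.hook)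
          (by simp) (by simp +contextual) ⟨_, v1⟩ v2 v3
        obtain ⟨T', hr, hT' | ⟨rfl, hT'⟩⟩ := ih _ (by simp) h1 rfl
        · exact ⟨T', hs.trans hr, Or.inl (hT'.cons_right hab h v1 v3 h4)⟩
        · exact absurd hT' (DiagRun.not_cons_right h)
  | cons y P =>
    have hy : y.1 < y.2 := h.hook.not_diagonal
      (fun x hx => h.lin.shifted (List.mem_cons_of_mem _ hx)) (by simp)
    by_cases h3 : c.1 = c.2 ∧ y = (c.1, c.1 + 1)
    · obtain ⟨hc, hyc⟩ := h3
      obtain ⟨Q', rfl, rfl, T₂, hs, h2, v1, v2, v3⟩ := h.diag_east hab hc hyc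
      have hcI := h.lin.1.notMem
      have hn := LinExt.nodup h.ideal h.lin
      simp only [List.cons_append, List.nil_append, List.nodup_cons, List.mem_cons, not_or] at hn
      have hdI : ∀ r, (r, r) ∈ I → r ≠ c.1 := by
        rintro r hr rfl
        exact hcI (by rw [← Prod.mk.eta (p := c), ← hc]; exact hr)
      obtain ⟨T', hr, hT' | ⟨rfl, r, -, -, hrI', hv', hr1, -⟩⟩ := ih _ (by simp; omega) h2 rfl
      · refine ⟨T', .step hs hr, Or.inl ?_⟩
        obtain ⟨P', Q₁, l, e, k, lP, lQ, lc, lu, ld⟩ := hT'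
        obtain rfl : P' = [] := by simpa using l
        have a1 : Adjacent c y := by rw [hyc]; unfold Adjacent; simp; omega
        have a2 : Adjacent y (c.1 + 1, c.1 + 1) := by rw [hyc]; unfold Adjacent; simp
        simp only [List.nil_append] at e lc lu ld
        have e' : slide c ([y] ++ (c.1 + 1, c.1 + 1) :: Q') =
            (c :: y :: Q₁, (slide (c.1 + 1, c.1 + 1) Q').2) := by
          simp [slide, pass_of_adjacent a1, pass_of_adjacent a2, e]
        have hlin2 : LinExt (insert c I) (y :: (c.1 + 1, c.1 + 1) :: Q') := h.lin.2
        have k2 : Hook [] (y :: Q₁) := by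
          refine hook_cons_right rfl k fun z hz => ?_
          cases Q' with
          | nil =>
            simp only [slide] at e
            subst e
            simp at hz
          | cons y' Q' =>
            obtain ⟨z', hz', -, g⟩ := LinExt.slide_head (z := y') (h.ideal.adjoin h.lin.1) hlin2
              (by simp)
            rw [pass_of_adjacent a2] at hz' g
            rw [e] at hz'
            obtain rfl : z = z' := Option.some_injective _ (hz.symm.trans hz')
            exact g ((List.pairwise_cons.1 h.hook.pairwise_right).1 y' (by simp))
        refine ⟨[], c :: y :: Q₁, by simp, by rw [e']; rfl, ?_, by simp, ?_, by rw [e']; exact lc,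
          ?_, ?_⟩
        · refine hook_cons_right rfl k2 fun z hz => ?_
          obtain rfl : y = z := by simpa using hz
          rw [hyc]; unfold RightOf; simp; omega
        · intro d hd
          simp only [List.mem_cons] at hd
          rcases hd with rfl | rfl | hd
          · rw [lu _ hn.1.2.1 hn.1.2.2, v1]
          · rw [lu _ hn.2.1.1 hn.2.1.2, v2]
          · exact lQ d hd
        · intro d d1 d2
          simp only [List.cons_append, List.nil_append, List.mem_cons, not_or] at d2
          rw [lu d d2.2.1 d2.2.2, v3 d d1 d2.1 d2.2.1]
        · rintro hα r hrI hv (⟨e1, -⟩ | ⟨e1, -⟩ | e1)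
          · have := congrArg Prod.fst e1
            have := congrArg Prod.snd e1
            simp at *; omega
          · rw [pass_of_adjacent a1] at e1
            have := congrArg Prod.fst (hyc.symm.trans e1)
            exact hdI r hrI (by simpa using this.symm)
          · simp only [pass_of_adjacent a1, pass_of_adjacent a2] at e1
            refine ld hα r (Or.inr (Or.inr hrI)) ?_ e1
            obtain ⟨p, hp⟩ := hv
            refine ⟨p, ?_⟩
            rw [v3, hp]
            · exact fun e => hcI (e ▸ hrI)
            · exact fun e => h.lin.notMem (x := y) (by simp) (e ▸ hrI)
            · exact fun e => h.lin.notMem (x := (c.1 + 1, c.1 + 1)) (by simp) (e ▸ hrI)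
      -- After (S3) the letter sits at `(c.1 + 1, c.1 + 1)`. A diagonal switch would need a diagonal
      -- `a`-box of the ideal at least that far southeast, which would place `c` in `I`.
      · exfalso
        rcases hrI' with e | e | e
        · rw [hyc] at e
          simp only [Prod.mk.injEq] at e; omega
        · exact hab (hv'.unique (e ▸ ⟨_, v1⟩))
        · refine hcI (h.ideal.down _ e c hc.le ?_ ?_)
          · simp at hr1 ⊢; omega
          · simp at hr1 ⊢; omega
    · have h4 : ¬ (c.2 = c.1 + 1 ∧ y = (c.1 + 1, c.2) ∧ α = false ∧ HasVal T a (c.1, c.1)) := by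
        rintro ⟨e1, e2, -⟩
        rw [e2] at hy; simp at hy; omega
      obtain ⟨T₁, hs, v1, v2, v3, hle⟩ := hmove y (P ++ Q) rfl (by tauto) h4
      rw [h.labP y (by simp)] at v1
      have h1 := h.next hab (y := y) (P' := P) (Q' := Q) rfl h.hook.2
        (by simp +contextual) (by simp) ⟨_, v1⟩ v2 v3
      obtain ⟨T', hr, hT' | ⟨rfl, hT'⟩⟩ := ih _ (by simp) h1 rfl
      · exact ⟨T', hs.trans hr, Or.inl (hT'.cons_left hab h v1 v3 h3 hy)⟩
      · exact ⟨T', hs.trans hr, Or.inr ⟨rfl, hT'.cons_left hab h v1 v3 h3 hle⟩⟩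

/-! ### Sliding all letters -/

/-- The letters `a` in the boxes `xs` and the letters `b` in the boxes `ys` extend the ideal `I`. -/
structure Pre (T : Filling n) (a b : Fin n) (I : Set Box) (xs ys : List Box) : Prop where
  ideal : IsIdeal I
  lin : LinExt I (xs ++ ys)
  bmem : ∀ d, HasVal T b d → d ∈ I ∨ d ∈ ys
  shifted : ∀ d, HasVal T a d → d.1 ≤ d.2

/-- The filling `T'` is obtained from `T` by sliding the letters in `xs` past those in `ys`; then
the letters `b'` are in the boxes `P` and the letters `b` are in the boxes `Q`. -/
structure Switched (T T' : Filling n) (a b : Fin n) (xs ys P Q : List Box) : Prop where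
  reaches : Reaches a b T T'
  eq : (switch xs ys).1 = P ++ Q
  hook : Hook P Q
  labP : ∀ d ∈ P, T' d = some ⟨b, true⟩
  labQ : ∀ d ∈ Q, T' d = some ⟨b, false⟩
  vals : ∀ d ∈ (switch xs ys).2, HasVal T' a d
  off : ∀ d, d ∉ xs → d ∉ ys → T' d = T d

theorem Pre.tail {T : Filling n} {a b : Fin n} {I : Set Box} {x : Box} {xs ys : List Box}
    (h : Pre T a b I (x :: xs) ys) : Pre T a b (insert x I) xs ys :=
  ⟨h.ideal.adjoin h.lin.1, h.lin.2, fun d hd => (h.bmem d hd).imp_left Or.inr, h.shifted⟩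

namespace Switched

variable {T T' : Filling n} {a b : Fin n} {I : Set Box} {x : Box} {xs ys P Q : List Box} {α : Bool}

theorem eq_on (hp : Pre T a b I xs ys) (h : Switched T T' a b xs ys P Q) {d : Box} (hd : d ∈ I) :
    T' d = T d :=
  h.off d (fun hm => hp.lin.notMem (List.mem_append_left _ hm) hd)
    (fun hm => hp.lin.notMem (List.mem_append_right _ hm) hd)

theorem runHyp (hab : a ≠ b) (hp : Pre T a b I (x :: xs) ys) (h : Switched T T' a b xs ys P Q)
    (hx : T x = some ⟨a, α⟩)
    (hl : ∀ d ∈ I, T d = some ⟨a, false⟩ → α = false ∧ d.2 < x.2)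
    (ha : α = true → ∀ d ∈ I, T d = some ⟨a, true⟩ → d.1 < x.1)
    (hd : α = false → ∀ r, (r, r) ∈ I → HasVal T a (r, r) → T (r, r) = some ⟨a, false⟩ ∧
      ∀ r', (r', r') ∈ I → HasVal T a (r', r') → r' = r) :
    RunHyp T' a b I x α P Q := by
  have hlin := LinExt.switch hp.tail.ideal (L := []) (by simpa using hp.tail.lin)
  have hI : ∀ d ∈ I, T' d = T d := fun d hd => h.eq_on hp.tail (Or.inr hd)
  have hm := mem_switch xs ys
  constructor
  · exact hp.ideal
  · refine ⟨hp.lin.1, ?_⟩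
    rw [← h.eq]
    exact (linExt_append.1 hlin).1
  · exact h.hook
  · rw [h.eq_on hp.tail (Or.inl rfl), hx]
  · exact h.labP
  · exact h.labQ
  · intro d hb
    rw [← h.eq]
    by_cases hd : d ∈ xs ∨ d ∈ ys
    · rcases (hm d).2 hd with h1 | h1
      · exact Or.inr h1
      · exact absurd ((h.vals d h1).unique hb) hab
    · rw [not_or] at hd
      obtain ⟨p, hp'⟩ := hb
      rw [h.off d hd.1 hd.2] at hp'
      exact (hp.bmem d ⟨p, hp'⟩).imp_right fun h1 => absurd h1 hd.2
  · intro d hd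
    by_cases hd' : d ∈ xs ∨ d ∈ ys
    · exact hp.lin.shifted (by simp; tauto)
    · rw [not_or] at hd'
      obtain ⟨p, hp'⟩ := hd
      rw [h.off d hd'.1 hd'.2] at hp'
      exact hp.shifted d ⟨p, hp'⟩
  · intro d hd hT
    rw [hI d hd] at hT
    exact hl d hd hT
  · intro hα d hd hT
    rw [hI d hd] at hT
    exact ha hα d hd hT
  · have key : ∀ r, (r, r) ∈ I → HasVal T' a (r, r) → HasVal T a (r, r) := by
      rintro r hr ⟨p, hp⟩
      exact ⟨p, by rw [← hI _ hr, hp]⟩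
    intro hα r hr hv
    obtain ⟨h1, h2⟩ := hd hα r hr (key r hr hv)
    exact ⟨by rw [hI _ hr, h1], fun r' hr' hv' => h2 r' hr' (key r' hr' hv')⟩

theorem cons (hp : Pre T a b I (x :: xs) ys) (h : Switched T T' a b xs ys P Q) {T'' : Filling n}
    (hr : Reaches a b T' T'') (h' : PlainRun T' T'' a b I x α P Q) :
    ∃ P' Q', Switched T T'' a b (x :: xs) ys P' Q' ∧
      T'' (slide x (switch xs ys).1).2 = some ⟨a, α⟩ ∧
      (∀ d ∈ (switch xs ys).2, T'' d = T' d) ∧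
      (α = false → ∀ r, (r, r) ∈ I → HasVal T' a (r, r) →
        ¬ EntersDiagonal r x (switch xs ys).1) := by
  obtain ⟨P', Q', -, e, k, lP, lQ, lc, lu, ld⟩ := h'
  have hlin : LinExt I (x :: ((switch xs ys).1 ++ ((switch xs ys).2 ++ []))) :=
    ⟨hp.lin.1, LinExt.switch hp.tail.ideal (by simpa using hp.tail.lin)⟩
  have hn := LinExt.nodup hp.ideal hlin
  rw [h.eq] at hn
  rw [← h.eq] at e lc ld
  have hzs : ∀ d ∈ (switch xs ys).2, T'' d = T' d := by
    intro d hd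
    refine lu d ?_ ?_
    · rintro rfl
      simp [hd] at hn
    · intro hm
      rw [List.nodup_cons, List.append_nil] at hn
      exact List.disjoint_of_nodup_append hn.2 hm hd
  refine ⟨P', Q', ⟨h.reaches.trans hr, by simpa [switch] using e, k, lP, lQ, ?_, ?_⟩, lc, hzs, ld⟩
  · intro d hd
    simp only [switch, List.mem_cons] at hd
    rcases hd with rfl | hd
    · exact ⟨_, lc⟩
    · obtain ⟨p, hp⟩ := h.vals d hd
      exact ⟨p, by rw [hzs d hd, hp]⟩
  · intro d h1 h2
    simp only [List.mem_cons, not_or] at h1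
    rw [lu d h1.1, h.off d h1.2 h2]
    rw [← h.eq]
    intro hm
    have := (mem_switch xs ys d).1 (Or.inl hm)
    tauto

theorem pairwise_diagonal (hp : Pre T a b I xs ys) (h : Switched T T' a b xs ys P Q) :
    (switch xs ys).1.Pairwise fun y z => y.1 = y.2 → z.1 ≠ z.2 := by
  have hlin := LinExt.switch hp.ideal (L := []) (by simpa using hp.lin)
  rw [h.eq] at hlin ⊢
  exact h.hook.pairwise_diagonal fun x hx => hlin.shifted (List.mem_append_left _ hx)

end Switched

theorem Switched.nil {T : Filling n} {a b : Fin n} {P Q : List Box} (hk : Hook P Q)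
    (hP : ∀ d ∈ P, T d = some ⟨b, true⟩) (hQ : ∀ d ∈ Q, T d = some ⟨b, false⟩) :
    Switched T T a b [] (P ++ Q) P Q :=
  ⟨.refl _ _ _, rfl, hk, hP, hQ, by simp [switch], fun _ _ _ => rfl⟩

theorem pairwise_switch_cons {I : Set Box} (hI : IsIdeal I) {x : Box} {xs ys : List Box}
    (hl : LinExt I (x :: (xs ++ ys))) (hr : ∀ y ∈ xs, RightOf x y)
    (hz : (switch xs ys).2.Pairwise RightOf)
    (he : ∀ r y, y ∈ xs.head? → x = (r, r) → ¬ EntersDiagonal r y (switch xs.tail ys).1)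
    (hu : (switch xs.tail ys).1.Pairwise fun y z => y.1 = y.2 → z.1 ≠ z.2) :
    (switch (x :: xs) ys).2.Pairwise RightOf := by
  refine hook_cons_right rfl hz fun z hz => ?_
  cases xs with
  | nil => simp [switch] at hz
  | cons y xs =>
    obtain rfl := Option.some_injective _ (hz.symm.trans (by simp only [switch, List.head?_cons]; rfl))
    exact switch_rightOf hI hl (hr y (by simp)) (fun r => he r y (by simp)) hu

/-- Sliding letters `a` that are too far to the right to enter the main diagonal from an
`a`-box on it. -/
theorem exists_switched_right {T : Filling n} {a b : Fin n} (hab : a ≠ b) {P Q : List Box}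
    (hk : Hook P Q) (hP : ∀ d ∈ P, T d = some ⟨b, true⟩) (hQ : ∀ d ∈ Q, T d = some ⟨b, false⟩)
    {I : Set Box} {xs : List Box} (hp : Pre T a b I xs (P ++ Q))
    (hx : ∀ x ∈ xs, T x = some ⟨a, false⟩) (hr : xs.Pairwise RightOf)
    (hl : ∀ d ∈ I, T d = some ⟨a, false⟩ → ∀ x ∈ xs, d.2 < x.2)
    (hd : ∀ r, (r, r) ∈ I → HasVal T a (r, r) → T (r, r) = some ⟨a, false⟩ ∧
      (∀ r', (r', r') ∈ I → HasVal T a (r', r') → r' = r) ∧ ∀ x ∈ xs, r + 1 < x.2)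
    (hn : ∀ x ∈ xs, x.1 < x.2) :
    ∃ T' P' Q', Switched T T' a b xs (P ++ Q) P' Q' ∧
      (∀ d ∈ (switch xs (P ++ Q)).2, T' d = some ⟨a, false⟩) ∧
      (switch xs (P ++ Q)).2.Pairwise RightOf ∧
      (switch xs.tail (P ++ Q)).1.Pairwise fun y z => y.1 = y.2 → z.1 ≠ z.2 := by
  induction xs generalizing I with
  | nil =>
    refine ⟨T, P, Q, .nil hk hP hQ, by simp [switch], by simp [switch], ?_⟩
    exact (Switched.nil (a := a) hk hP hQ).pairwise_diagonal hp
  | cons x xs ih =>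
    rw [List.pairwise_cons] at hr
    obtain ⟨T', P', Q', hs, hz, hzr, hu⟩ := ih hp.tail (fun y hy => hx y (by simp [hy])) hr.2
      (by
        rintro d (rfl | hd') hT y hy
        · exact (hr.1 y hy).1
        · exact hl d hd' hT y (by simp [hy]))
      (by
        have key : ∀ r, (r, r) ∈ insert x I → (r, r) ∈ I := by
          rintro r (rfl | h)
          · exact absurd (hn (r, r) (by simp)) (lt_irrefl _)
          · exact h
        intro r hr' hv
        obtain ⟨h1, h2, h3⟩ := hd r (key r hr') hv
        exact ⟨h1, fun r' h4 => h2 r' (key r' h4), fun y hy => h3 y (by simp [hy])⟩)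
      (fun y hy => hn y (by simp [hy]))
    have hrun := hs.runHyp hab hp (hx x (by simp))
      (fun d hd' hT => ⟨rfl, hl d hd' hT x (by simp)⟩) (by simp)
      (fun _ r hr hv => ⟨(hd r hr hv).1, (hd r hr hv).2.1⟩)
    obtain ⟨T'', hreach, hplain | ⟨-, r, v, w, hrI, hv, -, hr2, -⟩⟩ := hrun.run hab
    · obtain ⟨P'', Q'', hs', hzx, hzs, -⟩ := hs.cons hp hreach hplain
      refine ⟨T'', P'', Q'', hs', ?_, ?_, hs.pairwise_diagonal hp.tail⟩
      · intro d hd'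
        simp only [switch, List.mem_cons] at hd'
        rcases hd' with rfl | hd'
        · exact hzx
        · rw [hzs d hd', hz d hd']
      · refine pairwise_switch_cons hp.ideal hp.lin hr.1 hzr ?_ hu
        rintro r y - rfl
        exact absurd (hn (r, r) (by simp)) (lt_irrefl _)
    -- A diagonal run at `r` starts in a column at most `r + 1`, whereas `hd` puts `x` strictly to
    -- the right of that column.
    · exfalso
      have hv' : HasVal T a (r, r) := by
        obtain ⟨p, hp'⟩ := hv
        exact ⟨p, by rw [← hs.eq_on hp.tail (Or.inr hrI), hp']⟩
      have := (hd r hrI hv').2.2 x (by simp)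
      omega

theorem slide_of_not_adjacent {x : Box} {ys : List Box} (h : ∀ y ∈ ys, ¬ Adjacent x y) :
    slide x ys = (ys, x) := by
  induction ys with
  | nil => rfl
  | cons y ys ih =>
    simp only [slide, pass_of_not_adjacent (h y (by simp)), ih fun z hz => h z (by simp [hz])]

/-- The end of a run in which a diagonal box has been moved along: the box `(r, r + 1)`, now primed,
slides on. -/
theorem exists_switched_diag {T T' T₂ : Filling n} {a b : Fin n} (hab : a ≠ b) {I : Set Box}
    {x y : Box} {xs ys P Q : List Box} (hp : Pre T a b I (x :: y :: xs) ys)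
    (h : Switched T T' a b xs ys P Q) (hI : ∀ d ∈ I, HasVal T a d → d.1 ≠ d.2)
    (hx : T x = some ⟨a, false⟩) (hI' : ∀ d ∈ I, T d ≠ some ⟨a, false⟩)
    (hz : ∀ d ∈ (switch xs ys).2, T' d = some ⟨a, false⟩)
    (hrun : RunHyp T' a b (insert x I) y false P Q)
    (hr : Reaches a b T' T₂) (hd : DiagRun T' T₂ a b (insert x I) y P Q) :
    ∃ T₃ P' Q', Switched T T₃ a b (x :: y :: xs) ys P' Q' ∧
      T₃ (slide x (switch (y :: xs) ys).1).2 = some ⟨a, true⟩ ∧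
      (∀ d ∈ (switch (y :: xs) ys).2, T₃ d = some ⟨a, false⟩) ∧
      Below (slide x (switch (y :: xs) ys).1).2 (slide y (switch xs ys).1).2 := by
  obtain ⟨r, v, w, rI, rv, -, -, u, e, ev, hl, k, lu, lr, la, lv, lc, lo⟩ := hd
  have hIT' : ∀ d ∈ insert x I, T' d = T d := fun d hd => h.eq_on hp.tail.tail (Or.inr hd)
  -- By `hI` no earlier `a`-letter is on the diagonal, so the one moved along can only be `x`.
  have hxr : x = (r, r) := by
    rcases rI with e | e
    · exact e.symm
    · obtain ⟨p, hp'⟩ := rv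
      rw [hIT' _ (Or.inr e)] at hp'
      exact absurd rfl (hI _ e ⟨p, hp'⟩)
  subst hxr
  have hid := hp.tail.ideal
  have hl' := linExt_append.1 hl
  have hid2 := hid.union hl'.1
  have hlv : LinExt (insert (r, r) I ∪ {d | d ∈ u})
      ((r, r + 1) :: ((slide (r + 1, r + 1) w).1 ++ [(slide (r + 1, r + 1) w).2])) :=
    ⟨hl'.2.1, LinExt.slide (L := []) (hid2.adjoin hl'.2.1) (by simpa using hl'.2.2)⟩
  rw [← ev] at hlv
  have hkv : Hook [] v := List.Pairwise.of_cons k.pairwise_right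
  rw [← h.eq] at e lc lo
  have hc2 : (slide y (switch xs ys).1).2 = (slide (r + 1, r + 1) w).2 := by rw [e]
  have hc1 : (slide y (switch xs ys).1).1 = u ++ (r, r + 1) :: v := by rw [e]
  have hmem : ∀ d, d ∈ u ∨ d = (r, r + 1) ∨ d ∈ v ∨ d = (slide (r + 1, r + 1) w).2 ↔
      d = y ∨ d ∈ (switch xs ys).1 := by
    intro d
    have := mem_slide y (switch xs ys).1 d
    rw [hc2, hc1] at this
    simp only [List.mem_append, List.mem_cons] at this
    rw [← this]; tauto
  have hlall : LinExt (insert (r, r) I) (y :: ((switch xs ys).1 ++ ((switch xs ys).2 ++ []))) :=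
    ⟨hp.lin.2.1, LinExt.switch hp.tail.tail.ideal (by simpa using hp.tail.tail.lin)⟩
  have hnall := LinExt.nodup hid hlall
  have hnotzs : ∀ d, d = y ∨ d ∈ (switch xs ys).1 → d ∉ (switch xs ys).2 := by
    intro d hd hd'
    rw [List.nodup_cons, List.append_nil] at hnall
    rcases hd with rfl | hd
    · exact hnall.1 (List.mem_append_right _ hd')
    · exact List.disjoint_of_nodup_append hnall.2 hd hd'
  have hnl := LinExt.nodup hid2 hlv
  simp only [List.nodup_cons, List.mem_append, List.mem_singleton, not_or] at hnl
  -- The diagonal switch has already carried the label of `x` to `(r, r + 1)` as `a'`. What remains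
  -- is its run past `v` alone, with `(r, r)` and `u` counted as part of the ideal.
  have hrun2 : RunHyp T₂ a b (insert (r, r) I ∪ {d | d ∈ u}) (r, r + 1) true [] v := by
    constructor
    · exact hid2
    · exact ((linExt_append (L := (r, r + 1) :: v)).1 hlv).1
    · exact hkv
    · exact la
    · simp
    · exact lv
    · intro d hd
      by_cases h1 : d = (r, r)
      · exact Or.inl (Or.inl (Or.inl h1))
      by_cases h2 : d = y ∨ d ∈ (switch xs ys).1
      · rcases (hmem d).2 h2 with h3 | rfl | h3 | rfl
        · exact Or.inl (Or.inr h3)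
        · exact absurd (HasVal.unique ⟨_, la⟩ hd) hab
        · exact Or.inr h3
        · rw [hc2] at lc
          exact absurd (HasVal.unique ⟨_, lc⟩ hd) hab
      · rw [not_or] at h2
        obtain ⟨p, hp'⟩ := hd
        rw [lo d h1 h2.1 h2.2] at hp'
        rcases hrun.bmem d ⟨p, hp'⟩ with h3 | h3
        · exact Or.inl (Or.inl h3)
        · rw [← h.eq] at h3
          exact absurd h3 h2.2
    · intro d hd
      by_cases h1 : d = (r, r)
      · simp [h1]
      by_cases h2 : d = y ∨ d ∈ (switch xs ys).1
      · refine hlall.shifted (x := d) ?_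
        simp only [List.mem_cons, List.mem_append]
        tauto
      · rw [not_or] at h2
        obtain ⟨p, hp'⟩ := hd
        rw [lo d h1 h2.1 h2.2] at hp'
        exact hrun.shifted d ⟨p, hp'⟩
    · rintro d ((rfl | hd) | hd) hT
      · rw [lr] at hT
        exact absurd (by simpa using hT) hab.symm
      · have h1 : d ≠ (r, r) := fun e => hp.lin.1.notMem (e ▸ hd)
        rw [lo d h1 (fun e => hlall.notMem (x := d) (by simp [e]) (Or.inr hd))
          (fun e => hlall.notMem (x := d) (by simp [e]) (Or.inr hd)), hIT' d (Or.inr hd)] at hT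
        exact absurd hT (hI' d hd)
      · rw [lu d hd] at hT
        simp at hT
    · rintro - d ((rfl | hd) | hd) hT
      · rw [lr] at hT
        simp at hT
      · by_contra hcon
        have h2 := hp.ideal.shifted d hd
        simp at hcon
        exact hp.lin.1.notMem (hp.ideal.down d hd (r, r) le_rfl hcon (hcon.trans h2))
      · rw [lu d hd] at hT
        exact absurd (by simpa using hT) hab.symm
    · simp
  obtain ⟨T₃, hr3, hT₃ | ⟨h1, -⟩⟩ := hrun2.run hab
  swap
  · simp at h1
  obtain ⟨P', Q', l, e3, k3, -, lQ3, lc3, lu3, -⟩ := hT₃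
  obtain rfl : P' = [] := by simpa using l
  simp only [List.nil_append] at e3 lc3 lu3
  -- The only neighbour of `(r, r)` in the shifted plane that can lie outside the ideal is `(r, r +
  -- 1)`, and this is added after `u`.
  have hnu : ∀ d ∈ u, ¬ Adjacent (r, r) d := by
    intro d hd ha
    have h1 : d ≠ (r, r + 1) := by
      rintro rfl
      exact hl'.2.1.notMem (Or.inr hd)
    have h2 := hl'.1.shifted hd
    have h3 : d ∉ insert (r, r) I := hl'.1.notMem hd
    have h4 : ¬ (d.1 ≤ r ∧ d.2 ≤ r) := fun h4 => h3 (hid.down _ (Or.inl rfl) d h2 h4.1 h4.2)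
    obtain ⟨d1, d2⟩ := d
    unfold Adjacent at ha
    simp only [ne_eq, Prod.mk.injEq] at *
    omega
  have a1 : Adjacent (r, r) (r, r + 1) := by unfold Adjacent; simp
  -- On lists, `x` slides past `u` without moving, then steps from `(r, r)` to `(r, r + 1)` and goes
  -- on through `v`. The last part is exactly the run `hrun2`.
  have hsl : slide (r, r) (switch (y :: xs) ys).1 =
      (u ++ (r, r) :: (slide (r, r + 1) v).1, (slide (r, r + 1) v).2) := by
    simp only [switch]
    rw [hc1, slide_append, slide_of_not_adjacent hnu]
    simp [slide, pass_of_adjacent a1]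
  have h_off : ∀ d, d ∉ v → d ≠ (r, r + 1) → T₃ d = T₂ d := fun d h1 h2 => lu3 d h2 h1
  have hrr : (r, r) ∉ v := fun hm =>
    hlv.notMem (x := (r, r)) (by simp [hm]) (Or.inl (Or.inl rfl))
  have hc'val : T₃ (slide (r + 1, r + 1) w).2 = some ⟨a, false⟩ := by
    rw [h_off _ _ (fun e => hnl.1.2 e.symm), ← hc2, lc]
    intro hm
    have := hnl.2
    rw [List.nodup_append] at this
    exact this.2.2 _ hm _ (by simp) rfl
  have hzs3 : ∀ d ∈ (switch xs ys).2, T₃ d = some ⟨a, false⟩ := by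
    intro d hd
    have h0 : ¬ (d = y ∨ d ∈ (switch xs ys).1) := fun h0 => hnotzs d h0 hd
    have h1 := h0
    rw [← hmem] at h1
    rw [not_or] at h0
    rw [h_off d (by tauto) (by tauto), lo d _ h0.1 h0.2, hz d hd]
    rintro rfl
    exact hlall.notMem (x := (r, r)) (by simp [hd]) (Or.inl rfl)
  have hy3 : ∀ d ∈ (switch (y :: xs) ys).2, T₃ d = some ⟨a, false⟩ := by
    intro d hd
    simp only [switch, List.mem_cons] at hd
    rcases hd with rfl | hd
    · rw [hc2, hc'val]
    · exact hzs3 d hd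
  have hx3 : T₃ (slide (r, r) (switch (y :: xs) ys).1).2 = some ⟨a, true⟩ := by
    rw [hsl]; exact lc3
  refine ⟨T₃, u, (r, r) :: Q', ⟨(h.reaches.trans hr).trans hr3, ?_, ?_, ?_, ?_, ?_, ?_⟩, hx3, hy3, ?_⟩
  · show (slide (r, r) (switch (y :: xs) ys).1).1 = _
    rw [hsl, e3]
  · have hb := k.below
    refine hook_of hb.1 ?_ ?_
    · intro p hp'
      obtain ⟨q, hq, hpq⟩ := hb.2 p hp'
      obtain rfl : (r, r + 1) = q := by simpa using hq
      have h1 : p ≠ (r, r) := by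
        rintro rfl
        exact hl'.1.notMem hp' (Or.inl rfl)
      have h2 := hl'.1.shifted hp'
      refine ⟨(r, r), by simp, ?_⟩
      unfold Below at *
      simp at hpq ⊢
      omega
    · refine hook_cons_right rfl k3 fun z hz => ?_
      have h1 := List.pairwise_cons.1 k.pairwise_right
      cases v with
      | nil =>
        simp only [slide] at e3
        rw [← e3] at hz
        simp at hz
      | cons v0 v =>
        have h2 := h1.1 v0 (by simp)
        simp only [slide] at e3
        rw [← e3] at hz
        obtain rfl : (pass (r, r + 1) v0).1 = z := by simpa using hz
        unfold pass RightOf at *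
        split_ifs <;> simp at h2 ⊢; omega
  · intro d hd
    rw [h_off d _ _, lu d hd]
    · intro hm
      exact hlv.notMem (x := d) (by simp [hm]) (Or.inr hd)
    · rintro rfl
      exact hl'.2.1.notMem (Or.inr hd)
  · intro d hd
    rcases List.mem_cons.1 hd with rfl | hd
    · rw [h_off _ hrr (by simp), lr]
    · exact lQ3 d hd
  · intro d hd
    change d ∈ (slide (r, r) (switch (y :: xs) ys).1).2 :: (switch (y :: xs) ys).2 at hd
    rcases List.mem_cons.1 hd with rfl | hd
    · exact ⟨_, hx3⟩
    · exact ⟨_, hy3 d hd⟩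
  · intro d h1 h2
    simp only [List.mem_cons, not_or] at h1
    have h0 : ¬ (d = y ∨ d ∈ (switch xs ys).1) := by
      rintro (h0 | h0)
      · exact h1.2.1 h0
      · have := (mem_switch xs ys d).1 (Or.inl h0)
        tauto
    have h3 := h0
    rw [← hmem] at h3
    rw [not_or] at h0
    rw [h_off d (by tauto) (by tauto), lo d h1.1 h0.1 h0.2, h.off d h1.2.2 h2]
  · rw [hsl, hc2]
    have := slide_slide_below hid2 hl'.2 (by unfold Below; simp)
    rwa [← ev] at this

/-- Only the first unprimed box can be on the main diagonal, and only the second starts far enough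
left to drag it along. If that happens, the first letter becomes the last primed one; otherwise all
letters stay unprimed and keep going right. -/
theorem exists_switched_unprimed {T : Filling n} {a b : Fin n} (hab : a ≠ b) {P Q : List Box}
    (hk : Hook P Q) (hP : ∀ d ∈ P, T d = some ⟨b, true⟩) (hQ : ∀ d ∈ Q, T d = some ⟨b, false⟩)
    {I : Set Box} {xs : List Box} (hp : Pre T a b I xs (P ++ Q)) (hr : xs.Pairwise RightOf)
    (hx : ∀ x ∈ xs, T x = some ⟨a, false⟩)
    (hI : ∀ d ∈ I, HasVal T a d → T d = some ⟨a, true⟩ ∧ ∀ x ∈ xs.head?, Below d x) :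
    ∃ T' P' Q' P₂ Q₂, Switched T T' a b xs (P ++ Q) P' Q' ∧
      (switch xs (P ++ Q)).2 = P₂ ++ Q₂ ∧ Hook P₂ Q₂ ∧
      (∀ d ∈ P₂, T' d = some ⟨a, true⟩) ∧ (∀ d ∈ Q₂, T' d = some ⟨a, false⟩) := by
  cases xs with
  | nil =>
    exact ⟨T, P, Q, [], [], .nil hk hP hQ, rfl, List.Pairwise.nil, by simp, by simp⟩
  | cons x xs =>
    rw [List.pairwise_cons] at hr
    have hIu : ∀ d ∈ I, T d ≠ some ⟨a, false⟩ := by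
      intro d hd hT
      have := (hI d hd ⟨_, hT⟩).1
      rw [hT] at this
      simp at this
    have hId : ∀ d ∈ I, HasVal T a d → d.1 ≠ d.2 := by
      intro d hd hv
      have h1 := (hI d hd hv).2 x (by simp)
      have h2 := hp.lin.1.shifted
      unfold Below at h1
      omega
    -- The leftmost unprimed letter itself always runs plainly, because no earlier `a`-letter is on
    -- the diagonal.
    have hfirst : ∀ {T' P' Q'}, Switched T T' a b xs (P ++ Q) P' Q' →
        (∀ d ∈ (switch xs (P ++ Q)).2, T' d = some ⟨a, false⟩) →
        ∃ T'' P'' Q'', Switched T T'' a b (x :: xs) (P ++ Q) P'' Q'' ∧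
          ∀ d ∈ (switch (x :: xs) (P ++ Q)).2, T'' d = some ⟨a, false⟩ := by
      intro T' P' Q' hs hz
      have hrun := hs.runHyp hab hp (hx x (by simp)) (fun d hd hT => absurd hT (hIu d hd)) (by simp)
        (fun _ r hr hv => absurd rfl (hId _ hr hv))
      obtain ⟨T'', hreach, hplain | ⟨-, r, -, -, hrI, ⟨p, hv⟩, -⟩⟩ := hrun.run hab
      · obtain ⟨P'', Q'', hs', hzx, hzs, -⟩ := hs.cons hp hreach hplain
        refine ⟨T'', P'', Q'', hs', fun d hd => ?_⟩
        simp only [switch, List.mem_cons] at hd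
        rcases hd with rfl | hd
        · exact hzx
        · rw [hzs d hd, hz d hd]
      · rw [hs.eq_on hp.tail (Or.inr hrI)] at hv
        exact absurd rfl (hId _ hrI ⟨p, hv⟩)
    cases xs with
    | nil =>
      obtain ⟨T', P', Q', hs, hz⟩ := hfirst (.nil hk hP hQ) (by simp [switch])
      exact ⟨T', P', Q', [], _, hs, rfl, List.pairwise_singleton _ _, by simp, hz⟩
    | cons y xs =>
      have hxy := hr.1 y (by simp)
      have hr2 := List.pairwise_cons.1 hr.2
      have hxs := hp.lin.1.shifted
      have hnd : ∀ z ∈ y :: xs, z.1 < z.2 := by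
        intro z hz
        have := hr.1 z hz
        unfold RightOf at this
        omega
      have hdiag : ∀ r, (r, r) ∈ insert x I → HasVal T a (r, r) → (r, r) = x := by
        rintro r (e | h) hv
        · exact e
        · exact absurd rfl (hId _ h hv)
      have hdiag2 : ∀ r, (r, r) ∈ insert y (insert x I) → HasVal T a (r, r) → (r, r) = x := by
        rintro r (rfl | h) hv
        · exact absurd (hnd (r, r) (by simp)) (lt_irrefl _)
        · exact hdiag r h hv
      obtain ⟨T', P', Q', hs, hz, hzr, hu⟩ := exists_switched_right hab hk hP hQ hp.tail.tail
        (fun z hz => hx z (by simp [hz])) hr2.2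
        (by
          rintro d (rfl | rfl | hd) hT z hz
          · exact (hr2.1 z hz).1
          · exact (hr.1 z (by simp [hz])).1
          · exact absurd hT (hIu d hd))
        (by
          intro r hrI hv
          have hrx := hdiag2 r hrI hv
          refine ⟨hrx ▸ hx x (by simp), fun r' hr' hv' => ?_, fun z hz => ?_⟩
          · exact congrArg Prod.fst ((hdiag2 r' hr' hv').trans hrx.symm)
          · have h1 := (hr2.1 z hz).1
            have h2 := hxy.1
            rw [← hrx] at h2
            simp at h2
            omega)
        (fun z hz => hnd z (by simp [hz]))
      have hrun := hs.runHyp hab hp.tail (hx y (by simp))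
        (by
          rintro d (rfl | hd) hT
          · exact ⟨rfl, hxy.1⟩
          · exact absurd hT (hIu d hd))
        (by simp)
        (by
          intro _ r hrI hv
          have hrx := hdiag r hrI hv
          refine ⟨hrx ▸ hx x (by simp), fun r' hr' hv' => ?_⟩
          exact congrArg Prod.fst ((hdiag r' hr' hv').trans hrx.symm))
      obtain ⟨T₂, hreach, hplain | ⟨-, hdr⟩⟩ := hrun.run hab
      · obtain ⟨P₂, Q₂, hs2, hzy, hzs, hent⟩ := hs.cons hp.tail hreach hplain
        have hz2 : ∀ d ∈ (switch (y :: xs) (P ++ Q)).2, T₂ d = some ⟨a, false⟩ := by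
          intro d hd
          simp only [switch, List.mem_cons] at hd
          rcases hd with rfl | hd
          · exact hzy
          · rw [hzs d hd, hz d hd]
        obtain ⟨T₃, P₃, Q₃, hs3, hz3⟩ := hfirst hs2 hz2
        refine ⟨T₃, P₃, Q₃, [], _, hs3, rfl, ?_, by simp, hz3⟩
        have h2 : (switch (y :: xs) (P ++ Q)).2.Pairwise RightOf := by
          refine pairwise_switch_cons hp.tail.ideal hp.tail.lin hr2.1 hzr ?_ hu
          rintro r z - rfl
          exact absurd (hnd (r, r) (by simp)) (lt_irrefl _)
        refine pairwise_switch_cons hp.ideal hp.lin hr.1 h2 ?_ (hs.pairwise_diagonal hp.tail.tail)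
        rintro r z hz rfl
        obtain rfl : y = z := by simpa using hz
        -- As the run of `y` was plain, it did not enter the diagonal beside the `a` still at `x`;
        -- this is what preserves the rightward step from `x` to `y`.
        refine hent rfl r (Or.inl rfl) ⟨false, ?_⟩
        rw [hs.eq_on hp.tail.tail (Or.inr (Or.inl rfl)), hx _ (by simp)]
      · obtain ⟨T₃, P₃, Q₃, hs3, hzx, hzy, hb⟩ := exists_switched_diag hab hp hs hId (hx x (by simp))
          hIu hz hrun hreach hdr
        refine ⟨T₃, P₃, Q₃, [_], _, hs3, rfl, ⟨⟨_, rfl, hb⟩, ?_⟩, by simpa using hzx, hzy⟩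
        refine pairwise_switch_cons hp.tail.ideal hp.tail.lin hr2.1 hzr ?_ hu
        rintro r z - rfl
        exact absurd (hnd (r, r) (by simp)) (lt_irrefl _)

/-- Primed letters slide after the unprimed ones. They never trigger a diagonal switch, and their
downward steps always survive (`switch_below`), so they can be prepended one at a time. -/
theorem exists_switched {T : Filling n} {a b : Fin n} (hab : a ≠ b) {P Q : List Box}
    (hk : Hook P Q) (hP : ∀ d ∈ P, T d = some ⟨b, true⟩) (hQ : ∀ d ∈ Q, T d = some ⟨b, false⟩)
    {I : Set Box} {P₁ Q₁ : List Box} (hk₁ : Hook P₁ Q₁) (hp : Pre T a b I (P₁ ++ Q₁) (P ++ Q))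
    (hP₁ : ∀ d ∈ P₁, T d = some ⟨a, true⟩) (hQ₁ : ∀ d ∈ Q₁, T d = some ⟨a, false⟩)
    (hI : ∀ d ∈ I, HasVal T a d → T d = some ⟨a, true⟩ ∧ ∀ x ∈ (P₁ ++ Q₁).head?, Below d x) :
    ∃ T' P' Q' P₂ Q₂, Switched T T' a b (P₁ ++ Q₁) (P ++ Q) P' Q' ∧
      (switch (P₁ ++ Q₁) (P ++ Q)).2 = P₂ ++ Q₂ ∧ Hook P₂ Q₂ ∧
      (∀ d ∈ P₂, T' d = some ⟨a, true⟩) ∧ (∀ d ∈ Q₂, T' d = some ⟨a, false⟩) := by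
  induction P₁ generalizing I with
  | nil => exact exists_switched_unprimed hab hk hP hQ hp hk₁ hQ₁ hI
  | cons x P₁ ih =>
    obtain ⟨⟨y, hy, hxy⟩, hk₁⟩ := hk₁
    have hIx : ∀ d ∈ I, HasVal T a d → T d = some ⟨a, true⟩ ∧ Below d x :=
      fun d hd hv => ⟨(hI d hd hv).1, (hI d hd hv).2 x (by simp)⟩
    obtain ⟨T', P', Q', P₂, Q₂, hs, e2, k2, l2, l3⟩ := ih hk₁ hp.tail
      (fun d hd => hP₁ d (by simp [hd]))
      (by
        rintro d (rfl | hd) hv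
        · refine ⟨hP₁ _ (by simp), fun z hz => ?_⟩
          obtain rfl := Option.some_injective _ (hy.symm.trans hz)
          exact hxy
        · refine ⟨(hIx d hd hv).1, fun z hz => ?_⟩
          obtain rfl := Option.some_injective _ (hy.symm.trans hz)
          exact (hIx d hd hv).2.trans hxy)
    have hrun := hs.runHyp hab hp (hP₁ x (by simp))
      (by
        intro d hd hT
        have := (hIx d hd ⟨_, hT⟩).1
        rw [hT] at this
        simp at this)
      (fun _ d hd hT => (hIx d hd ⟨_, hT⟩).2.1) (by simp)
    obtain ⟨T'', hreach, hplain | ⟨h, -⟩⟩ := hrun.run hab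
    swap
    · simp at h
    obtain ⟨P'', Q'', hs', hzx, hzs, -⟩ := hs.cons hp hreach hplain
    refine ⟨T'', P'', Q'', _ :: P₂, Q₂, hs', by simp only [switch, List.cons_append, e2]; rfl,
      ⟨?_, k2⟩, ?_, ?_⟩
    · rw [← e2]
      exact switch_below hp.ideal hp.lin hy hxy
    · intro d hd
      rcases List.mem_cons.1 hd with rfl | hd
      · exact hzx
      · rw [hzs d (by simp [e2, hd]), l2 d hd]
    · intro d hd
      rw [hzs d (by simp [e2, hd]), l3 d hd]

/-! ### Shapes -/

/-- Equivalently, `i + parts[i]` is weakly decreasing in `i`, which makes the shifted shape an order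
ideal. -/
theorem StrictPartition.add_le_getElem (m : StrictPartition) {i j : ℕ} (hij : i ≤ j)
    (hj : j < m.parts.length) : m.parts[j] + (j - i) ≤ m.parts[i] := by
  induction j, hij using Nat.le_induction with
  | base => simp
  | succ j hij ih =>
    have h1 := ih (by omega)
    have h2 := List.pairwise_iff_getElem.1 m.sorted j (j + 1) (by omega) hj (by omega)
    omega

theorem StrictPartition.isIdeal (m : StrictPartition) : IsIdeal m.shape := by
  constructor
  · rintro x ⟨-, h, -⟩
    exact h
  · rintro x ⟨h1, h2, h3⟩ d h4 h5 h6
    refine ⟨h5.trans_lt h1, h4, ?_⟩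
    have := m.add_le_getElem h5 h1
    omega

theorem StrictPartition.finite_shape (m : StrictPartition) : m.shape.Finite := by
  refine (Finset.finite_toSet (Finset.range m.parts.length ×ˢ
    Finset.range (m.parts.length + m.parts.sum))).subset ?_
  rintro c ⟨h1, h2, h3⟩
  have := List.le_sum_of_mem (List.getElem_mem h1)
  simp
  omega

theorem exists_sorted_list {S : Set Box} (hS : S.Finite) (f : Box → ℕ) :
    ∃ L : List Box, (∀ c, c ∈ S ↔ c ∈ L) ∧ L.Pairwise fun x y => x ≠ y ∧ f x ≤ f y := by
  classical
  have ht : Std.Total (fun x y : Box => f x ≤ f y) := ⟨fun x y => le_total _ _⟩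
  have hr : IsTrans Box (fun x y : Box => f x ≤ f y) := ⟨fun x y z => le_trans⟩
  refine ⟨hS.toFinset.toList.insertionSort (fun x y => f x ≤ f y), by simp, ?_⟩
  refine List.Pairwise.and ?_ (List.pairwise_insertionSort _ _)
  exact (List.perm_insertionSort _ _).nodup_iff.2 (Finset.nodup_toList _)

/-! ### The lists of boxes of a tableau -/

/-- The boxes that are filled with letters smaller than `k` or are in the inner shape. -/
def inner (m : StrictPartition) (T : Filling n) (k : Fin n) : Set Box :=
  m.shape ∪ {c | ∃ x, T c = some x ∧ x.val < k}

/-- `P` and `Q` are the lists of the boxes that hold `k'` and `k`, in standard order. -/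
structure Listing (m : StrictPartition) (T : Filling n) (k : Fin n) (P Q : List Box) : Prop where
  primed : ∀ c, T c = some ⟨k, true⟩ ↔ c ∈ P
  unprimed : ∀ c, T c = some ⟨k, false⟩ ↔ c ∈ Q
  hook : Hook P Q
  ideal : IsIdeal (inner m T k)
  lin : LinExt (inner m T k) (P ++ Q)

theorem Listing.hasVal_iff {m : StrictPartition} {T : Filling n} {k : Fin n} {P Q : List Box}
    (h : Listing m T k P Q) {c : Box} : HasVal T k c ↔ c ∈ P ++ Q := by
  rw [List.mem_append, ← h.primed, ← h.unprimed]
  constructor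
  · rintro ⟨p, hp⟩
    cases p
    · exact Or.inr hp
    · exact Or.inl hp
  · rintro (h | h)
    · exact ⟨_, h⟩
    · exact ⟨_, h⟩

section ShST

variable {l m : StrictPartition} {T : Filling n} (hT : T ∈ ShST l m n)

include hT

theorem mem_skewShape_of_mem_ShST {c : Box} {x : Letter n} (hc : T c = some x) :
    c ∈ skewShape l m := by
  rw [← hT.1]; exact ⟨x, hc⟩

theorem filled_of_mem_ShST {x y : Box} {X Y : Letter n} (hx : T x = some X) (hy : T y = some Y)
    {d : Box} (hd : d.1 ≤ d.2) (h1 : x.1 ≤ d.1) (h2 : x.2 ≤ d.2) (h3 : d.1 ≤ y.1)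
    (h4 : d.2 ≤ y.2) : ∃ D, T d = some D := by
  have hx' := mem_skewShape_of_mem_ShST hT hx
  have hy' := mem_skewShape_of_mem_ShST hT hy
  have : d ∈ T.support := by
    rw [hT.1]
    refine ⟨l.isIdeal.down _ hy'.1 d hd h3 h4, fun hm => hx'.2 ?_⟩
    exact m.isIdeal.down _ hm x (l.isIdeal.shifted x hx'.1) h1 h2
  exact this

theorem rank_le_of_mem_ShST {x y : Box} {X Y : Letter n} (hx : T x = some X) (hy : T y = some Y)
    (h1 : x.1 ≤ y.1) (h2 : x.2 ≤ y.2) : X.rank ≤ Y.rank := by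
  have hx' := l.isIdeal.shifted x (mem_skewShape_of_mem_ShST hT hx).1
  -- Compare through the corner in the row of `x` and the column of `y`; the opposite corner may lie
  -- below the main diagonal.
  obtain ⟨D, hD⟩ := filled_of_mem_ShST hT hx hy (d := (x.1, y.2)) (hx'.trans h2) le_rfl h2 h1 le_rfl
  have e1 : X.rank ≤ D.rank := by
    rcases h2.eq_or_lt with e | e
    · rw [← e] at hD
      have : X = D := Option.some_injective _ (hx.symm.trans hD)
      rw [this]
    · exact hT.2.1.row_le _ _ _ _ _ e hx hD
  have e2 : D.rank ≤ Y.rank := by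
    rcases h1.eq_or_lt with e | e
    · rw [e] at hD
      have : Y = D := Option.some_injective _ (hy.symm.trans hD)
      rw [this]
    · exact hT.2.1.col_le _ _ _ _ _ e hD hy
  exact e1.trans e2

theorem corner_of_mem_ShST {x y : Box} {X Y : Letter n} (hx : T x = some X) (hy : T y = some Y)
    (h1 : x.1 ≤ y.1) (h2 : x.2 ≤ y.2) :
    ∃ D, T (x.1, y.2) = some D ∧ X.rank ≤ D.rank ∧ D.rank ≤ Y.rank := by
  have hx' := l.isIdeal.shifted x (mem_skewShape_of_mem_ShST hT hx).1
  obtain ⟨D, hD⟩ := filled_of_mem_ShST hT hx hy (d := (x.1, y.2)) (hx'.trans h2) le_rfl h2 h1 le_rfl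
  exact ⟨D, hD, rank_le_of_mem_ShST hT hx hD le_rfl h2, rank_le_of_mem_ShST hT hD hy h1 le_rfl⟩

theorem below_of_mem_ShST {x y : Box} {k : Fin n} (hx : T x = some ⟨k, true⟩)
    (hy : T y = some ⟨k, true⟩) (hne : x ≠ y) (h : x.1 ≤ y.1) : Below x y := by
  have h1 : x.1 ≠ y.1 := by
    intro e
    refine hne (Prod.ext e (hT.2.1.row_unique x.1 x.2 y.2 k hx ?_))
    rw [e]; exact hy
  refine ⟨lt_of_le_of_ne h h1, not_lt.1 fun h2 => ?_⟩
  obtain ⟨⟨v, p⟩, hD, h3, h4⟩ := corner_of_mem_ShST hT hx hy h h2.le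
  have hv : v = k ∧ p = true := by
    cases p <;> simp [Letter.rank] at h3 h4 <;> constructor <;> first | rfl | (ext; omega) | omega
  obtain ⟨rfl, rfl⟩ := hv
  exact h2.ne (hT.2.1.row_unique _ _ _ _ hx hD)

theorem rightOf_of_mem_ShST {x y : Box} {k : Fin n} (hx : T x = some ⟨k, false⟩)
    (hy : T y = some ⟨k, false⟩) (hne : x ≠ y) (h : x.2 ≤ y.2) : RightOf x y := by
  have h1 : x.2 ≠ y.2 := by
    intro e
    refine hne (Prod.ext (hT.2.1.col_unique x.1 y.1 x.2 k hx ?_) e)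
    rw [e]; exact hy
  refine ⟨lt_of_le_of_ne h h1, not_lt.1 fun h2 => ?_⟩
  obtain ⟨⟨v, p⟩, hD, h3, h4⟩ := corner_of_mem_ShST hT hx hy h2.le h
  have hv : v = k ∧ p = false := by
    cases p <;> simp [Letter.rank] at h3 h4 <;> constructor <;> first | rfl | (ext; omega) | omega
  obtain ⟨rfl, rfl⟩ := hv
  exact h2.ne (hT.2.1.col_unique _ _ _ _ hD hy)

/-- Canonical form gives a `k`-letter read earlier. It cannot stand in the same row, since the row
increases and has only one `k'`, so it lies lower; repeat until it is unprimed. -/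
theorem exists_unprimed_of_mem_ShST {x : Box} {k : Fin n} (hx : T x = some ⟨k, true⟩) :
    ∃ d, T d = some ⟨k, false⟩ ∧ x.1 < d.1 := by
  induction hN : l.parts.length - x.1 using Nat.strong_induction_on generalizing x with
  | _ N ih =>
  obtain ⟨d, hd, p, hp⟩ := hT.2.2 x k hx
  have hlt : x.1 < d.1 := by
    rcases hd with hd | ⟨h1, h2⟩
    · exact hd
    · exfalso
      have h3 := rank_le_of_mem_ShST hT hp hx h1.le h2.le
      cases p
      · simp [Letter.rank] at h3
      · refine h2.ne (hT.2.1.row_unique d.1 d.2 x.2 k hp ?_)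
        rw [h1]; exact hx
  cases p
  · exact ⟨d, hp, hlt⟩
  · obtain ⟨hl, -⟩ := (mem_skewShape_of_mem_ShST hT hp).1
    obtain ⟨d', h1, h2⟩ := ih (l.parts.length - d.1) (by omega) hp rfl
    exact ⟨d', h1, hlt.trans h2⟩

theorem isIdeal_inner (k : Fin n) : IsIdeal (inner m T k) := by
  constructor
  · rintro x (h | ⟨X, hX, -⟩)
    · exact m.isIdeal.shifted x h
    · exact l.isIdeal.shifted x (mem_skewShape_of_mem_ShST hT hX).1
  · rintro x (h | ⟨X, hX, hXk⟩) d h1 h2 h3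
    · exact Or.inl (m.isIdeal.down x h d h1 h2 h3)
    · by_cases hd : d ∈ m.shape
      · exact Or.inl hd
      · have : d ∈ T.support := by
          rw [hT.1]
          exact ⟨l.isIdeal.down _ (mem_skewShape_of_mem_ShST hT hX).1 d h1 h2 h3, hd⟩
        obtain ⟨D, hD⟩ := this
        refine Or.inr ⟨D, hD, ?_⟩
        have := rank_le_of_mem_ShST hT hD hX h2 h3
        have : 2 * (D.val : ℕ) ≤ 2 * (X.val : ℕ) + 1 := by
          unfold Letter.rank at this
          split_ifs at this <;> omega
        have : (X.val : ℕ) < k := hXk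
        show (D.val : ℕ) < k
        omega

/-- Semistandardness makes the `k'` a descending chain and the `k` a rightward chain. Canonical form
is what joins the two: the first unprimed box lies below every primed one. -/
theorem exists_listing (k : Fin n) : ∃ P Q, Listing m T k P Q := by
  have hfin : ∀ p, {c | T c = some ⟨k, p⟩}.Finite := fun p =>
    l.finite_shape.subset fun c hc => (mem_skewShape_of_mem_ShST hT hc).1
  obtain ⟨P, hP, hP'⟩ := exists_sorted_list (hfin true) Prod.fst
  obtain ⟨Q, hQ, hQ'⟩ := exists_sorted_list (hfin false) Prod.snd
  simp only [Set.mem_ofPred_eq] at hP hQ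
  have hPB : P.Pairwise Below := hP'.imp_of_mem fun hx hy h =>
    below_of_mem_ShST hT ((hP _).2 hx) ((hP _).2 hy) h.1 h.2
  have hQR : Q.Pairwise RightOf := hQ'.imp_of_mem fun hx hy h =>
    rightOf_of_mem_ShST hT ((hQ _).2 hx) ((hQ _).2 hy) h.1 h.2
  refine ⟨P, Q, hP, hQ, hook_of hPB ?_ hQR, isIdeal_inner hT k, linExt_of_pairwise ?_ ?_ ?_ ?_⟩
  · intro x hx
    have hx' := (hP x).2 hx
    obtain ⟨d, hd, hxd⟩ := exists_unprimed_of_mem_ShST hT hx'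
    have hdQ := (hQ d).1 hd
    cases Q with
    | nil => simp at hdQ
    | cons q Q =>
      have hq : T q = some ⟨k, false⟩ := (hQ q).2 (by simp)
      have h1 : d.1 ≤ q.1 := by
        rcases List.mem_cons.1 hdQ with rfl | h
        · exact le_rfl
        · exact ((List.pairwise_cons.1 hQR).1 d h).2
      refine ⟨q, by simp, hxd.trans_le h1, not_lt.1 fun h2 => ?_⟩
      -- If `x` were strictly left of `q`, their corner would hold `k` or `k'` and repeat the entry
      -- of `q` in its column or that of `x` in its row.
      obtain ⟨⟨v, p⟩, hD, h3, h4⟩ := corner_of_mem_ShST hT hx' hq (hxd.le.trans h1) h2.le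
      have hv : v = k := by
        cases p <;> simp [Letter.rank] at h3 h4 <;> ext <;> omega
      subst hv
      cases p
      · exact (hxd.trans_le h1).ne (hT.2.1.col_unique _ _ _ _ hD hq)
      · exact h2.ne (hT.2.1.row_unique _ _ _ _ hx' hD)
  · intro x hx
    rcases List.mem_append.1 hx with hx | hx
    · exact l.isIdeal.shifted x (mem_skewShape_of_mem_ShST hT ((hP _).2 hx)).1
    · exact l.isIdeal.shifted x (mem_skewShape_of_mem_ShST hT ((hQ _).2 hx)).1
  · have key : ∀ x p, T x = some ⟨k, p⟩ → x ∉ inner m T k := by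
      rintro x p hx (h | ⟨X, hX, hXk⟩)
      · exact (mem_skewShape_of_mem_ShST hT hx).2 h
      · rw [hx] at hX
        obtain rfl := Option.some_injective _ hX
        exact lt_irrefl _ hXk
    intro x hx
    rcases List.mem_append.1 hx with hx | hx
    · exact key x _ ((hP _).2 hx)
    · exact key x _ ((hQ _).2 hx)
  · have key : ∀ x p, T x = some ⟨k, p⟩ → ∀ d : Box, d.1 ≤ d.2 → d.1 ≤ x.1 → d.2 ≤ x.2 →
        d ∈ inner m T k ∨ d ∈ P ++ Q := by
      intro x p hx d h1 h2 h3
      by_cases hd : d ∈ m.shape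
      · exact Or.inl (Or.inl hd)
      · have : d ∈ T.support := by
          rw [hT.1]
          exact ⟨l.isIdeal.down _ (mem_skewShape_of_mem_ShST hT hx).1 d h1 h2 h3, hd⟩
        obtain ⟨⟨v, p'⟩, hD⟩ := this
        have h4 := rank_le_of_mem_ShST hT hD hx h2 h3
        have h5 : (v : ℕ) ≤ k := by
          unfold Letter.rank at h4
          split_ifs at h4 <;> simp only at h4 <;> omega
        rcases h5.lt_or_eq with h6 | h6
        · exact Or.inl (Or.inr ⟨_, hD, h6⟩)
        · obtain rfl : v = k := Fin.ext h6
          right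
          cases p'
          · exact List.mem_append_right _ ((hQ d).1 hD)
          · exact List.mem_append_left _ ((hP d).1 hD)
    intro x hx
    rcases List.mem_append.1 hx with hx | hx
    · exact key x _ ((hP _).2 hx)
    · exact key x _ ((hQ _).2 hx)
  · refine List.pairwise_append.2 ⟨hPB.imp ?_, hQR.imp ?_, ?_⟩
    · rintro x y ⟨h1, -⟩ ⟨h2, -⟩
      omega
    · rintro x y ⟨h1, -⟩ ⟨-, h2⟩
      omega
    · rintro x hx y hy ⟨h1, h2⟩
      have := rank_le_of_mem_ShST hT ((hQ y).2 hy) ((hP x).2 hx) h1 h2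
      simp [Letter.rank] at this

end ShST

/-- Monotonicity comes from the linear extensions, and uniqueness in rows and columns from the
strict steps of the hooks. Canonical form holds because the first box of `Q` lies below all of `P`
and so is read before them. -/
theorem mem_ShST_of_listing {l m : StrictPartition} {T : Filling n}
    (hs : T.support = skewShape l m) (h : ∀ k, ∃ P Q, Listing m T k P Q) : T ∈ ShST l m n := by
  have hsk : ∀ {c x}, T c = some x → c ∈ skewShape l m := fun {c x} hc => by
    rw [← hs]; exact ⟨x, hc⟩
  have hle : ∀ {x y : Box} {X Y : Letter n}, T x = some X → T y = some Y → x ≠ y → x.1 ≤ y.1 →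
      x.2 ≤ y.2 → X.rank ≤ Y.rank := by
    rintro x y ⟨j, p⟩ ⟨k, p'⟩ hx hy hne h1 h2
    obtain ⟨P, Q, hL⟩ := h k
    have hy' := hL.hasVal_iff.1 ⟨_, hy⟩
    rcases hL.lin.down hy' x (l.isIdeal.shifted x (hsk hx).1) h1 h2 with (h3 | ⟨X, hX, hXk⟩) | h3
    · exact absurd h3 (hsk hx).2
    · rw [hx] at hX
      obtain rfl := Option.some_injective _ hX
      have : (j : ℕ) < k := hXk
      unfold Letter.rank
      split_ifs <;> simp only <;> omega
    · obtain rfl : k = j := (hL.hasVal_iff.2 h3).unique ⟨_, hx⟩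
      cases p <;> cases p' <;> simp [Letter.rank]
      have h4 := (List.pairwise_append.1 (LinExt.pairwise hL.ideal hL.lin)).2.2 y
        ((hL.primed y).1 hy) x ((hL.unprimed x).1 hx)
      exact h4 ⟨h1, h2⟩
  refine ⟨hs, ⟨?_, ?_, ?_, ?_⟩, ?_⟩
  · intro r s s' x y hss hx hy
    exact hle hx hy (by simp; omega) le_rfl hss.le
  · intro r r' s x y hrr hx hy
    exact hle hx hy (by simp; omega) hrr.le le_rfl
  · intro r r' s k hx hy
    obtain ⟨P, Q, hL⟩ := h k
    by_contra hne
    have hx' := (hL.unprimed _).1 hx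
    have hy' := (hL.unprimed _).1 hy
    have h1 : Q.Pairwise fun x y => x.2 ≠ y.2 := hL.hook.pairwise_right.imp fun h => h.1.ne
    have hsymm : Std.Symm fun x y : Box => x.2 ≠ y.2 := ⟨fun _ _ h => h.symm⟩
    exact h1.forall hx' hy' (by simpa using hne) rfl
  · intro r s s' k hx hy
    obtain ⟨P, Q, hL⟩ := h k
    by_contra hne
    have hx' := (hL.primed _).1 hx
    have hy' := (hL.primed _).1 hy
    have h1 : P.Pairwise fun x y => x.1 ≠ y.1 := hL.hook.below.1.imp fun h => h.1.ne
    have hsymm : Std.Symm fun x y : Box => x.1 ≠ y.1 := ⟨fun _ _ h => h.symm⟩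
    exact h1.forall hx' hy' (by simpa using hne) rfl
  · intro c k hc
    obtain ⟨P, Q, hL⟩ := h k
    obtain ⟨q, hq, hcq⟩ := hL.hook.below.2 c ((hL.primed c).1 hc)
    exact ⟨q, Or.inl hcq.1, false, (hL.unprimed q).2 (List.mem_of_mem_head? hq)⟩

theorem canonicalize_eq {T : Filling n} (hT : IsCanonical T) : canonicalize T = T := by
  funext c
  unfold canonicalize
  cases hc : T c with
  | none => rfl
  | some x =>
    obtain ⟨k, p⟩ := x
    simp only [Option.map_some, Option.some.injEq]
    split_ifs with h
    · rfl
    · cases p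
      · rfl
      · exact absurd (hT c k hc) h

/-! ### The Bender--Knuth operators on lists of boxes -/

/-- `L k` is the list of the boxes with the letters `k'` and `k`, in standard order. -/
def HasLists (m : StrictPartition) (T : Filling n) (L : Fin n → List Box) : Prop :=
  ∀ k, ∃ P Q, L k = P ++ Q ∧ Listing m T k P Q

theorem exists_hasLists {l m : StrictPartition} {T : Filling n} (hT : T ∈ ShST l m n) :
    ∃ L, HasLists m T L := by
  choose P Q h using exists_listing hT
  exact ⟨fun k => P k ++ Q k, fun k => ⟨P k, Q k, rfl, h k⟩⟩

theorem HasLists.unique {m : StrictPartition} {T T' : Filling n} {L : Fin n → List Box}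
    (h : HasLists m T L) (h' : HasLists m T' L) : T = T' := by
  have key : ∀ {T T' : Filling n}, HasLists m T L → HasLists m T' L →
      ∀ c x, T c = some x → T' c = some x := by
    rintro T T' h h' c ⟨k, p⟩ hc
    obtain ⟨P, Q, e, hk⟩ := h k
    obtain ⟨P', Q', e', hk'⟩ := h' k
    obtain ⟨rfl, rfl⟩ := hk.hook.unique hk'.hook (e.symm.trans e')
    cases p
    · exact (hk'.unprimed c).2 ((hk.unprimed c).1 hc)
    · exact (hk'.primed c).2 ((hk.primed c).1 hc)
  funext c
  cases hc : T c with
  | some x => exact (key h h' c x hc).symm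
  | none =>
    cases hc' : T' c with
    | none => rfl
    | some x =>
      rw [key h' h c x hc'] at hc
      simp at hc

theorem HasLists.weight_eq {m : StrictPartition} {T : Filling n} {L : Fin n → List Box}
    (h : HasLists m T L) (k : Fin n) : weight T k = (L k).length := by
  obtain ⟨P, Q, e, hk⟩ := h k
  have hn := LinExt.nodup hk.ideal hk.lin
  have : {c | HasVal T k c} = ((P ++ Q).toFinset : Set Box) := by
    ext c
    rw [Set.mem_ofPred_eq, hk.hasVal_iff]
    simp
  rw [weight, this, Set.ncard_coe_finset, List.toFinset_card_of_nodup hn, e]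

theorem inner_succ {m : StrictPartition} {T : Filling n} {a b : Fin n} (hab : (b : ℕ) = a + 1)
    {P Q : List Box} (h : Listing m T a P Q) :
    inner m T b = inner m T a ∪ {d | d ∈ P ++ Q} := by
  ext d
  rw [Set.mem_union, Set.mem_ofPred_eq, ← h.hasVal_iff]
  unfold inner
  simp only [Set.mem_union, Set.mem_ofPred_eq, or_assoc]
  refine or_congr_right ⟨?_, ?_⟩
  · rintro ⟨⟨k, p⟩, hx, hk⟩
    have : (k : ℕ) < b := hk
    rcases Nat.lt_or_ge k a with h1 | h1
    · exact Or.inl ⟨_, hx, h1⟩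
    · obtain rfl : k = a := Fin.ext (by omega)
      exact Or.inr ⟨p, hx⟩
  · rintro (⟨x, hx, hk⟩ | ⟨p, hx⟩)
    · refine ⟨x, hx, ?_⟩
      have : (x.val : ℕ) < a := hk
      show (x.val : ℕ) < b
      omega
    · exact ⟨_, hx, by show (a : ℕ) < b; omega⟩

/-- Interchange the letters `a` and `b`. -/
def swapLetters (a b : Fin n) (T : Filling n) : Filling n := fun c =>
  (T c).map fun x => ⟨Equiv.swap a b x.val, x.primed⟩

theorem swapLetters_eq_iff {a b : Fin n} {T : Filling n} {c : Box} {k : Fin n} {p : Bool} :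
    swapLetters a b T c = some ⟨k, p⟩ ↔ T c = some ⟨Equiv.swap a b k, p⟩ := by
  unfold swapLetters
  rw [Option.map_eq_some_iff]
  constructor
  · rintro ⟨⟨v, q⟩, h, e⟩
    simp only [Letter.mk.injEq] at e
    obtain ⟨rfl, rfl⟩ := e
    simpa using h
  · intro h
    exact ⟨_, h, by simp⟩

/-- After the process the `b`-hook extends the inner ideal and the `a`-hook extends the result.
Interchanging the two names therefore gives listings again, already in canonical form. -/
theorem mem_ShST_switching {l m : StrictPartition} {T : Filling n} (hT : T ∈ ShST l m n)
    {a b : Fin n} (hab : (b : ℕ) = a + 1) {P₁ Q₁ P Q : List Box} (ha : Listing m T a P₁ Q₁)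
    (hb : Listing m T b P Q) :
    swapLetters a b (switching a b T) ∈ ShST l m n ∧
      (∃ P' Q', (switch (P₁ ++ Q₁) (P ++ Q)).1 = P' ++ Q' ∧
        Listing m (swapLetters a b (switching a b T)) a P' Q') ∧
      (∃ P' Q', (switch (P₁ ++ Q₁) (P ++ Q)).2 = P' ++ Q' ∧
        Listing m (swapLetters a b (switching a b T)) b P' Q') ∧
      ∀ k P' Q', k ≠ a → k ≠ b → Listing m T k P' Q' →
        Listing m (swapLetters a b (switching a b T)) k P' Q' := by
  have hne : a ≠ b := fun e => by rw [e] at hab; omega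
  have hlin : LinExt (inner m T a) (P₁ ++ Q₁ ++ (P ++ Q)) :=
    linExt_append.2 ⟨ha.lin, by rw [← inner_succ hab ha]; exact hb.lin⟩
  have hsh : ∀ {c x}, T c = some x → c ∈ skewShape l m := fun hc =>
    mem_skewShape_of_mem_ShST hT hc
  obtain ⟨T', P', Q', P₂, Q₂, hs, e2, k2, l2, l3⟩ := exists_switched hne hb.hook
    (fun d => (hb.primed d).2) (fun d => (hb.unprimed d).2) ha.hook
    ⟨ha.ideal, hlin, fun d hd => Or.inr (hb.hasVal_iff.1 hd),
      fun d ⟨p, hd⟩ => l.isIdeal.shifted d (hsh hd).1⟩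
    (fun d => (ha.primed d).2) (fun d => (ha.unprimed d).2)
    (by
      rintro d (hd | ⟨x, hx, hxa⟩) ⟨p, hv⟩
      · exact absurd hd (hsh hv).2
      · rw [hv] at hx
        obtain rfl := Option.some_injective _ hx
        exact absurd hxa (lt_irrefl _))
  have hlin' := LinExt.switch ha.ideal (xs := P₁ ++ Q₁) (ys := P ++ Q) (L := []) (by simpa using hlin)
  rw [hs.eq, e2, List.append_nil] at hlin'
  have hmem : ∀ d, d ∈ P' ++ Q' ∨ d ∈ P₂ ++ Q₂ ↔ d ∈ P₁ ++ Q₁ ∨ d ∈ P ++ Q := by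
    intro d
    rw [← hs.eq, ← e2]
    exact mem_switch _ _ d
  have hT'b : ∀ d, d ∈ P' ++ Q' → HasVal T' b d := by
    intro d hd
    rcases List.mem_append.1 hd with hd | hd
    · exact ⟨_, hs.labP d hd⟩
    · exact ⟨_, hs.labQ d hd⟩
  have hT'a : ∀ d, d ∈ P₂ ++ Q₂ → HasVal T' a d := by
    intro d hd
    rcases List.mem_append.1 hd with hd | hd
    · exact ⟨_, l2 d hd⟩
    · exact ⟨_, l3 d hd⟩
  have hoff : ∀ d, ¬ (d ∈ P' ++ Q' ∨ d ∈ P₂ ++ Q₂) →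
      T' d = T d ∧ ¬ HasVal T a d ∧ ¬ HasVal T b d := by
    intro d hd
    rw [hmem, not_or] at hd
    rw [ha.hasVal_iff, hb.hasVal_iff]
    exact ⟨hs.off d hd.1 hd.2, hd⟩
  have hA : ∀ d, HasVal T' a d ↔ d ∈ P₂ ++ Q₂ := by
    refine fun d => ⟨fun hv => ?_, hT'a d⟩
    by_contra hcon
    by_cases h1 : d ∈ P' ++ Q'
    · exact hne (hv.unique (hT'b d h1))
    · obtain ⟨h2, h3, -⟩ := hoff d (by tauto)
      obtain ⟨p, hp⟩ := hv
      exact h3 ⟨p, by rw [← h2, hp]⟩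
  have hB : ∀ d, HasVal T' b d ↔ d ∈ P' ++ Q' := by
    refine fun d => ⟨fun hv => ?_, hT'b d⟩
    by_contra hcon
    by_cases h1 : d ∈ P₂ ++ Q₂
    · exact hne ((hT'a d h1).unique hv)
    · obtain ⟨h2, -, h3⟩ := hoff d (by tauto)
      obtain ⟨p, hp⟩ := hv
      exact h3 ⟨p, by rw [← h2, hp]⟩
  -- The inner ideal together with the new `b`-boxes is an ideal that contains no `a`-box, so no
  -- `a`-box is left of or above a `b`-box.
  have hfull : FullySwitched T' a b := by
    intro c hc ht
    rw [hA] at hc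
    have hl' := linExt_append.1 hlin'
    have hJ := ha.ideal.union hl'.1
    have key : ∀ e : Box, HasVal T' b e → c.1 ≤ e.1 → c.2 ≤ e.2 → False := by
      intro e he h1 h2
      rw [hB] at he
      exact hl'.2.notMem hc (hJ.down e (Or.inr he) c (hl'.2.shifted hc) h1 h2)
    rcases ht with ht | ht
    · exact key _ ht (by simp [Box.east]) (by simp [Box.east])
    · exact key _ ht (by simp [Box.south]) (by simp [Box.south])
  rw [hs.reaches.switching_eq hfull]
  set G := swapLetters a b T' with hG
  have hlab : ∀ {k : Fin n} {X Y : List Box},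
      (∀ d, HasVal T' k d ↔ d ∈ X ++ Y) → (∀ d ∈ X, T' d = some ⟨k, true⟩) →
      (∀ d ∈ Y, T' d = some ⟨k, false⟩) →
      (∀ d, T' d = some ⟨k, true⟩ ↔ d ∈ X) ∧ (∀ d, T' d = some ⟨k, false⟩ ↔ d ∈ Y) := by
    intro k X Y h1 h2 h3
    refine ⟨fun d => ⟨fun hd => ?_, h2 d⟩, fun d => ⟨fun hd => ?_, h3 d⟩⟩
    · refine (List.mem_append.1 ((h1 d).1 ⟨_, hd⟩)).resolve_right fun h4 => ?_
      rw [h3 d h4] at hd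
      simp at hd
    · refine (List.mem_append.1 ((h1 d).1 ⟨_, hd⟩)).resolve_left fun h4 => ?_
      rw [h2 d h4] at hd
      simp at hd
  have hG_off : ∀ d, ¬ (d ∈ P' ++ Q' ∨ d ∈ P₂ ++ Q₂) → G d = T d := by
    intro d hd
    obtain ⟨h1, h2, h3⟩ := hoff d hd
    rw [hG]
    unfold swapLetters
    rw [h1]
    cases hc : T d with
    | none => rfl
    | some x =>
      obtain ⟨v, p⟩ := x
      have h4 : v ≠ a := by rintro rfl; exact h2 ⟨p, hc⟩
      have h5 : v ≠ b := by rintro rfl; exact h3 ⟨p, hc⟩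
      simp [Equiv.swap_apply_of_ne_of_ne h4 h5]
  have hG_on : ∀ d, d ∈ P' ++ Q' ∨ d ∈ P₂ ++ Q₂ →
      ∃ j p j' p', G d = some ⟨j, p⟩ ∧ T d = some ⟨j', p'⟩ ∧
        (j = a ∨ j = b) ∧ (j' = a ∨ j' = b) := by
    intro d hd
    have h1 : HasVal T a d ∨ HasVal T b d := by
      rw [ha.hasVal_iff, hb.hasVal_iff, ← hmem]; exact hd
    have h2 : HasVal G b d ∨ HasVal G a d := by
      rcases hd with hd | hd
      · obtain ⟨p, hp⟩ := hT'b d hd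
        exact Or.inr ⟨p, swapLetters_eq_iff.2 (by simpa using hp)⟩
      · obtain ⟨p, hp⟩ := hT'a d hd
        exact Or.inl ⟨p, swapLetters_eq_iff.2 (by simpa using hp)⟩
    rcases h1 with ⟨p, h1⟩ | ⟨p, h1⟩ <;> rcases h2 with ⟨p', h2⟩ | ⟨p', h2⟩ <;>
      exact ⟨_, _, _, _, h2, h1, by simp, by simp⟩
  have hsupp : G.support = skewShape l m := by
    rw [← hT.1]
    ext d
    by_cases hd : d ∈ P' ++ Q' ∨ d ∈ P₂ ++ Q₂
    · obtain ⟨j, p, j', p', h1, h2, -⟩ := hG_on d hd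
      exact ⟨fun _ => ⟨_, h2⟩, fun _ => ⟨_, h1⟩⟩
    · show (∃ x, G d = some x) ↔ ∃ x, T d = some x
      rw [hG_off d hd]
  -- As `a` and `b` are consecutive, they lie on the same side of every threshold `k` other than
  -- `b`.
  have hinner : ∀ k, k ≠ b → inner m G k = inner m T k := by
    intro k hk
    unfold inner
    congr 1
    ext d
    simp only [Set.mem_ofPred_eq]
    by_cases hd : d ∈ P' ++ Q' ∨ d ∈ P₂ ++ Q₂
    · obtain ⟨j, p, j', p', h1, h2, h3, h4⟩ := hG_on d hd
      rw [h1, h2]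
      simp only [Option.some.injEq, exists_eq_left']
      have h5 : (k : ℕ) ≠ b := fun e => hk (Fin.ext e)
      rw [Fin.lt_def, Fin.lt_def]
      rcases h3 with rfl | rfl <;> rcases h4 with rfl | rfl <;> omega
    · rw [hG_off d hd]
  have hLa : Listing m G a P' Q' := by
    obtain ⟨h1, h2⟩ := hlab hB hs.labP hs.labQ
    have hi := hinner a hne
    refine ⟨fun c => ?_, fun c => ?_, hs.hook, hi ▸ ha.ideal, hi ▸ (linExt_append.1 hlin').1⟩
    · rw [hG, swapLetters_eq_iff, Equiv.swap_apply_left, h1]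
    · rw [hG, swapLetters_eq_iff, Equiv.swap_apply_left, h2]
  have hLb : Listing m G b P₂ Q₂ := by
    obtain ⟨h1, h2⟩ := hlab hA l2 l3
    have hi := inner_succ hab hLa
    rw [hinner a hne] at hi
    have hl' := linExt_append.1 hlin'
    refine ⟨fun c => ?_, fun c => ?_, k2, hi ▸ ha.ideal.union hl'.1, hi ▸ hl'.2⟩
    · rw [hG, swapLetters_eq_iff, Equiv.swap_apply_right, h1]
    · rw [hG, swapLetters_eq_iff, Equiv.swap_apply_right, h2]
  have hLk : ∀ k X Y, k ≠ a → k ≠ b → Listing m T k X Y → Listing m G k X Y := by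
    intro k X Y hka hkb h
    have hi := hinner k hkb
    have key : ∀ c p, G c = some ⟨k, p⟩ ↔ T c = some ⟨k, p⟩ := by
      intro c p
      by_cases hc : c ∈ P' ++ Q' ∨ c ∈ P₂ ++ Q₂
      · obtain ⟨j, q, j', q', h1, h2, h3, h4⟩ := hG_on c hc
        rw [h1, h2]
        simp only [Option.some.injEq, Letter.mk.injEq]
        rcases h3 with rfl | rfl <;> rcases h4 with rfl | rfl <;> simp [hka.symm, hkb.symm]
      · rw [hG_off c hc]
    exact ⟨fun c => (key c _).trans (h.primed c), fun c => (key c _).trans (h.unprimed c), h.hook,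
      hi ▸ h.ideal, hi ▸ h.lin⟩
  refine ⟨mem_ShST_of_listing hsupp fun k => ?_, ⟨P', Q', hs.eq, hLa⟩, ⟨P₂, Q₂, e2, hLb⟩, hLk⟩
  by_cases hka : k = a
  · exact ⟨P', Q', hka ▸ hLa⟩
  by_cases hkb : k = b
  · exact ⟨P₂, Q₂, hkb ▸ hLb⟩
  obtain ⟨X, Y, h⟩ := exists_listing hT k
  exact ⟨X, Y, hLk k X Y hka hkb h⟩

/-- The Bender--Knuth operators on families of lists of boxes. -/
def bkLists (i : ℕ) (L : Fin n → List Box) : Fin n → List Box :=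
  if h : 1 ≤ i ∧ i < n then
    Function.update (Function.update L ⟨i - 1, by omega⟩ (switch (L ⟨i - 1, by omega⟩) (L ⟨i, h.2⟩)).1)
      ⟨i, h.2⟩ (switch (L ⟨i - 1, by omega⟩) (L ⟨i, h.2⟩)).2
  else L

theorem HasLists.bk {l m : StrictPartition} {T : Filling n} (hT : T ∈ ShST l m n)
    {L : Fin n → List Box} (hL : HasLists m T L) (i : ℕ) :
    ShiftedBK.bk i T ∈ ShST l m n ∧ HasLists m (ShiftedBK.bk i T) (bkLists i L) := by
  unfold ShiftedBK.bk bkLists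
  split_ifs with h
  · have hi : ((⟨i, h.2⟩ : Fin n) : ℕ) = (⟨i - 1, by omega⟩ : Fin n) + 1 := by simp; omega
    generalize (⟨i, h.2⟩ : Fin n) = b at *
    generalize (⟨i - 1, by omega⟩ : Fin n) = a at *
    obtain ⟨P₁, Q₁, e₁, h₁⟩ := hL a
    obtain ⟨P, Q, e, hb⟩ := hL b
    obtain ⟨hG, ha', hb', hk'⟩ := mem_ShST_switching hT hi h₁ hb
    -- The relabelled filling is already canonical, so the canonicalization in the definition of the
    -- operator changes nothing.
    have hcan : permFilling (Equiv.swap a b) (switching a b T) =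
        swapLetters a b (switching a b T) := canonicalize_eq hG.2.2
    simp only [hcan]
    refine ⟨hG, fun k => ?_⟩
    rw [e₁, e]
    by_cases hkb : k = b
    · subst hkb
      simpa using hb'
    by_cases hka : k = a
    · subst hka
      simpa [hkb] using ha'
    · obtain ⟨X, Y, eX, hX⟩ := hL k
      exact ⟨X, Y, by simpa [hka, hkb] using eX, hk' k X Y hka hkb hX⟩
  · exact ⟨hT, hL⟩

theorem bkLists_bkLists (i : ℕ) (L : Fin n → List Box) : bkLists i (bkLists i L) = L := by
  unfold bkLists
  split_ifs with h
  · have hne : (⟨i - 1, by omega⟩ : Fin n) ≠ ⟨i, h.2⟩ := by simp; omega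
    generalize (⟨i, h.2⟩ : Fin n) = b at *
    generalize (⟨i - 1, by omega⟩ : Fin n) = a at *
    funext k
    by_cases hkb : k = b
    · subst hkb
      simp [hne, switch_switch]
    by_cases hka : k = a
    · subst hka
      simp [hne, switch_switch]
    · simp [hka, hkb]
  · rfl

/-- The two operators act on disjoint pairs of letters. -/
theorem bkLists_comm {i j : ℕ} (hij : i + 1 < j) (L : Fin n → List Box) :
    bkLists i (bkLists j L) = bkLists j (bkLists i L) := by
  unfold bkLists
  by_cases hi : 1 ≤ i ∧ i < n
  · by_cases hj : 1 ≤ j ∧ j < n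
    · simp only [hi, hj, and_self, dif_pos]
      have h1 : (⟨i - 1, by omega⟩ : Fin n) ≠ ⟨j, hj.2⟩ := by simp; omega
      have h2 : (⟨i - 1, by omega⟩ : Fin n) ≠ ⟨j - 1, by omega⟩ := by simp; omega
      have h3 : (⟨i, hi.2⟩ : Fin n) ≠ ⟨j, hj.2⟩ := by simp; omega
      have h4 : (⟨i, hi.2⟩ : Fin n) ≠ ⟨j - 1, by omega⟩ := by simp; omega
      generalize (⟨i, hi.2⟩ : Fin n) = b at *
      generalize (⟨i - 1, by omega⟩ : Fin n) = a at *
      generalize (⟨j, hj.2⟩ : Fin n) = d at *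
      generalize (⟨j - 1, by omega⟩ : Fin n) = c at *
      funext k
      simp only [Function.update_apply]
      simp only [h1, h2, h3, h4, h1.symm, h2.symm, h3.symm, h4.symm, if_false]
      split_ifs <;> simp_all
    · simp [hj]
  · simp [hi]

theorem length_bkLists (i : ℕ) (h : 1 ≤ i ∧ i < n) (L : Fin n → List Box) (k : Fin n) :
    (bkLists i L k).length =
      (L (Equiv.swap (⟨i - 1, by omega⟩ : Fin n) ⟨i, h.2⟩ k)).length := by
  unfold bkLists
  rw [dif_pos h]
  have hne : (⟨i - 1, by omega⟩ : Fin n) ≠ ⟨i, h.2⟩ := by simp; omega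
  generalize (⟨i, h.2⟩ : Fin n) = b at *
  generalize (⟨i - 1, by omega⟩ : Fin n) = a at *
  by_cases hkb : k = b
  · subst hkb
    simp [length_switch]
  by_cases hka : k = a
  · subst hka
    simp [hkb, length_switch]
  · simp [hka, hkb, Equiv.swap_apply_of_ne_of_ne hka hkb]

/-! ### Promotion and evacuation -/

section Evacuation

variable {G : Type*} [Group G] {t p q : ℕ → G}

theorem commute_promotion (hc : ∀ i j, i + 1 < j → Commute (t i) (t j)) (p0 : p 0 = 1)
    (ps : ∀ i, p (i + 1) = t (i + 1) * p i) {i j : ℕ} (hij : i + 1 < j) : Commute (p i) (t j) := by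
  induction i with
  | zero => rw [p0]; exact Commute.one_left _
  | succ i ih => rw [ps]; exact (hc _ _ hij).mul_left (ih (by omega))

theorem commute_evacuation (hc : ∀ i j, i + 1 < j → Commute (t i) (t j)) (p0 : p 0 = 1)
    (ps : ∀ i, p (i + 1) = t (i + 1) * p i) (q0 : q 0 = 1) (qs : ∀ i, q (i + 1) = q i * p (i + 1))
    {i j : ℕ} (hij : i + 1 < j) : Commute (q i) (t j) := by
  induction i with
  | zero => rw [q0]; exact Commute.one_left _
  | succ i ih => rw [qs]; exact (ih (by omega)).mul_left (commute_promotion hc p0 ps hij)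

/-- By induction: in `q_{i+2} = q_{i+1} p_{i+2} = p_{i+1}⁻¹ q_i t_{i+2} p_{i+1}` the involution
`t_{i+2}` commutes with `q_i` and is absorbed into `p_{i+2}⁻¹`, which leaves `q_i p_{i+1} =
q_{i+1}`. -/
theorem evacuation_succ (ht : ∀ i, t i * t i = 1) (hc : ∀ i j, i + 1 < j → Commute (t i) (t j))
    (p0 : p 0 = 1) (ps : ∀ i, p (i + 1) = t (i + 1) * p i) (q0 : q 0 = 1)
    (qs : ∀ i, q (i + 1) = q i * p (i + 1)) (i : ℕ) : q (i + 1) = (p (i + 1))⁻¹ * q i := by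
  induction i with
  | zero =>
    rw [qs, ps, p0, q0, mul_one, mul_one, one_mul]
    exact (inv_eq_of_mul_eq_one_left (ht 1)).symm
  | succ i ih =>
    have h1 := (commute_evacuation hc p0 ps q0 qs (show i + 1 < i + 2 by omega)).eq
    have h2 := inv_eq_of_mul_eq_one_left (ht (i + 2))
    calc q (i + 2) = (p (i + 1))⁻¹ * (q i * t (i + 2)) * p (i + 1) := by
          rw [qs (i + 1), ps (i + 1), ih]; simp only [mul_assoc]
      _ = (p (i + 2))⁻¹ * (q i * p (i + 1)) := by
          rw [h1, ps (i + 1), mul_inv_rev, h2]; simp only [mul_assoc]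
      _ = (p (i + 2))⁻¹ * q (i + 1) := by rw [qs i]

/-- Combining the two factorizations, `q_{i+1} ^ 2 = p_{i+1}⁻¹ q_i q_i p_{i+1}`, so the claim passes
from `i` to `i + 1`. -/
theorem evacuation_mul_self (ht : ∀ i, t i * t i = 1)
    (hc : ∀ i j, i + 1 < j → Commute (t i) (t j)) (p0 : p 0 = 1)
    (ps : ∀ i, p (i + 1) = t (i + 1) * p i) (q0 : q 0 = 1) (qs : ∀ i, q (i + 1) = q i * p (i + 1))
    (i : ℕ) : q i * q i = 1 := by
  induction i with
  | zero => rw [q0, one_mul]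
  | succ i ih =>
    nth_rewrite 1 [evacuation_succ ht hc p0 ps q0 qs i]
    rw [qs, mul_assoc, ← mul_assoc (q i), ih, one_mul, inv_mul_cancel]

end Evacuation

/-! ### Relations between the operators on tableaux, and their effect on weights -/

variable {l m : StrictPartition}

theorem bk_mem {T : Filling n} (hT : T ∈ ShST l m n) (i : ℕ) : bk i T ∈ ShST l m n := by
  obtain ⟨L, hL⟩ := exists_hasLists hT
  exact (hL.bk hT i).1

theorem bk_bk {T : Filling n} (hT : T ∈ ShST l m n) (i : ℕ) : bk i (bk i T) = T := by
  obtain ⟨L, hL⟩ := exists_hasLists hT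
  have h := hL.bk hT i
  have h2 := (h.2.bk h.1 i).2
  rw [bkLists_bkLists] at h2
  exact h2.unique hL

theorem bk_comm {T : Filling n} (hT : T ∈ ShST l m n) {i j : ℕ} (hij : i + 1 < j) :
    bk i (bk j T) = bk j (bk i T) := by
  obtain ⟨L, hL⟩ := exists_hasLists hT
  have h1 := hL.bk hT i
  have h2 := hL.bk hT j
  have h3 := (h2.2.bk h2.1 i).2
  rw [bkLists_comm hij] at h3
  exact h3.unique (h1.2.bk h1.1 j).2

theorem weight_bk {T : Filling n} (hT : T ∈ ShST l m n) {i : ℕ} (h : 1 ≤ i ∧ i < n) (k : Fin n) :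
    weight (bk i T) k = weight T (Equiv.swap (⟨i - 1, by omega⟩ : Fin n) ⟨i, h.2⟩ k) := by
  obtain ⟨L, hL⟩ := exists_hasLists hT
  rw [(hL.bk hT i).2.weight_eq, hL.weight_eq, length_bkLists i h]

theorem promotion_mem {T : Filling n} (hT : T ∈ ShST l m n) (i : ℕ) :
    promotion i T ∈ ShST l m n := by
  induction i with
  | zero => exact hT
  | succ i ih => exact bk_mem ih _

theorem q_mem {T : Filling n} (hT : T ∈ ShST l m n) (i : ℕ) : q i T ∈ ShST l m n := by
  induction i generalizing T with
  | zero => exact hT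
  | succ i ih => exact ih (promotion_mem hT _)

/-- Promotion acts on weights as the cycle composed of the transpositions. The index `j` is a
variable fixed by its value, so the induction is arithmetic in `ℕ`. -/
theorem weight_promotion {T : Filling n} (hT : T ∈ ShST l m n) {i : ℕ} (hi : i < n) (k j : Fin n)
    (hj : (j : ℕ) = if (k : ℕ) < i then (k : ℕ) + 1 else if (k : ℕ) = i then 0 else k) :
    weight (promotion i T) k = weight T j := by
  induction i generalizing k j with
  | zero =>
    have : j = k := Fin.ext (by split_ifs at hj <;> omega)
    rw [this]; rfl
  | succ i ih =>
    show weight (bk (i + 1) (promotion i T)) k = _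
    rw [weight_bk (promotion_mem hT i) ⟨by omega, hi⟩]
    apply ih (by omega)
    rw [Equiv.swap_apply_def]
    simp only [Fin.ext_iff]
    split_ifs at * <;> simp at * <;> omega

/-- Reversing `0, ..., i` and then applying the cycle on `0, ..., i + 1` reverses `0, ..., i + 1`.
-/
theorem weight_q {T : Filling n} (hT : T ∈ ShST l m n) {i : ℕ} (hi : i < n) (k j : Fin n)
    (hj : (j : ℕ) = if (k : ℕ) ≤ i then i - (k : ℕ) else k) :
    weight (q i T) k = weight T j := by
  induction i generalizing T k j with
  | zero =>
    have : j = k := Fin.ext (by split_ifs at hj <;> omega)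
    rw [this]; rfl
  | succ i ih =>
    have hlt : (if (k : ℕ) ≤ i then i - (k : ℕ) else k) < n := by split_ifs <;> omega
    show weight (q i (promotion (i + 1) T)) k = _
    rw [ih (promotion_mem hT _) (by omega) k ⟨_, hlt⟩ rfl]
    apply weight_promotion hT hi
    simp only
    split_ifs at * <;> omega

/-- The Bender--Knuth operators as permutations of the set of tableaux. -/
noncomputable def bkPerm (l m : StrictPartition) (n i : ℕ) : Equiv.Perm (ShST l m n) where
  toFun T := ⟨bk i T.1, bk_mem T.2 i⟩
  invFun T := ⟨bk i T.1, bk_mem T.2 i⟩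
  left_inv T := Subtype.ext (bk_bk T.2 i)
  right_inv T := Subtype.ext (bk_bk T.2 i)

/-- Promotion as a permutation of the set of tableaux. -/
noncomputable def promotionPerm (l m : StrictPartition) (n : ℕ) : ℕ → Equiv.Perm (ShST l m n)
  | 0 => 1
  | i + 1 => bkPerm l m n (i + 1) * promotionPerm l m n i

/-- The operators `q_i` as permutations of the set of tableaux. -/
noncomputable def qPerm (l m : StrictPartition) (n : ℕ) : ℕ → Equiv.Perm (ShST l m n)
  | 0 => 1
  | i + 1 => qPerm l m n i * promotionPerm l m n (i + 1)

theorem coe_promotionPerm (i : ℕ) (T : ShST l m n) :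
    (promotionPerm l m n i T : Filling n) = promotion i T := by
  induction i with
  | zero => rfl
  | succ i ih =>
    show bk (i + 1) (promotionPerm l m n i T : Filling n) = bk (i + 1) (promotion i T)
    rw [ih]

theorem coe_qPerm (i : ℕ) (T : ShST l m n) : (qPerm l m n i T : Filling n) = q i T := by
  induction i generalizing T with
  | zero => rfl
  | succ i ih =>
    show (qPerm l m n i (promotionPerm l m n (i + 1) T) : Filling n) = q i (promotion (i + 1) T)
    rw [ih, coe_promotionPerm]

/-- The group argument asks for the relations at all indices; they hold because `bk` is the identity
outside the range `1, ..., n - 1`. -/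
theorem q_q {T : Filling n} (hT : T ∈ ShST l m n) (i : ℕ) : q i (q i T) = T := by
  have h : qPerm l m n i * qPerm l m n i = 1 :=
    evacuation_mul_self (t := bkPerm l m n) (p := promotionPerm l m n)
      (fun i => Equiv.ext fun T => Subtype.ext (bk_bk T.2 i))
      (fun i j hij => Equiv.ext fun T => Subtype.ext (bk_comm T.2 hij))
      rfl (fun _ => rfl) rfl (fun _ => rfl) i
  have h2 := congrArg Subtype.val (Equiv.congr_fun h ⟨T, hT⟩)
  rwa [Equiv.Perm.mul_apply, coe_qPerm, coe_qPerm] at h2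

end ShiftedBK

theorem mainTheorem10 (n : ℕ) (l m : ShiftedBK.StrictPartition) (hml : m.shape ⊆ l.shape)
    (i : ℕ) (hi : 1 ≤ i) (hin : i < n) :
    ∀ T ∈ ShiftedBK.ShST l m n,
      ShiftedBK.q i T ∈ ShiftedBK.ShST l m n ∧
      ShiftedBK.q i (ShiftedBK.q i T) = T ∧
      ShiftedBK.weight (ShiftedBK.q i T) =
        ShiftedBK.permVector (ShiftedBK.longest n 1 (i + 1)) (ShiftedBK.weight T) := by
  intro T hT
  refine ⟨ShiftedBK.q_mem hT i, ShiftedBK.q_q hT i, funext fun k => ?_⟩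
  refine ShiftedBK.weight_q hT hin k _ ?_
  -- The inverse in `permVector` disappears by definition, since `longest` is built from an
  -- involution that serves as its own inverse.
  show ((ShiftedBK.reverseBetween n 1 (i + 1) k : Fin n) : ℕ) = _
  unfold ShiftedBK.reverseBetween
  split_ifs <;> first | omega | (simp only; omega)
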